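/- Let $d\in\mathbb{N}$, let $\mathbb{F}_d^*$ be the free unital semigroup on $d$ generators, let $\ell^2(\mathbb{F}_d^*)$ have orthonormal basis $\{\xi_w\}$, let $L_w\xi_u=\xi_{wu}$, and let $\mathcal{L}_d$ be the unital WOT-closed algebra generated by the $L_w$, with the weak*-continuous comultiplication $\Delta:\mathcal{L}_d\to\mathcal{L}_d\overline{\otimes}\mathcal{L}_d$ determined by $\Delta(L_w)=L_w\otimes L_w$. Let $\mathcal{J}$ be a homogeneous Hopf ideal of $\mathcal{L}_d$, i.e. a WOT-closed two-sided ideal that is generated, as a WOT-closed two-sided ideal, by homogeneous polynomials in the $L_i$ and satisfies $\Delta(\mathcal{J})\subseteq\overline{\mathcal{J}\otimes\mathcal{L}_d+\mathcal{L}_d\otimes\mathcal{J}}^{w^*}$. Put $\mathcal{N}_{\mathcal{J}}=(\mathcal{J}\xi_\varnothing)^\perp$, $\pi_{\mathcal{J}}(A)=P_{\mathcal{N}_{\mathcal{J}}}A|_{\mathcal{N}_{\mathcal{J}}}$ and $\mathcal{L}_{\mathcal{J}}=\pi_{\mathcal{J}}(\mathcal{L}_d)$, with the comultiplication $\Delta_{\mathcal{J}}\circ\pi_{\mathcal{J}}=(\pi_{\mathcal{J}}\otimes\pi_{\mathcal{J}})\circ\Delta$.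 Let $S$ be the quotient of $\mathbb{F}_d^*\cup\{0\}$ by the congruence $u\sim v\iff L_u-L_v\in\mathcal{J}$ (where $L_0=0$), and for $s\in S$ let $L_s=\pi_{\mathcal{J}}(L_w)$ for any $w$ in the class $s$. The predual $(\mathcal{L}_{\mathcal{J}})_*$ is the space of weak*-continuous functionals on $\mathcal{L}_{\mathcal{J}}$; it carries the product $\varphi\star\psi=(\varphi\otimes\psi)\circ\Delta_{\mathcal{J}}$ and the comultiplication dual to the multiplication of $\mathcal{L}_{\mathcal{J}}$, which sends $\varphi$ to the bilinear functional $(A,B)\mapsto\varphi(AB)$. Let $\theta:(\mathcal{L}_{\mathcal{J}})_*\to(\mathcal{L}_{\mathcal{J}})_*$ be a bounded linear map with adjoint $\theta^*:\mathcal{L}_{\mathcal{J}}\to\mathcal{L}_{\mathcal{J}}$. Then the following are equivalent: (i) $\theta$ is a Hopf convolution algebra automorphism, i.e. $\theta$ is bijective, $\theta(\varphi\star\psi)=\theta(\varphi)\star\theta(\psi)$ for all $\varphi,\psi$, and $\theta$ intertwines the comultiplication of $(\mathcal{L}_{\mathcal{J}})_*$; (ii) $\theta^*$ is a Hopf dual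 algebra automorphism of $\mathcal{L}_{\mathcal{J}}$, i.e. a weak*-continuous automorphism of the unital algebra $\mathcal{L}_{\mathcal{J}}$ such that $\theta^*\otimes\theta^*$ extends to a weak*-continuous linear map of $\mathcal{L}_{\mathcal{J}}\overline{\otimes}\mathcal{L}_{\mathcal{J}}$ and $\Delta_{\mathcal{J}}\circ\theta^*=(\theta^*\otimes\theta^*)\circ\Delta_{\mathcal{J}}$; (iii) there is a unital zero-preserving semigroup automorphism $\sigma$ of $S$ such that $\theta^*(L_s)=L_{\sigma(s)}$ for all $s\in S$. Moreover, a linear map $\alpha:\mathcal{L}_d\to\mathcal{L}_d$ is a Hopf dual algebra automorphism of $(\mathcal{L}_d,\Delta)$ if and only if there is a permutation $\tau$ of $\{1,\dots,d\}$ such that $\alpha(A)=UAU^*$ for all $A\in\mathcal{L}_d$, where $U$ is the unitary with $U\xi_{i_1\cdots i_k}=\xi_{\tau(i_1)\cdots\tau(i_k)}$. -/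

import Mathlib

open scoped InnerProductSpace TensorProduct Topology

noncomputable section

namespace NCToeplitz

/-! ### Hilbert space tensor products, ampliations and the weak* topology of `B(K)` -/

section General

variable {K K' : Type*} [NormedAddCommGroup K] [InnerProductSpace ℂ K]
  [NormedAddCommGroup K'] [InnerProductSpace ℂ K']

/-- The Hilbert space tensor square `K ⊗ K`: the completion of the algebraic one. -/
abbrev TensorSq (K : Type*) [NormedAddCommGroup K] [InnerProductSpace ℂ K] : Type _ :=
  UniformSpace.Completion (K ⊗[ℂ] K)

/-- The elementary tensor `x ⊗ y` in `K ⊗ K`. -/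
def tmul (x y : K) : TensorSq K := ((x ⊗ₜ[ℂ] y : K ⊗[ℂ] K) : TensorSq K)

/-- The operator `A ⊗ B : K ⊗ K → K' ⊗ K'`. -/
def opTensor (A B : K →L[ℂ] K') : TensorSq K →L[ℂ] TensorSq K' :=
  (TensorProduct.mapL A B).completion

theorem memℓp_ampliation (ι : Type*) (T : K →L[ℂ] K) (x : lp (fun _ : ι => K) 2) :
    Memℓp (fun i => T (x i)) 2 := by
  have h := (lp.memℓp x)
  refine memℓp_gen ?_
  have h2 := h.summable (by norm_num)
  refine Summable.of_nonneg_of_le (fun i => by positivity) (fun i => ?_)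
    (h2.mul_left (‖T‖ ^ (2 : ENNReal).toReal))
  rw [← Real.mul_rpow (norm_nonneg _) (norm_nonneg _)]
  exact Real.rpow_le_rpow (norm_nonneg _) (T.le_opNorm _) (by norm_num)

/-- The ampliation of `T ∈ B(K)` to the Hilbert space direct sum of `ι` copies of `K`,
`(x_i)_i ↦ (T x_i)_i`. -/
def ampliation (ι : Type*) (T : K →L[ℂ] K) :
    lp (fun _ : ι => K) 2 →L[ℂ] lp (fun _ : ι => K) 2 :=
  LinearMap.mkContinuous
    { toFun := fun x => ⟨fun i => T (x i), memℓp_ampliation ι T x⟩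
      map_add' := fun x y => by ext i; exact map_add T _ _
      map_smul' := fun c x => by ext i; exact map_smul T c _ } ‖T‖ (by
    intro x
    refine lp.norm_le_of_tsum_le (by norm_num) (by positivity) ?_
    have h2 := (lp.memℓp x).summable (by norm_num)
    rw [Real.mul_rpow (norm_nonneg _) (norm_nonneg _), lp.norm_rpow_eq_tsum (by norm_num) x,
      ← tsum_mul_left]
    refine Summable.tsum_le_tsum (fun i => ?_)
      ((memℓp_ampliation ι T x).summable (by norm_num)) (h2.mul_left _)
    rw [← Real.mul_rpow (norm_nonneg _) (norm_nonneg _)]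
    exact Real.rpow_le_rpow (norm_nonneg _) (T.le_opNorm _) (by norm_num))

@[simp]
theorem ampliation_apply (ι : Type*) (T : K →L[ℂ] K) (x : lp (fun _ : ι => K) 2) (i : ι) :
    (ampliation ι T x : ι → K) i = T (x i) := rfl

/-- The ampliation to countably many copies, with values in the operators with the weak
operator topology. -/
def ampliationWOT (K : Type*) [NormedAddCommGroup K] [InnerProductSpace ℂ K] :
    (K →L[ℂ] K) →ₗ[ℂ] (lp (fun _ : ℕ => K) 2 →WOT[ℂ] lp (fun _ : ℕ => K) 2) where
  toFun T := ContinuousLinearMapWOT.ofCLM (ampliation ℕ T)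
  map_add' S T := by ext x i; rfl
  map_smul' c T := by ext x i; rfl

/-- The weak* (ultraweak) topology of `B(K)`, the coarsest one that makes every functional
`T ↦ ∑ₙ ⟪yₙ, T xₙ⟫` with `∑ ‖xₙ‖² < ∞`, `∑ ‖yₙ‖² < ∞` continuous. -/
abbrev weakStar (K : Type*) [NormedAddCommGroup K] [InnerProductSpace ℂ K] :
    TopologicalSpace (K →L[ℂ] K) :=
  TopologicalSpace.induced (ampliationWOT K) inferInstance

/-- The relative weak* topology on a subset of `B(K)`. -/
abbrev weakStarOn (s : Set (K →L[ℂ] K)) : TopologicalSpace s :=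
  TopologicalSpace.induced Subtype.val (weakStar K)

/-- The weak* closed linear span of a set of operators. -/
def weakStarSpan (s : Set (K →L[ℂ] K)) : Submodule ℂ (K →L[ℂ] K) :=
  letI : TopologicalSpace (K →L[ℂ] K) := weakStar K
  haveI : ContinuousAdd (K →L[ℂ] K) := continuousAdd_induced (ampliationWOT K)
  haveI : ContinuousConstSMul ℂ (K →L[ℂ] K) :=
    ⟨fun c => continuous_induced_rng.2 (by
      have h : Continuous fun T : K →L[ℂ] K => ampliationWOT K T := continuous_induced_dom
      have h' : (ampliationWOT K) ∘ (fun T => c • T) = fun T => c • ampliationWOT K T := by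
        funext T; exact map_smul _ _ _
      rw [h']
      exact h.const_smul c)⟩
  (Submodule.span ℂ s).topologicalClosure

/-- A set of operators is closed in the weak operator topology. -/
def IsWOTClosed (s : Set (K →L[ℂ] K)) : Prop :=
  IsClosed ((ContinuousLinearMapWOT.toCLM : (K →WOT[ℂ] K) → (K →L[ℂ] K)) ⁻¹' s)

/-! ### Hopf dual algebras, preduals and their automorphisms -/

/-- The normal tensor product `A ⊗̄ A ⊆ B(K ⊗ K)`. -/
def normalTensor (A : Subalgebra ℂ (K →L[ℂ] K)) :
    Submodule ℂ (TensorSq K →L[ℂ] TensorSq K) :=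
  weakStarSpan {T | ∃ a ∈ A, ∃ b ∈ A, T = opTensor a b}

/-- The predual `A_*`, realised (with the norm of the dual of `A`) as the space of the weak*
continuous linear functionals on `A`, i.e. of the functionals `a ↦ Tr(T a)`, `T` trace class. -/
def Predual (A : Subalgebra ℂ (K →L[ℂ] K)) : Submodule ℂ (A →L[ℂ] ℂ) where
  carrier := {φ | Continuous[weakStarOn (A : Set (K →L[ℂ] K)), inferInstance] (fun a : A => φ a)}
  zero_mem' := by
    let _ : TopologicalSpace A := weakStarOn (A : Set (K →L[ℂ] K))
    exact continuous_const
  add_mem' := fun {φ ψ} hφ hψ => by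
    let _ : TopologicalSpace A := weakStarOn (A : Set (K →L[ℂ] K))
    exact Continuous.add hφ hψ
  smul_mem' := fun c φ hφ => by
    let _ : TopologicalSpace A := weakStarOn (A : Set (K →L[ℂ] K))
    exact Continuous.const_smul hφ c

/-- For a comultiplication `Δ : A → A ⊗̄ A`: `χ = φ ⋆ ψ`, that is `χ = (φ ⊗ ψ) ∘ Δ`. Here `ω`
is (an extension to `B(K ⊗ K)` of) the weak* continuous functional `φ ⊗ ψ` on `A ⊗̄ A`, which is
determined by its values on elementary tensors. -/
def IsConvolution (A : Subalgebra ℂ (K →L[ℂ] K)) (Δ : A → (TensorSq K →L[ℂ] TensorSq K))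
    (φ ψ χ : Predual A) : Prop :=
  ∃ ω : (TensorSq K →L[ℂ] TensorSq K) →ₗ[ℂ] ℂ,
    Continuous[weakStar (TensorSq K), inferInstance] ω ∧
    (∀ a b : A, ω (opTensor (a : K →L[ℂ] K) (b : K →L[ℂ] K)) = φ.1 a * ψ.1 b) ∧
    ∀ a : A, χ.1 a = ω (Δ a)

/-- The comultiplication of the predual, dual to the multiplication of `A`. The (extended
Haagerup) tensor square of `A_*` consists of separately weak* continuous bilinear functionals
on `A × A`; the comultiplication sends `φ` to `(a, b) ↦ φ(ab)`. -/
def predualComul (A : Subalgebra ℂ (K →L[ℂ] K)) (φ : Predual A) : A → A → ℂ :=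
  fun a b => φ.1 (a * b)

/-- `v = (θ ⊗ θ)(u)` for bilinear functionals `u, v` on `A × A`, regarded as elements of a tensor
square of the predual: `w = (θ ⊗ id)(u)` arises by applying `θ` to the functionals `u(·, b)`, and
`v = (id ⊗ θ)(w)` by applying `θ` to the functionals `w(a, ·)`. -/
def IsTensorImage (A : Subalgebra ℂ (K →L[ℂ] K)) (θ : Predual A → Predual A)
    (u v : A → A → ℂ) : Prop :=
  ∃ w : A → A → ℂ,
    (∀ b, ∃ f : Predual A, (∀ a, f.1 a = u a b) ∧ ∀ a, w a b = (θ f).1 a) ∧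
    (∀ a, ∃ f : Predual A, (∀ b, f.1 b = w a b) ∧ ∀ b, v a b = (θ f).1 b)

/-- `θ` is a Hopf convolution algebra automorphism of the predual of `(A, Δ)`: a bijective linear
map with `θ(φ ⋆ ψ) = θ(φ) ⋆ θ(ψ)` that intertwines the comultiplication of the predual. -/
structure IsHopfConvolutionAut (A : Subalgebra ℂ (K →L[ℂ] K))
    (Δ : A → (TensorSq K →L[ℂ] TensorSq K)) (θ : Predual A →L[ℂ] Predual A) : Prop where
  bijective : Function.Bijective θ
  map_conv : ∀ φ ψ χ : Predual A,
    IsConvolution A Δ φ ψ χ → IsConvolution A Δ (θ φ) (θ ψ) (θ χ)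
  map_comul : ∀ φ : Predual A,
    IsTensorImage A θ (predualComul A φ) (predualComul A (θ φ))

/-- `α` is a Hopf dual algebra automorphism of `(A, Δ)`: a weak* continuous automorphism of the
unital algebra `A` such that `α ⊗ α` extends to a weak* continuous linear map `Θ` of `A ⊗̄ A`,
with `Δ ∘ α = (α ⊗ α) ∘ Δ`. -/
structure IsHopfDualAut (A : Subalgebra ℂ (K →L[ℂ] K))
    (Δ : A → (TensorSq K →L[ℂ] TensorSq K)) (α : A →ₗ[ℂ] A) : Prop where
  bijective : Function.Bijective α
  map_one : α 1 = 1
  map_mul : ∀ a b : A, α (a * b) = α a * α b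
  continuous : Continuous[weakStarOn (A : Set (K →L[ℂ] K)), weakStarOn (A : Set (K →L[ℂ] K))] α
  map_comul : ∃ Θ : normalTensor A →ₗ[ℂ] normalTensor A,
    Continuous[weakStarOn (normalTensor A : Set (TensorSq K →L[ℂ] TensorSq K)),
      weakStarOn (normalTensor A : Set (TensorSq K →L[ℂ] TensorSq K))] Θ ∧
    (∀ (a b : A) (T : normalTensor A), (T : TensorSq K →L[ℂ] TensorSq K) = opTensor a.1 b.1 →
      (Θ T : TensorSq K →L[ℂ] TensorSq K) = opTensor (α a).1 (α b).1) ∧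
    ∀ a : A, ∃ T : normalTensor A, (T : TensorSq K →L[ℂ] TensorSq K) = Δ a ∧
      (Θ T : TensorSq K →L[ℂ] TensorSq K) = Δ (α a)

end General

/-! ### The noncommutative analytic Toeplitz algebra -/

/-- The Fock space `ℓ²(𝔽_d^*)`. -/
abbrev Fock (d : ℕ) : Type := lp (fun _ : FreeMonoid (Fin d) => ℂ) 2

variable {d : ℕ}

instance : DecidableEq (FreeMonoid (Fin d)) := inferInstanceAs (DecidableEq (List (Fin d)))

/-- The standard orthonormal basis `ξ_w` of the Fock space. -/
def ξ (w : FreeMonoid (Fin d)) : Fock d := lp.single 2 w (1 : ℂ)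

theorem orthonormal_ξ : Orthonormal ℂ (ξ : FreeMonoid (Fin d) → Fock d) := by
  rw [orthonormal_iff_ite]
  intro i j
  simp only [ξ, lp.inner_single_left]
  by_cases h : i = j
  · subst h; simp
  · simp [h]

/-- The isometry `ξ_w ↦ v w` given by an orthonormal family `v`. -/
def isometryOf {E : Type*} [NormedAddCommGroup E] [InnerProductSpace ℂ E] [CompleteSpace E]
    {v : FreeMonoid (Fin d) → E} (hv : Orthonormal ℂ v) : Fock d →ₗᵢ[ℂ] E :=
  hv.orthogonalFamily.linearIsometry

@[simp]
theorem isometryOf_ξ {E : Type*} [NormedAddCommGroup E] [InnerProductSpace ℂ E] [CompleteSpace E]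
    {v : FreeMonoid (Fin d) → E} (hv : Orthonormal ℂ v) (w : FreeMonoid (Fin d)) :
    isometryOf hv (ξ w) = v w := by
  simp [isometryOf, ξ, OrthogonalFamily.linearIsometry_apply_single]

theorem ext_ξ {E : Type*} [NormedAddCommGroup E] [InnerProductSpace ℂ E]
    {S T : Fock d →L[ℂ] E} (h : ∀ w, S (ξ w) = T (ξ w)) : S = T := by
  refine lp.ext_continuousLinearMap (by norm_num) fun w => ?_
  ext
  simpa [ξ] using h w

/-- The left regular representation: `L_w ξ_u = ξ_{wu}`. -/
def Lop (w : FreeMonoid (Fin d)) : Fock d →L[ℂ] Fock d :=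
  (isometryOf (orthonormal_ξ.comp (fun u => w * u)
    (fun _ _ h => mul_left_cancel h))).toContinuousLinearMap

@[simp]
theorem Lop_ξ (w u : FreeMonoid (Fin d)) : Lop w (ξ u) = ξ (w * u) := by
  simp [Lop]

/-- The algebra `𝓛_d`, the smallest WOT-closed unital algebra that contains all `L_w`. -/
def LAlg (d : ℕ) : Subalgebra ℂ (Fock d →L[ℂ] Fock d) :=
  sInf {B | IsWOTClosed (B : Set (Fock d →L[ℂ] Fock d)) ∧ ∀ w, Lop w ∈ B}

theorem Lop_mem (w : FreeMonoid (Fin d)) : Lop w ∈ LAlg d := by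
  simp only [LAlg, Algebra.mem_sInf]
  exact fun B hB => hB.2 w

/-- `w ↦ L_w` as a homomorphism into `𝓛_d`. -/
def LHom (d : ℕ) : FreeMonoid (Fin d) →* LAlg d where
  toFun w := ⟨Lop w, Lop_mem w⟩
  map_one' := by
    apply Subtype.ext
    exact ext_ξ fun u => by simp
  map_mul' u v := by
    apply Subtype.ext
    exact ext_ξ fun w => by simp [mul_assoc]

/-- `w ↦ L_w` on the free semigroup with adjoined zero, with `L_0 = 0`. -/
def LHom₀ (d : ℕ) : WithZero (FreeMonoid (Fin d)) →*₀ LAlg d :=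
  WithZero.lift' (LHom d)

/-- The pairs of words without a common prefix. Every pair of words is `(wp, wq)` for a unique
word `w` and a unique such pair `(p, q)`. -/
def ReducedPair (d : ℕ) : Type :=
  {r : FreeMonoid (Fin d) × FreeMonoid (Fin d) //
    ∀ w p q, r = (w * p, w * q) → w = 1}

theorem reducedPair_unique (r r' : ReducedPair d) (w w' : FreeMonoid (Fin d))
    (h₁ : w * r.1.1 = w' * r'.1.1) (h₂ : w * r.1.2 = w' * r'.1.2) : r = r' ∧ w = w' := by
  have key : ∀ (r r' : ReducedPair d) (w z : FreeMonoid (Fin d)),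
      w * r.1.1 = w * z * r'.1.1 → w * r.1.2 = w * z * r'.1.2 → r = r' ∧ w = w * z := by
    intro r r' w z h₁ h₂
    rw [mul_assoc] at h₁ h₂
    have e₁ := mul_left_cancel h₁
    have e₂ := mul_left_cancel h₂
    have hz : z = 1 := r.2 z r'.1.1 r'.1.2 (Prod.ext e₁ e₂)
    subst hz
    exact ⟨Subtype.ext (Prod.ext (by simpa using e₁) (by simpa using e₂)), by simp⟩
  have hcmp : (∃ z, w' = w * z) ∨ (∃ z, w = w' * z) := by
    have h : FreeMonoid.toList w ++ FreeMonoid.toList r.1.1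
        = FreeMonoid.toList w' ++ FreeMonoid.toList r'.1.1 := by
      simpa using congrArg FreeMonoid.toList h₁
    rcases List.append_eq_append_iff.1 h with ⟨z, hz, -⟩ | ⟨z, hz, -⟩
    · exact Or.inl ⟨FreeMonoid.ofList z, by
        apply FreeMonoid.toList.injective; simpa using hz⟩
    · exact Or.inr ⟨FreeMonoid.ofList z, by
        apply FreeMonoid.toList.injective; simpa using hz⟩
  rcases hcmp with ⟨z, rfl⟩ | ⟨z, rfl⟩
  · exact key r r' w z h₁ h₂
  · obtain ⟨h, h'⟩ := key r' r w' z h₁.symm h₂.symm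
    exact ⟨h.symm, h'.symm⟩

theorem inner_tmul_ξ (u v u' v' : FreeMonoid (Fin d)) :
    ⟪tmul (ξ u) (ξ v), tmul (ξ u') (ξ v')⟫_ℂ = if u = u' ∧ v = v' then 1 else 0 := by
  have h := orthonormal_iff_ite.1 (orthonormal_ξ (d := d))
  simp only [tmul, UniformSpace.Completion.inner_coe, TensorProduct.inner_tmul, h]
  split_ifs <;> simp_all

theorem orthonormal_pair (r : ReducedPair d) :
    Orthonormal ℂ fun w : FreeMonoid (Fin d) => tmul (ξ (w * r.1.1)) (ξ (w * r.1.2)) := by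
  rw [orthonormal_iff_ite]
  intro w w'
  rw [inner_tmul_ξ]
  by_cases h : w = w'
  · simp [h]
  · simp [h]

/-- The isometry `ξ_w ↦ ξ_{wp} ⊗ ξ_{wq}` for a pair `(p, q)`. -/
def pairIsometry (r : ReducedPair d) : Fock d →ₗᵢ[ℂ] TensorSq (Fock d) :=
  isometryOf (orthonormal_pair r)

theorem orthogonalFamily_pairIsometry :
    OrthogonalFamily ℂ (fun _ : ReducedPair d => Fock d) pairIsometry := by
  intro r r' hr x y
  have hz : ∀ (s : ReducedPair d) (z : TensorSq (Fock d)),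
      (∀ w, ⟪z, pairIsometry s (ξ w)⟫_ℂ = 0) → ∀ y, ⟪z, pairIsometry s y⟫_ℂ = 0 := by
    intro s z h y
    have : (innerSL ℂ z) ∘L (pairIsometry s).toContinuousLinearMap = 0 :=
      ext_ξ fun w => by simpa using h w
    simpa using DFunLike.congr_fun this y
  refine hz r' _ (fun w' => ?_) y
  rw [← inner_conj_symm, hz r _ (fun w => ?_) x, map_zero]
  simp only [pairIsometry, isometryOf_ξ, inner_tmul_ξ]
  rw [if_neg]
  rintro ⟨h₁, h₂⟩
  exact hr (reducedPair_unique r r' w w' h₁.symm h₂.symm).1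

/-- The unitary from the direct sum of copies of the Fock space, indexed by the reduced pairs
`(p, q)`, onto `ℓ²(𝔽_d^*) ⊗ ℓ²(𝔽_d^*)` that sends `ξ_w` in the copy `(p, q)` to
`ξ_{wp} ⊗ ξ_{wq}`. -/
def pairUnitary (d : ℕ) :
    lp (fun _ : ReducedPair d => Fock d) 2 →ₗᵢ[ℂ] TensorSq (Fock d) :=
  orthogonalFamily_pairIsometry.linearIsometry

/-- The comultiplication `Δ` of `𝓛_d`. In the decomposition of `ℓ²(𝔽_d^*) ⊗ ℓ²(𝔽_d^*)` into the
copies of the Fock space above, `Δ(A)` is the direct sum of copies of `A`; so it is weak*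
continuous and `Δ(L_w) = L_w ⊗ L_w` (`comul_LHom`). -/
def comul (d : ℕ) (A : LAlg d) : TensorSq (Fock d) →L[ℂ] TensorSq (Fock d) :=
  (pairUnitary d).toContinuousLinearMap ∘L ampliation (ReducedPair d) A.1 ∘L
    ContinuousLinearMap.adjoint (pairUnitary d).toContinuousLinearMap

theorem exists_reducedPair (u v : FreeMonoid (Fin d)) :
    ∃ (r : ReducedPair d) (w : FreeMonoid (Fin d)), u = w * r.1.1 ∧ v = w * r.1.2 := by
  induction u using FreeMonoid.recOn generalizing v with
  | one =>
    refine ⟨⟨(1, v), fun w p q h => ?_⟩, 1, by simp, by simp⟩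
    have := congrArg FreeMonoid.length (congrArg Prod.fst h)
    simp at this
    exact FreeMonoid.length_eq_zero.1 (by omega)
  | of_mul i u ih =>
    by_cases h : ∃ v', v = FreeMonoid.of i * v'
    · obtain ⟨v', rfl⟩ := h
      obtain ⟨r, w, rfl, rfl⟩ := ih v'
      exact ⟨r, FreeMonoid.of i * w, by simp [mul_assoc], by simp [mul_assoc]⟩
    · refine ⟨⟨(FreeMonoid.of i * u, v), fun w p q hw => ?_⟩, 1, by simp, by simp⟩
      obtain ⟨h₁, h₂⟩ := Prod.mk.inj hw
      induction w using FreeMonoid.casesOn with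
      | one => rfl
      | of_mul j w =>
        exfalso
        have h₃ : i :: FreeMonoid.toList u = j :: FreeMonoid.toList (w * p) := by
          simpa [mul_assoc] using congrArg FreeMonoid.toList h₁
        obtain ⟨rfl, -⟩ := List.cons.inj h₃
        exact h ⟨w * q, by rw [h₂, mul_assoc]⟩

theorem pairUnitary_single (r : ReducedPair d) (x : Fock d) :
    haveI := Classical.decEq (ReducedPair d)
    pairUnitary d (lp.single 2 r x) = pairIsometry r x := by
  classical
  exact orthogonalFamily_pairIsometry.linearIsometry_apply_single x

theorem ext_tmul_ξ {E : Type*} [NormedAddCommGroup E] [InnerProductSpace ℂ E]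
    {S T : TensorSq (Fock d) →L[ℂ] E}
    (h : ∀ u v, S (tmul (ξ u) (ξ v)) = T (tmul (ξ u) (ξ v))) : S = T := by
  let ι : Fock d ⊗[ℂ] Fock d →L[ℂ] TensorSq (Fock d) := UniformSpace.Completion.toComplL
  let m := TensorProduct.mkL ℂ (Fock d) (Fock d)
  have h₁ : ∀ u y, S (ι (m (ξ u) y)) = T (ι (m (ξ u) y)) := fun u y =>
    DFunLike.congr_fun (ext_ξ (S := S ∘L ι ∘L m (ξ u)) (T := T ∘L ι ∘L m (ξ u)) (h u)) y
  have h₂ : ∀ x y, S (ι (m x y)) = T (ι (m x y)) := fun x y =>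
    DFunLike.congr_fun (ext_ξ (S := S ∘L ι ∘L m.flip y) (T := T ∘L ι ∘L m.flip y)
      fun u => h₁ u y) x
  ext z
  induction z using UniformSpace.Completion.induction_on with
  | hp => exact isClosed_eq S.continuous T.continuous
  | ih z =>
    induction z using TensorProduct.induction_on with
    | zero => rw [UniformSpace.Completion.coe_zero, map_zero, map_zero]
    | tmul x y => exact h₂ x y
    | add a b ha hb => simp [UniformSpace.Completion.coe_add, ha, hb]

theorem opTensor_tmul {K K' : Type*} [NormedAddCommGroup K] [InnerProductSpace ℂ K]
    [NormedAddCommGroup K'] [InnerProductSpace ℂ K'] (A B : K →L[ℂ] K') (x y : K) :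
    opTensor A B (tmul x y) = tmul (A x) (B y) := by
  simp [opTensor, tmul]

theorem comul_LHom (w : FreeMonoid (Fin d)) :
    comul d (LHom d w) = opTensor (Lop w) (Lop w) := by
  classical
  refine ext_tmul_ξ fun u v => ?_
  obtain ⟨r, z, rfl, rfl⟩ := exists_reducedPair u v
  have h : ∀ z, pairUnitary d (lp.single 2 r (ξ z)) = tmul (ξ (z * r.1.1)) (ξ (z * r.1.2)) := by
    intro z
    simp [pairUnitary, OrthogonalFamily.linearIsometry_apply_single, pairIsometry]
  have hadj : ContinuousLinearMap.adjoint (pairUnitary d).toContinuousLinearMap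
      (pairUnitary d (lp.single 2 r (ξ z))) = lp.single 2 r (ξ z) := by
    refine ext_inner_left ℂ fun x => ?_
    rw [ContinuousLinearMap.adjoint_inner_right]
    exact (pairUnitary d).inner_map_map _ _
  have hamp : ampliation (ReducedPair d) (Lop w) (lp.single 2 r (ξ z))
      = lp.single 2 r (ξ (w * z)) := by
    refine lp.ext (funext fun r' => ?_)
    rw [ampliation_apply]
    by_cases hr : r' = r
    · subst hr; simp
    · simp [hr]
  rw [opTensor_tmul, ← h, comul]
  simp only [ContinuousLinearMap.comp_apply]
  rw [hadj]
  change pairUnitary d (ampliation (ReducedPair d) (Lop w) (lp.single 2 r (ξ z))) = _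
  rw [hamp, h]
  simp [mul_assoc]

/-! ### Homogeneous Hopf ideals, the compression algebra and the semigroup -/

/-- The homogeneous polynomials of degree `n` in the generators. -/
def homogeneousPart (d n : ℕ) : Submodule ℂ (LAlg d) :=
  Submodule.span ℂ {A | ∃ w : FreeMonoid (Fin d), w.length = n ∧ A = LHom d w}

/-- The ideal `J` is closed in the weak operator topology. -/
def IsClosedIdeal (J : TwoSidedIdeal (LAlg d)) : Prop :=
  IsWOTClosed (Subtype.val '' {A : LAlg d | A ∈ J})

/-- `J` is a homogeneous Hopf ideal of `𝓛_d`: a WOT-closed two-sided ideal, generated (as such) by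
homogeneous polynomials, with `Δ(J)` contained in the weak* closure of `J ⊗ 𝓛_d + 𝓛_d ⊗ J`. -/
structure IsHomogeneousHopfIdeal (J : TwoSidedIdeal (LAlg d)) : Prop where
  closed : IsClosedIdeal J
  homogeneous : ∃ G : Set (LAlg d), (∀ A ∈ G, ∃ n, A ∈ homogeneousPart d n) ∧
    IsLeast {I : TwoSidedIdeal (LAlg d) | IsClosedIdeal I ∧ ∀ A ∈ G, A ∈ I} J
  coideal : ∀ A ∈ J, comul d A ∈ weakStarSpan
    {T | ∃ B ∈ J, ∃ C : LAlg d, T = opTensor B.1 C.1 ∨ T = opTensor C.1 B.1}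

/-- The space `N_J = (J ξ_∅)^⊥`. -/
def NSpace (J : TwoSidedIdeal (LAlg d)) : Submodule ℂ (Fock d) :=
  (Submodule.span ℂ {x | ∃ A ∈ J, x = A.1 (ξ 1)})ᗮ

instance (J : TwoSidedIdeal (LAlg d)) : CompleteSpace (NSpace J) := by
  unfold NSpace; infer_instance

instance (J : TwoSidedIdeal (LAlg d)) : (NSpace J).HasOrthogonalProjection := by
  unfold NSpace; infer_instance

/-- The compression `P_{N_J} T |_{N_J}`. -/
def compress (J : TwoSidedIdeal (LAlg d)) (T : Fock d →L[ℂ] Fock d) :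
    NSpace J →L[ℂ] NSpace J :=
  (NSpace J).orthogonalProjectionOnto ∘L T ∘L (NSpace J).subtypeL

theorem mem_NSpace {J : TwoSidedIdeal (LAlg d)} {y : Fock d} :
    y ∈ NSpace J ↔ ∀ A ∈ J, ⟪A.1 (ξ 1), y⟫_ℂ = 0 := by
  rw [NSpace, Submodule.mem_orthogonal]
  constructor
  · exact fun h A hA => h _ (Submodule.subset_span ⟨A, hA, rfl⟩)
  · intro h u hu
    induction hu using Submodule.span_induction with
    | mem x hx => obtain ⟨A, hA, rfl⟩ := hx; exact h A hA
    | zero => simp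
    | add a b _ _ ha hb => rw [inner_add_left, ha, hb, add_zero]
    | smul c a _ ha => rw [inner_smul_left, ha, mul_zero]

/-- `N_J` is coinvariant. -/
theorem adjoint_mem_NSpace (J : TwoSidedIdeal (LAlg d)) (A : LAlg d) {y : Fock d}
    (hy : y ∈ NSpace J) : ContinuousLinearMap.adjoint A.1 y ∈ NSpace J := by
  rw [mem_NSpace] at hy ⊢
  intro B hB
  rw [ContinuousLinearMap.adjoint_inner_right]
  exact hy (A * B) (J.mul_mem_left A B hB)

theorem compress_mul (J : TwoSidedIdeal (LAlg d)) (A B : LAlg d) :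
    compress J (A * B).1 = compress J A.1 * compress J B.1 := by
  ext1 x
  refine ext_inner_left ℂ fun y => ?_
  have h : ∀ (T : Fock d →L[ℂ] Fock d) (y z : NSpace J),
      ⟪y, compress J T z⟫_ℂ = ⟪(y : Fock d), T z⟫_ℂ := fun T y z => by
    simp [compress]
  have h' := h B.1 ⟨_, adjoint_mem_NSpace J A y.2⟩ x
  rw [Submodule.coe_inner, ContinuousLinearMap.adjoint_inner_left,
    ContinuousLinearMap.adjoint_inner_left] at h'
  rw [h, mul_apply_eq_comp, h, h']
  rfl

theorem compress_eq_zero (J : TwoSidedIdeal (LAlg d)) {A : LAlg d} (hA : A ∈ J) :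
    compress J A.1 = 0 := by
  ext1 x
  refine ext_inner_left ℂ fun y => ?_
  have hy : ContinuousLinearMap.adjoint A.1 (y : Fock d) = 0 := by
    have : innerSL ℂ (ContinuousLinearMap.adjoint A.1 (y : Fock d)) = 0 := by
      refine ext_ξ fun w => ?_
      have h := mem_NSpace.1 y.2 (A * LHom d w) (J.mul_mem_right A _ hA)
      rw [innerSL_apply_apply, ContinuousLinearMap.adjoint_inner_left]
      rw [← inner_conj_symm]
      have e : (A * LHom d w).1 (ξ 1) = A.1 (ξ w) := by
        change A.1 (Lop w (ξ 1)) = _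
        simp
      rw [← e, h]
      simp
    have h := DFunLike.congr_fun this (ContinuousLinearMap.adjoint A.1 (y : Fock d))
    rw [innerSL_apply_apply] at h
    exact inner_self_eq_zero.1 h
  have : ⟪y, compress J A.1 x⟫_ℂ = ⟪(y : Fock d), A.1 x⟫_ℂ := by
    simp [compress]
  rw [this, ← ContinuousLinearMap.adjoint_inner_left, hy]
  simp

/-- The compression map `π_J : 𝓛_d → B(N_J)` as a homomorphism of unital algebras. -/
def compressHom (J : TwoSidedIdeal (LAlg d)) : LAlg d →ₐ[ℂ] (NSpace J →L[ℂ] NSpace J) :=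
  AlgHom.ofLinearMap
    { toFun := fun A => compress J A.1
      map_add' := fun A B => by ext x; simp [compress]
      map_smul' := fun c A => by ext x; simp [compress] }
    (by ext x; simp [compress]) (compress_mul J)

/-- The algebra `𝓛_J = P_{N_J} 𝓛_d |_{N_J}`. -/
def LJ (J : TwoSidedIdeal (LAlg d)) : Subalgebra ℂ (NSpace J →L[ℂ] NSpace J) :=
  (compressHom J).range

/-- The compression map `π_J : 𝓛_d → 𝓛_J`. -/
def proj (J : TwoSidedIdeal (LAlg d)) : LAlg d →ₐ[ℂ] LJ J := (compressHom J).rangeRestrict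

/-- The comultiplication `Δ_J` of `𝓛_J`, defined by `Δ_J(π_J(A)) = (π_J ⊗ π_J)(Δ(A))`, where
`π_J ⊗ π_J` is the compression of operators on `ℓ²(𝔽_d^*) ⊗ ℓ²(𝔽_d^*)` to `N_J ⊗ N_J`. If `J` is a
Hopf ideal, then the choice of the preimage `A` does not matter. -/
def comulJ (J : TwoSidedIdeal (LAlg d)) (F : LJ J) :
    TensorSq (NSpace J) →L[ℂ] TensorSq (NSpace J) :=
  opTensor (NSpace J).orthogonalProjectionOnto (NSpace J).orthogonalProjectionOnto ∘L
    comul d (Classical.choose F.2) ∘L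
    opTensor (NSpace J).subtypeL (NSpace J).subtypeL

/-- The congruence `u ∼ v ↔ L_u - L_v ∈ J` on the free semigroup with adjoined zero. -/
def congr (J : TwoSidedIdeal (LAlg d)) : Con (WithZero (FreeMonoid (Fin d))) :=
  Con.comap (LHom₀ d) (map_mul (LHom₀ d)) J.ringCon.toCon

theorem congr_iff (J : TwoSidedIdeal (LAlg d)) (u v : WithZero (FreeMonoid (Fin d))) :
    congr J u v ↔ LHom₀ d u - LHom₀ d v ∈ J :=
  TwoSidedIdeal.rel_iff J _ _

/-- The semigroup `S` of `J`. -/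
abbrev Semi (J : TwoSidedIdeal (LAlg d)) : Type := (congr J).Quotient

instance (J : TwoSidedIdeal (LAlg d)) : Zero (Semi J) :=
  ⟨((0 : WithZero (FreeMonoid (Fin d))) : (congr J).Quotient)⟩

/-- The operators `L_s ∈ 𝓛_J`, `s ∈ S`: `L_s = P_{N_J} L_w |_{N_J}` for every `w` in the
class `s`. -/
def Ls (J : TwoSidedIdeal (LAlg d)) (s : Semi J) : LJ J :=
  Con.liftOn s (fun w => proj J (LHom₀ d w)) (fun u v h => by
    have h0 : proj J (LHom₀ d u - LHom₀ d v) = 0 :=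
      Subtype.ext (compress_eq_zero J ((congr_iff J u v).1 h))
    rwa [map_sub, sub_eq_zero] at h0)

/-- The unitary on the Fock space induced by a permutation `τ` of the generators,
`ξ_{i₁⋯iₖ} ↦ ξ_{τ(i₁)⋯τ(iₖ)}` (the second quantization of the permutation matrix). -/
def permUnitary (τ : Equiv.Perm (Fin d)) : Fock d →L[ℂ] Fock d :=
  (isometryOf (orthonormal_ξ.comp (FreeMonoid.map τ)
    (List.map_injective_iff.2 τ.injective))).toContinuousLinearMap

end NCToeplitz

end

open NCToeplitz

open scoped InnerProductSpace TensorProduct Topology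

noncomputable section

namespace NCToeplitz

section

/-! ### Continuity for the weak* topology -/

section WeakStar

variable {K K' : Type*} [NormedAddCommGroup K] [InnerProductSpace ℂ K]
  [NormedAddCommGroup K'] [InnerProductSpace ℂ K']

/-! Condition (iii) is the pivot. It rests on identifying the group-like elements of `𝓛_J`, the `F`
with `Δ_J(F) = F ⊗ F`, with the operators `L_s` (`exists_eq_Ls_of_grouplike`). An `A ∈ 𝓛_d` commutes
with the right shifts, so it is determined by the function `A ξ_∅` on words, and `Δ(A)` sends `ξ_∅ ⊗
ξ_∅` to this function placed on the diagonal. Hence the coideal condition makes `N_J` closed under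
pointwise products. As `J` is homogeneous, `N_J` is also stable under truncation to one degree,
where there are finitely many words, and a Stone–Weierstrass argument puts the indicator of every
nonzero class into `N_J` (`classInd_mem`). For a group-like `π_J(A)` the pairing `y ↦ ⟪y, A ξ_∅⟫` is
multiplicative on these orthogonal idempotents, so it is `1` on at most one class and `0` on the
others.

From (i) or (ii), `θ*` is injective, multiplicative and preserves group-likes, so it induces an
injective endomorphism `σ` of `S`. If `σ` missed a class, the vector functional of its indicator
would vanish on the range of `θ*`, which no nonzero element of the predual does
(`exists_semigroup_aut`). This uses that the `L_s` are weak* total, by Cesàro means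
(`tendsto_cesaro`).

From (iii), `σ` permutes the finite set of letter classes together with `0`, so it respects degrees
and has finite order. The map `L_s Ω ↦ L_{σ(s)} Ω`, with `Ω` the vacuum, extends to a bounded
operator `V`: in one degree the norm of a polynomial in `𝓛_d` is the `ℓ²` norm of its coefficients
and `θ*` is bounded, while different degrees stay orthogonal. Finite order makes `V` invertible, and
`θ*(F) = V F V⁻¹` (`exists_similarity`), which yields (i) and (ii).

For `𝓛_d` itself the nonzero group-likes are the `L_w`, and an automorphism of a free monoid
permutes its generators. -/

theorem continuous_comp {X Y Z : Type*} {tX : TopologicalSpace X} {tY : TopologicalSpace Y}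
    {tZ : TopologicalSpace Z} {g : Y → Z} {f : X → Y} (hg : Continuous[tY, tZ] g)
    (hf : Continuous[tX, tY] f) : Continuous[tX, tZ] fun x => g (f x) :=
  hg.comp hf

theorem continuous_weakStarOn_val (s : Set (K →L[ℂ] K)) :
    Continuous[weakStarOn s, weakStar K] (Subtype.val : s → K →L[ℂ] K) :=
  continuous_induced_dom

theorem continuous_weakStarOn_rng {X : Type*} {tX : TopologicalSpace X}
    {s : Set (K →L[ℂ] K)} {f : X → s}
    (hf : Continuous[tX, weakStar K] fun x => (f x : K →L[ℂ] K)) :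
    Continuous[tX, weakStarOn s] f :=
  continuous_induced_rng.2 hf

theorem continuous_inner_ampliation [CompleteSpace K] (x y : lp (fun _ : ℕ => K) 2) :
    Continuous[weakStar K, inferInstance] fun T => ⟪y, ampliation ℕ T x⟫_ℂ :=
  continuous_comp
    (g := fun A : lp (fun _ : ℕ => K) 2 →WOT[ℂ] lp (fun _ : ℕ => K) 2 => ⟪y, A x⟫_ℂ)
    (ContinuousLinearMapWOT.continuous_dual_apply x (innerSL ℂ y))
    (continuous_induced_dom (f := ampliationWOT K))

theorem tendsto_weakStar [CompleteSpace K] {X : Type*} {l : Filter X} {f : X → K →L[ℂ] K}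
    {T : K →L[ℂ] K}
    (h : ∀ x y : lp (fun _ : ℕ => K) 2,
      Filter.Tendsto (fun a => ⟪y, ampliation ℕ (f a) x⟫_ℂ) l (𝓝 ⟪y, ampliation ℕ T x⟫_ℂ)) :
    Filter.Tendsto f l (@nhds _ (weakStar K) T) := by
  rw [nhds_induced, Filter.tendsto_comap_iff,
    ContinuousLinearMapWOT.tendsto_iff_forall_inner_apply_tendsto]
  exact fun x y => h x y

theorem continuous_to_weakStar [CompleteSpace K] {X : Type*} {tX : TopologicalSpace X}
    {f : X → K →L[ℂ] K}
    (h : ∀ x y : lp (fun _ : ℕ => K) 2,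
      Continuous[tX, inferInstance] fun a => ⟪y, ampliation ℕ (f a) x⟫_ℂ) :
    Continuous[tX, weakStar K] f := by
  let tK := weakStar K
  rw [@continuous_iff_continuousAt]
  exact fun a => tendsto_weakStar fun x y => (h x y).continuousAt

theorem inner_ampliation {ι : Type*} (T : K →L[ℂ] K) (x y : lp (fun _ : ι => K) 2) :
    ⟪y, ampliation ι T x⟫_ℂ = ∑' i, ⟪y i, T (x i)⟫_ℂ :=
  lp.inner_eq_tsum _ _

theorem summable_norm_sq_coe {E ι : Type*} [NormedAddCommGroup E] (x : lp (fun _ : ι => E) 2) :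
    Summable fun i => ‖x i‖ ^ 2 := by
  have := (lp.memℓp x).summable (by norm_num)
  simpa using this

theorem memℓp_two_of_summable {E ι : Type*} [NormedAddCommGroup E] {x : ι → E}
    (hx : Summable fun i => ‖x i‖ ^ 2) :
    Memℓp x 2 :=
  memℓp_gen (by simpa using hx)

/-- A countable index set embeds in `ℕ`; extending both families by zero gives one of the
functionals that define the topology. -/
theorem continuous_tsum_inner [CompleteSpace K] {κ : Type*} [Countable κ] {x y : κ → K}
    (hx : Summable fun k => ‖x k‖ ^ 2) (hy : Summable fun k => ‖y k‖ ^ 2) :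
    Continuous[weakStar K, inferInstance] fun T : K →L[ℂ] K => ∑' k, ⟪y k, T (x k)⟫_ℂ := by
  obtain ⟨e, he⟩ := exists_injective_nat κ
  have hext : ∀ {z : κ → K}, (Summable fun k => ‖z k‖ ^ 2) →
      Memℓp (Function.extend e z 0) 2 := by
    intro z hz
    refine memℓp_two_of_summable ?_
    rw [← he.summable_iff]
    · simpa [Function.comp_def, he.extend_apply] using hz
    · intro n hn
      rw [Function.extend_apply' _ _ _ (by simpa using hn)]
      simp
  have h := continuous_inner_ampliation (K := K) ⟨_, hext hx⟩ ⟨_, hext hy⟩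
  convert h using 2 with T
  rw [inner_ampliation, ← he.tsum_eq]
  · simp [he.extend_apply]
  · intro n hn
    by_contra hne
    refine hn ?_
    change ⟪Function.extend e y 0 n, _⟫_ℂ = 0
    rw [Function.extend_apply' _ _ _ (by simpa using hne)]
    simp

theorem continuous_inner_apply [CompleteSpace K] (x y : K) :
    Continuous[weakStar K, inferInstance] fun T : K →L[ℂ] K => ⟪y, T x⟫_ℂ := by
  have h := continuous_tsum_inner (K := K) (κ := Unit) (x := fun _ => x) (y := fun _ => y)
    (Summable.of_finite) (Summable.of_finite)
  simpa using h

/-- Sandwiching an ampliation between bounded operators is weak* continuous. -/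
theorem continuous_sandwich_ampliation [CompleteSpace K] [CompleteSpace K']
    {ι : Type*} [Countable ι] (X : K' →L[ℂ] lp (fun _ : ι => K) 2)
    (Y : lp (fun _ : ι => K) 2 →L[ℂ] K') :
    Continuous[weakStar K, weakStar K'] fun T => Y ∘L ampliation ι T ∘L X := by
  refine continuous_to_weakStar fun x y => ?_
  have hs : ∀ (Z : K' →L[ℂ] lp (fun _ : ι => K) 2) (z : lp (fun _ : ℕ => K') 2),
      Summable fun p : ℕ × ι => ‖Z (z p.1) p.2‖ ^ 2 := by
    intro Z z
    rw [summable_prod_of_nonneg (fun _ => by positivity)]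
    refine ⟨fun n => summable_norm_sq_coe (Z (z n)), ?_⟩
    have h : ∀ n, ∑' i, ‖Z (z n) i‖ ^ 2 = ‖Z (z n)‖ ^ 2 := fun n => by
      have := lp.norm_rpow_eq_tsum (p := 2) (by norm_num) (Z (z n))
      simpa using this.symm
    simp only [h]
    refine Summable.of_nonneg_of_le (fun _ => by positivity) (fun n => ?_)
      ((summable_norm_sq_coe z).mul_left (‖Z‖ ^ 2))
    rw [← mul_pow]
    exact pow_le_pow_left₀ (norm_nonneg _) (Z.le_opNorm _) 2
  have hX := hs X x
  have hY := hs (ContinuousLinearMap.adjoint Y) y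
  convert continuous_tsum_inner hX hY using 2 with T
  rw [inner_ampliation, Summable.tsum_prod]
  · refine tsum_congr fun n => ?_
    rw [ContinuousLinearMap.comp_apply, ← ContinuousLinearMap.adjoint_inner_left,
      ContinuousLinearMap.comp_apply, inner_ampliation]
  -- The double series is dominated through `‖b‖ ‖T a‖ ≤ ‖b‖² + ‖T‖² ‖a‖²`, which justifies summing
  -- over pairs.
  · refine Summable.of_norm_bounded ((hY.add (hX.mul_left (‖T‖ ^ 2)))) fun p => ?_
    refine (norm_inner_le_norm _ _).trans ?_
    have h1 := T.le_opNorm (X (x p.1) p.2)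
    have h2 := norm_nonneg (ContinuousLinearMap.adjoint Y (y p.1) p.2)
    rw [← mul_pow]
    nlinarith [sq_nonneg (‖ContinuousLinearMap.adjoint Y (y p.1) p.2‖ - ‖T‖ * ‖X (x p.1) p.2‖),
      mul_le_mul_of_nonneg_left h1 h2]

theorem continuous_sandwich [CompleteSpace K] [CompleteSpace K']
    (X : K' →L[ℂ] K) (Y : K →L[ℂ] K') :
    Continuous[weakStar K, weakStar K'] fun T => Y ∘L T ∘L X := by
  refine continuous_to_weakStar fun x y => ?_
  have hs : ∀ (Z : K' →L[ℂ] K) (z : lp (fun _ : ℕ => K') 2), Summable fun n => ‖Z (z n)‖ ^ 2 := by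
    intro Z z
    refine Summable.of_nonneg_of_le (fun _ => by positivity) (fun n => ?_)
      ((summable_norm_sq_coe z).mul_left (‖Z‖ ^ 2))
    rw [← mul_pow]
    exact pow_le_pow_left₀ (norm_nonneg _) (Z.le_opNorm _) 2
  convert continuous_tsum_inner (hs X x) (hs (ContinuousLinearMap.adjoint Y) y) using 2 with T
  rw [inner_ampliation]
  refine tsum_congr fun n => ?_
  rw [ContinuousLinearMap.adjoint_inner_left]
  rfl

theorem subset_weakStarSpan (s : Set (K →L[ℂ] K)) : s ⊆ weakStarSpan s := fun _ hx =>
  @subset_closure _ (weakStar K) _ _ (Submodule.subset_span hx)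

theorem map_mem_weakStarSpan {s : Set (K →L[ℂ] K)} {t : Set (K' →L[ℂ] K')}
    (f : (K →L[ℂ] K) →ₗ[ℂ] (K' →L[ℂ] K')) (hf : Continuous[weakStar K, weakStar K'] f)
    (h : ∀ T ∈ s, f T ∈ weakStarSpan t) {T : K →L[ℂ] K} (hT : T ∈ weakStarSpan s) :
    f T ∈ weakStarSpan t := by
  let t1 := weakStar K
  let t2 := weakStar K'
  have hc : @IsClosed _ (weakStar K') (weakStarSpan t : Set (K' →L[ℂ] K')) :=
    @isClosed_closure _ (weakStar K') _
  have hsub : (Submodule.span ℂ s : Set (K →L[ℂ] K)) ⊆ f ⁻¹' (weakStarSpan t) :=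
    Submodule.span_le (p := (weakStarSpan t).comap f).2 h
  have h' := @closure_minimal _ t1 _ _ hsub (@IsClosed.preimage _ _ t1 t2 _ hf _ hc)
  exact h' hT

theorem eq_zero_of_mem_weakStarSpan {s : Set (K →L[ℂ] K)}
    (f : (K →L[ℂ] K) →ₗ[ℂ] ℂ) (hf : Continuous[weakStar K, inferInstance] f)
    (h : ∀ T ∈ s, f T = 0) {T : K →L[ℂ] K} (hT : T ∈ weakStarSpan s) : f T = 0 := by
  let t1 := weakStar K
  have hsub : (Submodule.span ℂ s : Set (K →L[ℂ] K)) ⊆ f ⁻¹' {0} :=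
    Submodule.span_le (p := LinearMap.ker f).2 h
  have h' := @closure_minimal _ t1 _ _ hsub
    (@IsClosed.preimage _ _ t1 _ _ hf _ isClosed_singleton)
  exact h' hT

theorem mem_weakStarSpan_of_tendsto {s : Set (K →L[ℂ] K)} {f : ℕ → K →L[ℂ] K} {T : K →L[ℂ] K}
    (h : Filter.Tendsto f Filter.atTop (@nhds _ (weakStar K) T))
    (hf : ∀ n, f n ∈ Submodule.span ℂ s) : T ∈ weakStarSpan s :=
  @mem_closure_of_tendsto _ (weakStar K) _ _ _ _ _ _ h (Filter.Eventually.of_forall hf)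

end WeakStar

end

section

variable {d : ℕ}

/-! ### The basis of the Fock space -/

theorem inner_ξ_left (w : FreeMonoid (Fin d)) (x : Fock d) : ⟪ξ w, x⟫_ℂ = x w := by
  simp [ξ, lp.inner_single_left]

theorem inner_ξ_ξ (u v : FreeMonoid (Fin d)) :
    ⟪(ξ u : Fock d), ξ v⟫_ℂ = if u = v then 1 else 0 :=
  orthonormal_iff_ite.1 orthonormal_ξ u v

theorem norm_ξ (w : FreeMonoid (Fin d)) : ‖(ξ w : Fock d)‖ = 1 := orthonormal_ξ.1 w

theorem ext_inner_ξ {x y : Fock d} (h : ∀ w, ⟪ξ w, x⟫_ℂ = ⟪ξ w, y⟫_ℂ) : x = y := by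
  refine lp.ext (funext fun w => ?_)
  simpa [inner_ξ_left] using h w

theorem topologicalClosure_span_ξ :
    (Submodule.span ℂ (Set.range (ξ : FreeMonoid (Fin d) → Fock d))).topologicalClosure = ⊤ := by
  rw [Submodule.topologicalClosure_eq_top_iff, Submodule.eq_bot_iff]
  intro y hy
  refine ext_inner_ξ fun w => ?_
  rw [inner_zero_right]
  exact hy _ (Submodule.subset_span ⟨w, rfl⟩)

/-- A bounded sequence of functionals is equicontinuous, so the vectors where it converges to `g`
form a closed subspace; this one contains the basis. -/
theorem tendsto_of_tendsto_ξ {f : ℕ → Fock d →L[ℂ] ℂ} {g : Fock d →L[ℂ] ℂ} {C : ℝ}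
    (hC : ∀ n, ‖f n‖ ≤ C)
    (h : ∀ w, Filter.Tendsto (fun n => f n (ξ w)) Filter.atTop (𝓝 (g (ξ w)))) (x : Fock d) :
    Filter.Tendsto (fun n => f n x) Filter.atTop (𝓝 (g x)) := by
  let p : Submodule ℂ (Fock d) :=
    { carrier := {x | Filter.Tendsto (fun n => f n x) Filter.atTop (𝓝 (g x))}
      add_mem' := fun {a b} ha hb => by
        simpa only [Set.mem_ofPred_eq, map_add] using Filter.Tendsto.add ha hb
      zero_mem' := by simp
      smul_mem' := fun c a ha => by
        simpa only [Set.mem_ofPred_eq, map_smul] using Filter.Tendsto.const_smul ha c }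
  have hp : IsClosed (p : Set (Fock d)) := by
    refine Equicontinuous.isClosed_setOfPred_tendsto (F := fun n x => f n x) ?_ g.continuous
    refine UniformEquicontinuous.equicontinuous ?_
    refine LipschitzWith.uniformEquicontinuous _ C.toNNReal fun n => ?_
    exact (f n).lipschitz.weaken (by
      rw [← NNReal.coe_le_coe]
      exact (hC n).trans (Real.le_coe_toNNReal C))
  have hle := Submodule.topologicalClosure_minimal _ (Submodule.span_le.2 (by
    rintro _ ⟨w, rfl⟩; exact h w) : Submodule.span ℂ (Set.range ξ) ≤ p) hp
  rw [topologicalClosure_span_ξ] at hle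
  exact hle Submodule.mem_top

/-- A uniformly bounded sequence of operators whose matrix entries converge is weak*
convergent. -/
theorem tendsto_weakStar_of_entries {S : ℕ → Fock d →L[ℂ] Fock d} {T : Fock d →L[ℂ] Fock d}
    {C : ℝ} (hC : ∀ n, ‖S n‖ ≤ C)
    (h : ∀ u w, Filter.Tendsto (fun n => ⟪ξ u, S n (ξ w)⟫_ℂ) Filter.atTop
      (𝓝 ⟪ξ u, T (ξ w)⟫_ℂ)) :
    Filter.Tendsto S Filter.atTop (@nhds _ (weakStar (Fock d)) T) := by
  have hC0 : 0 ≤ C := (norm_nonneg _).trans (hC 0)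
  have h₁ : ∀ u x, Filter.Tendsto (fun n => ⟪ξ u, S n x⟫_ℂ) Filter.atTop (𝓝 ⟪ξ u, T x⟫_ℂ) := by
    intro u x
    refine tendsto_of_tendsto_ξ (f := fun n => innerSL ℂ (ξ u) ∘L S n)
      (g := innerSL ℂ (ξ u) ∘L T) (C := C) (fun n => ?_) (h u) x
    refine (ContinuousLinearMap.opNorm_comp_le _ _).trans ?_
    rw [innerSL_apply_norm, norm_ξ, one_mul]
    exact hC n
  have h₂ : ∀ x y, Filter.Tendsto (fun n => ⟪y, S n x⟫_ℂ) Filter.atTop (𝓝 ⟪y, T x⟫_ℂ) := by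
    intro x y
    have key := tendsto_of_tendsto_ξ (f := fun n => innerSL ℂ (S n x)) (g := innerSL ℂ (T x))
      (C := C * ‖x‖) (fun n => ?_) (fun w => ?_) y
    · have := (Complex.continuous_conj.tendsto _).comp key
      simpa [Function.comp_def] using this
    · rw [innerSL_apply_norm]
      exact ((S n).le_opNorm x).trans (mul_le_mul_of_nonneg_right (hC n) (norm_nonneg _))
    · have := (Complex.continuous_conj.tendsto _).comp (h₁ w x)
      simpa [Function.comp_def] using this
  refine tendsto_weakStar fun x y => ?_
  simp only [inner_ampliation]
  -- On bounded sequences, convergence of all matrix coefficients already gives weak* convergence.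
  refine tendsto_tsum_of_dominated_convergence
    (bound := fun i => ‖y i‖ ^ 2 + C ^ 2 * ‖x i‖ ^ 2)
    ((summable_norm_sq_coe y).add ((summable_norm_sq_coe x).mul_left _)) (fun i => h₂ _ _)
    (Filter.Eventually.of_forall fun n i => ?_)
  refine (norm_inner_le_norm _ _).trans ?_
  have h1 : ‖S n (x i)‖ ≤ C * ‖x i‖ :=
    ((S n).le_opNorm _).trans (mul_le_mul_of_nonneg_right (hC n) (norm_nonneg _))
  have h2 := mul_le_mul_of_nonneg_left h1 (norm_nonneg (y i))
  nlinarith [sq_nonneg (‖y i‖ - C * ‖x i‖)]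

/-- The finite set of words of length `n`. -/
def words (d n : ℕ) : Finset (FreeMonoid (Fin d)) :=
  Set.Finite.toFinset (s := {w : FreeMonoid (Fin d) | w.length = n})
    (List.finite_length_eq (Fin d) n)

@[simp]
theorem mem_words {n : ℕ} {w : FreeMonoid (Fin d)} : w ∈ words d n ↔ w.length = n :=
  Set.Finite.mem_toFinset _

/-! ### Right shifts and the structure of `𝓛_d` -/

/-- The right regular representation: `R_w ξ_u = ξ_{uw}`. -/
def Rop (w : FreeMonoid (Fin d)) : Fock d →ₗᵢ[ℂ] Fock d :=
  isometryOf (orthonormal_ξ.comp (fun u => u * w) (fun _ _ h => mul_right_cancel h))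

@[simp]
theorem Rop_ξ (w u : FreeMonoid (Fin d)) : Rop w (ξ u) = ξ (u * w) := by
  simp [Rop]

theorem isWOTClosed_LAlg : IsWOTClosed (LAlg d : Set (Fock d →L[ℂ] Fock d)) := by
  have : (LAlg d : Set (Fock d →L[ℂ] Fock d)) =
      ⋂ B ∈ {B : Subalgebra ℂ (Fock d →L[ℂ] Fock d) |
        IsWOTClosed (B : Set (Fock d →L[ℂ] Fock d)) ∧ ∀ w, Lop w ∈ B}, B := by
    simp [LAlg, Algebra.coe_sInf]
  rw [IsWOTClosed, this, Set.preimage_iInter₂]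
  exact isClosed_biInter fun B hB => hB.1

/-- The commutant of the right shifts is a WOT-closed unital algebra that contains every `L_w`, so
it contains the smallest such algebra. -/
theorem map_Rop (A : LAlg d) (w : FreeMonoid (Fin d)) (x : Fock d) :
    A.1 (Rop w x) = Rop w (A.1 x) := by
  let B : Subalgebra ℂ (Fock d →L[ℂ] Fock d) :=
    Subalgebra.centralizer ℂ (Set.range fun w => (Rop w).toContinuousLinearMap)
  have hB : IsWOTClosed (B : Set (Fock d →L[ℂ] Fock d)) := by
    have : (ContinuousLinearMapWOT.toCLM : (Fock d →WOT[ℂ] Fock d) → _) ⁻¹' B =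
        ⋂ (w : FreeMonoid (Fin d)) (x : Fock d) (y : Fock d),
          {T | ⟪ContinuousLinearMap.adjoint (Rop w).toContinuousLinearMap y, T x⟫_ℂ =
            ⟪y, T (Rop w x)⟫_ℂ} := by
      ext T
      simp only [Set.mem_preimage, SetLike.mem_coe, Set.mem_iInter, Set.mem_ofPred_eq, B,
        Subalgebra.mem_centralizer_iff, Set.forall_mem_range,
        ContinuousLinearMap.adjoint_inner_left]
      refine forall_congr' fun w => ⟨fun h x y => ?_, fun h => ?_⟩
      · exact congrArg (fun z => ⟪y, z⟫_ℂ) (DFunLike.congr_fun h x)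
      · ext1 x
        exact ext_inner_left ℂ (h x)
    rw [IsWOTClosed, this]
    refine isClosed_iInter fun w => isClosed_iInter fun x => isClosed_iInter fun y => ?_
    exact isClosed_eq
      (ContinuousLinearMapWOT.continuous_dual_apply x
        (innerSL ℂ (ContinuousLinearMap.adjoint (Rop w).toContinuousLinearMap y)))
      (ContinuousLinearMapWOT.continuous_dual_apply (Rop w x) (innerSL ℂ y))
  have hL : ∀ w, Lop w ∈ B := by
    intro w
    rw [Subalgebra.mem_centralizer_iff, Set.forall_mem_range]
    intro v
    refine ext_ξ fun u => ?_
    change Rop v (Lop w (ξ u)) = Lop w (Rop v (ξ u))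
    simp [mul_assoc]
  have hA : A.1 ∈ B := (Algebra.mem_sInf.1 A.2) B ⟨hB, hL⟩
  rw [Subalgebra.mem_centralizer_iff, Set.forall_mem_range] at hA
  exact (DFunLike.congr_fun (hA w) x).symm

/-- Every column of `A` is a right shift of the column at the empty word. So `A` is determined by
its Fourier coefficients, the entries of `A ξ_∅`. -/
theorem apply_ξ (A : LAlg d) (w : FreeMonoid (Fin d)) : A.1 (ξ w) = Rop w (A.1 (ξ 1)) := by
  rw [← map_Rop, Rop_ξ, one_mul]

theorem LAlg_ext {A B : LAlg d} (h : A.1 (ξ 1) = B.1 (ξ 1)) : A = B :=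
  Subtype.ext (ext_ξ fun w => by rw [apply_ξ A, apply_ξ B, h])

theorem inner_mul_apply_ξ (A : LAlg d) (v w : FreeMonoid (Fin d)) :
    ⟪ξ (v * w), A.1 (ξ w)⟫_ℂ = ⟪ξ v, A.1 (ξ 1)⟫_ℂ := by
  rw [apply_ξ, ← Rop_ξ, LinearIsometry.inner_map_map]

theorem inner_apply_ξ_eq_zero (A : LAlg d) {u w : FreeMonoid (Fin d)}
    (h : ∀ v, u ≠ v * w) : ⟪ξ u, A.1 (ξ w)⟫_ℂ = 0 := by
  rw [apply_ξ]
  have : innerSL ℂ (ξ u) ∘L (Rop w).toContinuousLinearMap = 0 := by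
    refine ext_ξ fun v => ?_
    simp [inner_ξ_ξ, h v]
  exact DFunLike.congr_fun this _

/-! ### Cesàro means -/

/-- Counts the pairs `i, j < N` with `k + i = j`. The result is the unnormalised Fejér weight, and
truncated subtraction makes it vanish for `k ≥ N`. -/
theorem sum_range_ite_add (N k l : ℕ) (z : ℂ) :
    ∑ i ∈ Finset.range N, ∑ j ∈ Finset.range N, (if k + l + i = l + j then z else 0) =
      ((N - k : ℕ) : ℂ) * z := by
  have h : ∀ i, ∑ j ∈ Finset.range N, (if k + l + i = l + j then z else 0) =
      if i < N - k then z else 0 := by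
    intro i
    have : ∀ j, (k + l + i = l + j) ↔ (k + i = j) := fun j => by omega
    simp only [this, Finset.sum_ite_eq, Finset.mem_range]
    congr 1
    exact propext (by omega)
  simp only [h]
  rw [← Finset.sum_filter, Finset.sum_const, nsmul_eq_mul]
  congr 2
  rw [show (Finset.range N).filter (fun i => i < N - k) = Finset.range (N - k) by
    ext i; simp; omega, Finset.card_range]

/-- The vectors `(n+1)^{-1/2} ∑_{i ≤ n} ξ_w`, with the `i`-th copy of `ξ_w` in the summand of
index `|w| + i`. -/
def fejerVec (n : ℕ) (w : FreeMonoid (Fin d)) : lp (fun _ : ℕ => Fock d) 2 :=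
  ∑ i ∈ Finset.range (n + 1), ((Real.sqrt (n + 1) : ℂ)⁻¹) •
    lp.single (E := fun _ : ℕ => Fock d) 2 (w.length + i) (ξ w)

theorem inner_single_single {K ι : Type*} [NormedAddCommGroup K] [InnerProductSpace ℂ K]
    [DecidableEq ι] (i j : ι) (a b : K) :
    ⟪(lp.single 2 i a : lp (fun _ : ι => K) 2), lp.single 2 j b⟫_ℂ =
      if i = j then ⟪a, b⟫_ℂ else 0 := by
  rw [lp.inner_single_left]
  by_cases h : i = j
  · subst h; simp
  · simp [h]

theorem ampliation_single {K ι : Type*} [NormedAddCommGroup K] [InnerProductSpace ℂ K]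
    [DecidableEq ι] (T : K →L[ℂ] K) (i : ι) (a : K) :
    ampliation ι T (lp.single 2 i a) = lp.single 2 i (T a) := by
  refine lp.ext (funext fun j => ?_)
  rw [ampliation_apply]
  by_cases h : j = i
  · subst h; simp
  · simp [h]

theorem inner_fejerVec (n : ℕ) (T : Fock d →L[ℂ] Fock d) (u w : FreeMonoid (Fin d)) :
    ⟪fejerVec n u, ampliation ℕ T (fejerVec n w)⟫_ℂ =
      ((n : ℂ) + 1)⁻¹ * ∑ i ∈ Finset.range (n + 1), ∑ j ∈ Finset.range (n + 1),
        (if u.length + i = w.length + j then ⟪ξ u, T (ξ w)⟫_ℂ else 0) := by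
  have hs : ((Real.sqrt (n + 1) : ℂ)⁻¹) * ((Real.sqrt (n + 1) : ℂ)⁻¹) = ((n : ℂ) + 1)⁻¹ := by
    rw [← mul_inv, ← Complex.ofReal_mul, Real.mul_self_sqrt (by positivity)]
    simp
  simp only [fejerVec, map_sum, map_smul, ampliation_single, sum_inner, inner_sum,
    inner_smul_left, inner_smul_right, inner_single_single, Finset.mul_sum, ← hs]
  rw [Finset.sum_comm]
  refine Finset.sum_congr rfl fun i _ => Finset.sum_congr rfl fun j _ => ?_
  simp only [map_inv₀, Complex.conj_ofReal]
  ring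

theorem ampliation_one {K ι : Type*} [NormedAddCommGroup K] [InnerProductSpace ℂ K]
    (x : lp (fun _ : ι => K) 2) : ampliation ι (1 : K →L[ℂ] K) x = x := rfl

theorem orthonormal_fejerVec (n : ℕ) :
    Orthonormal ℂ (fejerVec n : FreeMonoid (Fin d) → lp (fun _ : ℕ => Fock d) 2) := by
  rw [orthonormal_iff_ite]
  intro u w
  rw [← ampliation_one (fejerVec n w), inner_fejerVec]
  simp only [one_apply_eq_self, inner_ξ_ξ]
  by_cases h : u = w
  · subst h
    have := sum_range_ite_add (n + 1) 0 u.length 1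
    simp only [zero_add] at this
    simp only [if_true]
    rw [this]
    have : (n : ℂ) + 1 ≠ 0 := Nat.cast_add_one_ne_zero n
    simp [this]
  · simp [h]

/-- The Cesàro means of the Fourier series of `A ∈ 𝓛_d`. -/
def cesaro (n : ℕ) (A : LAlg d) : LAlg d :=
  ∑ k ∈ Finset.range (n + 1), ∑ v ∈ words d k,
    (((n : ℂ) + 1)⁻¹ * ((n + 1 - k : ℕ) : ℂ) * ⟪ξ v, A.1 (ξ 1)⟫_ℂ) • LHom d v

theorem LHom_coe (v : FreeMonoid (Fin d)) : ((LHom d v : LAlg d) : Fock d →L[ℂ] Fock d) = Lop v :=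
  rfl

theorem inner_cesaro (n : ℕ) (A : LAlg d) (v : FreeMonoid (Fin d)) :
    ⟪ξ v, (cesaro n A).1 (ξ 1)⟫_ℂ =
      ((n : ℂ) + 1)⁻¹ * ((n + 1 - v.length : ℕ) : ℂ) * ⟪ξ v, A.1 (ξ 1)⟫_ℂ := by
  have h : ∀ k, ∑ u ∈ words d k, ⟪ξ v, ((((n : ℂ) + 1)⁻¹ * ((n + 1 - k : ℕ) : ℂ) *
      ⟪ξ u, A.1 (ξ 1)⟫_ℂ) • Lop u) (ξ 1)⟫_ℂ =
      if k = v.length then ((n : ℂ) + 1)⁻¹ * ((n + 1 - v.length : ℕ) : ℂ) *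
        ⟪ξ v, A.1 (ξ 1)⟫_ℂ else 0 := by
    intro k
    simp only [smul_apply, Lop_ξ, mul_one, inner_smul_right, inner_ξ_ξ,
      mul_ite, mul_zero, Finset.sum_ite_eq, mem_words]
    by_cases hk : v.length = k
    · subst hk; simp
    · rw [if_neg hk, if_neg (Ne.symm hk)]
  have e : (cesaro n A).1 = ∑ k ∈ Finset.range (n + 1), ∑ v ∈ words d k,
      (((n : ℂ) + 1)⁻¹ * ((n + 1 - k : ℕ) : ℂ) * ⟪ξ v, A.1 (ξ 1)⟫_ℂ) • Lop v := by
    simp [cesaro, LHom_coe]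
  rw [e]
  simp only [sum_apply, inner_sum, h]
  rw [Finset.sum_ite_eq']
  split_ifs with hv
  · rfl
  -- Words longer than `n` do not occur in the sum, and their weight is `0` by truncated
  -- subtraction.
  · have : n + 1 - v.length = 0 := by simp at hv; omega
    simp [this]

/-- The Cesàro mean is a compression of an ampliation of `A` by an isometry, hence has norm at most
`‖A‖`. Both sides have entries only at `(vw, w)`, where the pairs of copies with equal index number
`n + 1 - |v|`. -/
theorem cesaro_eq (n : ℕ) (A : LAlg d) :
    (cesaro n A).1 =
      ContinuousLinearMap.adjoint (isometryOf (orthonormal_fejerVec n)).toContinuousLinearMap ∘L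
        ampliation ℕ A.1 ∘L (isometryOf (orthonormal_fejerVec n)).toContinuousLinearMap := by
  refine ext_ξ fun w => ext_inner_ξ fun u => ?_
  rw [ContinuousLinearMap.comp_apply, ContinuousLinearMap.adjoint_inner_right,
    ContinuousLinearMap.comp_apply]
  simp only [LinearIsometry.coe_toContinuousLinearMap, isometryOf_ξ]
  rw [inner_fejerVec]
  by_cases h : ∃ v, u = v * w
  · obtain ⟨v, rfl⟩ := h
    rw [inner_mul_apply_ξ, inner_mul_apply_ξ, FreeMonoid.length_mul, sum_range_ite_add,
      inner_cesaro, mul_assoc]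
  · push Not at h
    rw [inner_apply_ξ_eq_zero _ h, inner_apply_ξ_eq_zero _ h]
    simp

theorem norm_cesaro_le (n : ℕ) (A : LAlg d) : ‖(cesaro n A).1‖ ≤ ‖A.1‖ := by
  have hV : ‖(isometryOf (orthonormal_fejerVec (d := d) n)).toContinuousLinearMap‖ ≤ 1 :=
    LinearIsometry.norm_toContinuousLinearMap_le _
  have hA : ‖ampliation ℕ A.1‖ ≤ ‖A.1‖ := LinearMap.mkContinuous_norm_le _ (norm_nonneg _) _
  rw [cesaro_eq]
  refine (ContinuousLinearMap.opNorm_comp_le _ _).trans ?_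
  rw [LinearIsometryEquiv.norm_map]
  refine (mul_le_mul_of_nonneg_right hV (norm_nonneg _)).trans ?_
  rw [one_mul]
  refine (ContinuousLinearMap.opNorm_comp_le _ _).trans ?_
  exact (mul_le_mul hA hV (norm_nonneg _) (norm_nonneg _)).trans_eq (mul_one _)

theorem tendsto_cesaro (A : LAlg d) :
    Filter.Tendsto (fun n => (cesaro n A).1) Filter.atTop (@nhds _ (weakStar (Fock d)) A.1) := by
  refine tendsto_weakStar_of_entries (fun n => norm_cesaro_le n A) fun u w => ?_
  by_cases h : ∃ v, u = v * w
  · obtain ⟨v, rfl⟩ := h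
    simp only [inner_mul_apply_ξ, inner_cesaro]
    have h1 : Filter.Tendsto (fun n : ℕ => ((n : ℂ) + 1)⁻¹ * ((n + 1 - v.length : ℕ) : ℂ))
        Filter.atTop (𝓝 1) := by
      have h2 : Filter.Tendsto (fun n : ℕ => 1 - (v.length : ℂ) * (1 / ((n : ℂ) + 1)))
          Filter.atTop (𝓝 (1 - (v.length : ℂ) * 0)) :=
        (tendsto_const_nhds).sub (tendsto_one_div_add_atTop_nhds_zero_nat.const_mul _)
      rw [mul_zero, sub_zero] at h2
      refine h2.congr' ?_
      filter_upwards [Filter.eventually_ge_atTop v.length] with n hn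
      have : (n : ℂ) + 1 ≠ 0 := Nat.cast_add_one_ne_zero n
      rw [Nat.cast_sub (by omega)]
      push_cast
      field_simp
    simpa using h1.mul_const ⟪ξ v, A.1 (ξ 1)⟫_ℂ
  · push Not at h
    simp only [inner_apply_ξ_eq_zero _ h]
    exact tendsto_const_nhds

theorem cesaro_mem_span (n : ℕ) (A : LAlg d) :
    cesaro n A ∈ Submodule.span ℂ (Set.range (LHom d)) :=
  Submodule.sum_mem _ fun _ _ => Submodule.sum_mem _ fun v _ =>
    Submodule.smul_mem _ _ (Submodule.subset_span ⟨v, rfl⟩)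

/-- `𝓛_d` is contained in the weak* closed span of the operators `L_w`. -/
theorem mem_weakStarSpan_Lop (A : LAlg d) : A.1 ∈ weakStarSpan (Set.range (Lop (d := d))) := by
  refine mem_weakStarSpan_of_tendsto (tendsto_cesaro A) fun n => ?_
  have h := Submodule.mem_map_of_mem (f := (LAlg d).val.toLinearMap) (cesaro_mem_span n A)
  rw [Submodule.map_span, ← Set.range_comp] at h
  exact h

/-- A weak* continuous functional on `𝓛_d` that vanishes at all `L_w` is zero. -/
theorem eq_zero_of_LHom {f : LAlg d →ₗ[ℂ] ℂ}
    (hf : Continuous[weakStarOn (LAlg d : Set (Fock d →L[ℂ] Fock d)), inferInstance] f)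
    (h : ∀ w, f (LHom d w) = 0) (A : LAlg d) : f A = 0 := by
  have h0 : ∀ n, f (cesaro n A) = 0 := fun n =>
    (Submodule.span_le (p := LinearMap.ker f)).2 (by rintro _ ⟨w, rfl⟩; exact h w)
      (cesaro_mem_span n A)
  have ht : Filter.Tendsto (fun n => cesaro n A) Filter.atTop
      (@nhds _ (weakStarOn (LAlg d : Set (Fock d →L[ℂ] Fock d))) A) := by
    rw [@nhds_induced _ _ (weakStar (Fock d)), Filter.tendsto_comap_iff]
    exact tendsto_cesaro A
  have hA := (@Continuous.tendsto _ _ (weakStarOn (LAlg d : Set (Fock d →L[ℂ] Fock d))) _ _ hf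
    A).comp ht
  simp only [Function.comp_def, h0] at hA
  exact tendsto_nhds_unique hA tendsto_const_nhds

end

section

/-! ### Sandwiched operators -/

section Sandwich

variable {K K' : Type*} [NormedAddCommGroup K] [InnerProductSpace ℂ K]
  [NormedAddCommGroup K'] [InnerProductSpace ℂ K']

theorem continuous_fun_sub {X : Type*} {tX : TopologicalSpace X} {f g : X → ℂ}
    (hf : Continuous[tX, inferInstance] f) (hg : Continuous[tX, inferInstance] g) :
    Continuous[tX, inferInstance] fun x => f x - g x :=
  hf.sub hg

/-- The linear map `T ↦ Y T X`. -/
def sandwich (X : K' →L[ℂ] K) (Y : K →L[ℂ] K') : (K →L[ℂ] K) →ₗ[ℂ] (K' →L[ℂ] K') where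
  toFun T := Y ∘L T ∘L X
  map_add' S T := by ext; simp
  map_smul' c T := by ext; simp

theorem sandwich_apply (X : K' →L[ℂ] K) (Y : K →L[ℂ] K') (T : K →L[ℂ] K) :
    sandwich X Y T = Y ∘L T ∘L X := rfl

theorem continuous_sandwich_map [CompleteSpace K] [CompleteSpace K']
    (X : K' →L[ℂ] K) (Y : K →L[ℂ] K') :
    Continuous[weakStar K, weakStar K'] (sandwich X Y) :=
  continuous_sandwich X Y

/-- The linear map `T ↦ Y T^{(ι)} X`, where `T^{(ι)}` is the ampliation of `T`. -/
def ampSandwich {ι : Type*} (X : K' →L[ℂ] lp (fun _ : ι => K) 2)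
    (Y : lp (fun _ : ι => K) 2 →L[ℂ] K') : (K →L[ℂ] K) →ₗ[ℂ] (K' →L[ℂ] K') where
  toFun T := Y ∘L ampliation ι T ∘L X
  map_add' S T := by
    ext x
    simp only [ContinuousLinearMap.comp_apply, add_apply, ← map_add]
    rfl
  map_smul' c T := by
    ext x
    change Y (c • ampliation ι T (X x)) = c • Y (ampliation ι T (X x))
    rw [map_smul]

theorem continuous_ampSandwich [CompleteSpace K] [CompleteSpace K'] {ι : Type*} [Countable ι]
    (X : K' →L[ℂ] lp (fun _ : ι => K) 2) (Y : lp (fun _ : ι => K) 2 →L[ℂ] K') :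
    Continuous[weakStar K, weakStar K'] (ampSandwich X Y) :=
  continuous_sandwich_ampliation X Y

/-- The linear functional `T ↦ ⟪y, T x⟫`. -/
def innerFunctional (x y : K) : (K →L[ℂ] K) →ₗ[ℂ] ℂ where
  toFun T := ⟪y, T x⟫_ℂ
  map_add' S T := by simp
  map_smul' c T := by simp

theorem innerFunctional_apply (x y : K) (T : K →L[ℂ] K) :
    innerFunctional x y T = ⟪y, T x⟫_ℂ := rfl

theorem continuous_innerFunctional [CompleteSpace K] (x y : K) :
    Continuous[weakStar K, inferInstance] (innerFunctional x y) :=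
  continuous_inner_apply x y

theorem inner_tmul_tmul (x y x' y' : K) : ⟪tmul x y, tmul x' y'⟫_ℂ = ⟪x, x'⟫_ℂ * ⟪y, y'⟫_ℂ := by
  simp [tmul, UniformSpace.Completion.inner_coe, TensorProduct.inner_tmul]

theorem opTensor_comp {K₁ : Type*} [NormedAddCommGroup K₁] [InnerProductSpace ℂ K₁]
    (A B : K' →L[ℂ] K₁) (A' B' : K →L[ℂ] K') :
    opTensor A B ∘L opTensor A' B' = opTensor (A ∘L A') (B ∘L B') := by
  refine ContinuousLinearMap.ext fun z => ?_
  induction z using UniformSpace.Completion.induction_on with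
  | hp => exact isClosed_eq (ContinuousLinearMap.continuous _) (ContinuousLinearMap.continuous _)
  | ih z =>
    induction z using TensorProduct.induction_on with
    | zero => rw [UniformSpace.Completion.coe_zero, map_zero, map_zero]
    | tmul x y =>
      change (opTensor A B) ((opTensor A' B') (tmul x y)) = opTensor _ _ (tmul x y)
      simp [opTensor_tmul]
    | add a b ha hb => simp only [UniformSpace.Completion.coe_add, map_add, ha, hb]

/-- Operators on `K ⊗ K` are determined by their matrix coefficients at elementary tensors. -/
theorem ext_inner_tmul {S T : TensorSq K →L[ℂ] TensorSq K'}
    (h : ∀ x x' y y', ⟪tmul y y', S (tmul x x')⟫_ℂ = ⟪tmul y y', T (tmul x x')⟫_ℂ) : S = T := by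
  have h₁ : ∀ x x', S (tmul x x') = T (tmul x x') := by
    intro x x'
    refine ext_inner_left ℂ fun z => ?_
    induction z using UniformSpace.Completion.induction_on with
    | hp =>
      exact isClosed_eq (continuous_id.inner continuous_const)
        (continuous_id.inner continuous_const)
    | ih z =>
      induction z using TensorProduct.induction_on with
      | zero => rw [UniformSpace.Completion.coe_zero, inner_zero_left, inner_zero_left]
      | tmul y y' => exact h x x' y y'
      | add a b ha hb => simp only [UniformSpace.Completion.coe_add, inner_add_left, ha, hb]
  refine ContinuousLinearMap.ext fun z => ?_
  induction z using UniformSpace.Completion.induction_on with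
  | hp => exact isClosed_eq (ContinuousLinearMap.continuous _) (ContinuousLinearMap.continuous _)
  | ih z =>
    induction z using TensorProduct.induction_on with
    | zero => rw [UniformSpace.Completion.coe_zero, map_zero, map_zero]
    | tmul x y => exact h₁ x y
    | add a b ha hb => simp only [UniformSpace.Completion.coe_add, map_add, ha, hb]

theorem adjoint_opTensor [CompleteSpace K] [CompleteSpace K'] (A B : K →L[ℂ] K') :
    ContinuousLinearMap.adjoint (opTensor A B) =
      opTensor (ContinuousLinearMap.adjoint A) (ContinuousLinearMap.adjoint B) :=
  ext_inner_tmul fun x x' y y' => by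
    simp [ContinuousLinearMap.adjoint_inner_right, opTensor_tmul, inner_tmul_tmul]

/-- A weak* continuous linear map with `T ↦ T ⊗ T` on a subset of `A` maps the weak* closed span
of that subset to `A ⊗̄ A`. -/
theorem map_mem_normalTensor {A : Subalgebra ℂ (K →L[ℂ] K)} {s : Set (K →L[ℂ] K)}
    (f : (K →L[ℂ] K) →ₗ[ℂ] (TensorSq K →L[ℂ] TensorSq K))
    (hf : Continuous[weakStar K, weakStar (TensorSq K)] f) (hs : ∀ T ∈ s, T ∈ A)
    (h : ∀ T ∈ s, f T = opTensor T T) {T : K →L[ℂ] K} (hT : T ∈ weakStarSpan s) :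
    f T ∈ normalTensor A := by
  unfold normalTensor
  refine map_mem_weakStarSpan f hf (fun S hS => ?_) hT
  exact subset_weakStarSpan _ ⟨S, hs S hS, S, hs S hS, h S hS⟩

end Sandwich

variable {d : ℕ}

/-! ### The comultiplication of `𝓛_d` -/

instance : Countable (ReducedPair d) := by
  have : Countable (FreeMonoid (Fin d)) := inferInstanceAs (Countable (List (Fin d)))
  exact Subtype.countable

theorem comul_eq (A : LAlg d) :
    comul d A = ampSandwich (ContinuousLinearMap.adjoint (pairUnitary d).toContinuousLinearMap)
      (pairUnitary d).toContinuousLinearMap A.1 := rfl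

theorem comul_mem_normalTensor (A : LAlg d) : comul d A ∈ normalTensor (LAlg d) := by
  rw [comul_eq]
  refine map_mem_normalTensor _ (continuous_ampSandwich _ _) ?_ ?_ (mem_weakStarSpan_Lop A)
  · rintro _ ⟨w, rfl⟩
    exact Lop_mem w
  · rintro _ ⟨w, rfl⟩
    exact comul_LHom w

theorem orthonormal_diag :
    Orthonormal ℂ fun w : FreeMonoid (Fin d) => tmul (ξ w) (ξ w) := by
  rw [orthonormal_iff_ite]
  intro w w'
  simp [inner_tmul_ξ]

/-- The isometry `ξ_w ↦ ξ_w ⊗ ξ_w`. -/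
def diag (d : ℕ) : Fock d →ₗᵢ[ℂ] TensorSq (Fock d) := isometryOf orthonormal_diag

@[simp]
theorem diag_ξ (w : FreeMonoid (Fin d)) : diag d (ξ w) = tmul (ξ w) (ξ w) := by
  simp [diag]

/-- Both sides are weak* continuous in `A` and agree at `L_w`, where they equal `ξ_w ⊗ ξ_w`. This
turns `Δ` into pointwise multiplication of coefficient functions. -/
theorem comul_tmul_one (A : LAlg d) : comul d A (tmul (ξ 1) (ξ 1)) = diag d (A.1 (ξ 1)) := by
  refine ext_inner_left ℂ fun z => ?_
  rw [← sub_eq_zero]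
  let f : LAlg d →ₗ[ℂ] ℂ :=
    (innerFunctional (tmul (ξ 1) (ξ 1)) z ∘ₗ ampSandwich
        (ContinuousLinearMap.adjoint (pairUnitary d).toContinuousLinearMap)
        (pairUnitary d).toContinuousLinearMap -
      innerFunctional (ξ 1) (ContinuousLinearMap.adjoint (diag d).toContinuousLinearMap z)) ∘ₗ
      (LAlg d).val.toLinearMap
  have hf : ∀ A, f A = ⟪z, comul d A (tmul (ξ 1) (ξ 1))⟫_ℂ - ⟪z, diag d (A.1 (ξ 1))⟫_ℂ := by
    intro A
    change _ - ⟪ContinuousLinearMap.adjoint _ z, A.1 (ξ 1)⟫_ℂ = _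
    rw [ContinuousLinearMap.adjoint_inner_left]
    rfl
  rw [← hf]
  refine eq_zero_of_LHom ?_ (fun w => ?_) A
  · refine continuous_comp (tY := weakStar (Fock d)) (g := fun T => (innerFunctional
      (tmul (ξ 1) (ξ 1)) z (ampSandwich _ _ T)) - innerFunctional (ξ 1) _ T) ?_
      (continuous_weakStarOn_val _)
    exact continuous_fun_sub (continuous_comp (continuous_innerFunctional _ _)
      (continuous_ampSandwich _ _)) (continuous_innerFunctional _ _)
  · rw [hf, comul_LHom, opTensor_tmul, LHom_coe, Lop_ξ, mul_one, diag_ξ, sub_self]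

/-! ### Homogeneous components -/

/-- The orthogonal projection onto the span of the words of length `n`. -/
def degProj (n : ℕ) : Fock d →L[ℂ] Fock d :=
  ∑ w ∈ words d n, (innerSL ℂ (ξ w)).smulRight (ξ w)

theorem degProj_apply (n : ℕ) (x : Fock d) :
    degProj n x = ∑ w ∈ words d n, ⟪ξ w, x⟫_ℂ • ξ w := by
  simp [degProj]

theorem degProj_ξ (n : ℕ) (w : FreeMonoid (Fin d)) :
    degProj n (ξ w) = if w.length = n then ξ w else 0 := by
  simp [degProj_apply, inner_ξ_ξ]

theorem inner_degProj_left (n : ℕ) (x y : Fock d) :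
    ⟪degProj n x, y⟫_ℂ = ⟪x, degProj n y⟫_ℂ := by
  simp only [degProj_apply, sum_inner, inner_sum, inner_smul_left, inner_smul_right,
    inner_conj_symm]
  exact Finset.sum_congr rfl fun _ _ => mul_comm _ _

theorem inner_ξ_degProj (n : ℕ) (w : FreeMonoid (Fin d)) (x : Fock d) :
    ⟪ξ w, degProj n x⟫_ℂ = if w.length = n then ⟪ξ w, x⟫_ℂ else 0 := by
  rw [← inner_degProj_left, degProj_ξ]
  split_ifs <;> simp

/-- The homogeneous polynomial of degree `n` with the coefficients of `x`. -/
def polyOf (n : ℕ) : Fock d →ₗ[ℂ] LAlg d where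
  toFun x := ∑ w ∈ words d n, ⟪ξ w, x⟫_ℂ • LHom d w
  map_add' x y := by simp [add_smul, Finset.sum_add_distrib]
  map_smul' c x := by simp [mul_smul, Finset.smul_sum]

theorem polyOf_apply (n : ℕ) (x : Fock d) :
    polyOf n x = ∑ w ∈ words d n, ⟪ξ w, x⟫_ℂ • LHom d w := rfl

theorem polyOf_coe (n : ℕ) (x : Fock d) :
    (polyOf n x).1 = ∑ w ∈ words d n, ⟪ξ w, x⟫_ℂ • Lop w := by
  simp [polyOf_apply, LHom_coe]

theorem polyOf_apply_one (n : ℕ) (x : Fock d) : (polyOf n x).1 (ξ 1) = degProj n x := by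
  simp [polyOf_coe, degProj_apply]

theorem polyOf_ξ (n : ℕ) (w : FreeMonoid (Fin d)) :
    polyOf n (ξ w) = if w.length = n then LHom d w else 0 := by
  simp [polyOf_apply, inner_ξ_ξ]

/-- The homogeneous component of degree `n` of `A ∈ 𝓛_d`. -/
def homComp (n : ℕ) : LAlg d →ₗ[ℂ] LAlg d where
  toFun A := polyOf n (A.1 (ξ 1))
  map_add' A B := by rw [← map_add]; rfl
  map_smul' c A := by rw [RingHom.id_apply, ← map_smul]; rfl

theorem homComp_apply (n : ℕ) (A : LAlg d) : homComp n A = polyOf n (A.1 (ξ 1)) := rfl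

theorem homComp_apply_one (n : ℕ) (A : LAlg d) :
    (homComp n A).1 (ξ 1) = degProj n (A.1 (ξ 1)) := polyOf_apply_one _ _

theorem homComp_LHom (n : ℕ) (w : FreeMonoid (Fin d)) :
    homComp n (LHom d w) = if w.length = n then LHom d w else 0 := by
  rw [homComp_apply, LHom_coe, Lop_ξ, mul_one, polyOf_ξ]

theorem homComp_of_mem {n : ℕ} {A : LAlg d} (hA : A ∈ homogeneousPart d n) (m : ℕ) :
    homComp m A = if n = m then A else 0 := by
  have h : homogeneousPart d n ≤
      LinearMap.ker (homComp m - if n = m then LinearMap.id else 0) := by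
    refine Submodule.span_le.2 ?_
    rintro _ ⟨w, rfl, rfl⟩
    simp only [SetLike.mem_coe, LinearMap.mem_ker, LinearMap.sub_apply, homComp_LHom]
    split_ifs <;> simp
  have := h hA
  rw [LinearMap.mem_ker, LinearMap.sub_apply, sub_eq_zero] at this
  rw [this]
  split_ifs <;> simp

theorem degProj_Rop (n : ℕ) (w : FreeMonoid (Fin d)) (x : Fock d) :
    degProj (n + w.length) (Rop w x) = Rop w (degProj n x) := by
  have : degProj (n + w.length) ∘L (Rop w).toContinuousLinearMap =
      (Rop w).toContinuousLinearMap ∘L degProj n := by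
    refine ext_ξ fun u => ?_
    simp only [ContinuousLinearMap.comp_apply, LinearIsometry.coe_toContinuousLinearMap, Rop_ξ,
      degProj_ξ, FreeMonoid.length_mul, add_left_inj]
    split_ifs <;> simp
  exact DFunLike.congr_fun this x

theorem degProj_Rop_of_lt {n : ℕ} {w : FreeMonoid (Fin d)} (h : n < w.length) (x : Fock d) :
    degProj n (Rop w x) = 0 := by
  have : degProj n ∘L (Rop w).toContinuousLinearMap = 0 := by
    refine ext_ξ fun u => ?_
    simp only [ContinuousLinearMap.comp_apply, LinearIsometry.coe_toContinuousLinearMap, Rop_ξ,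
      degProj_ξ, FreeMonoid.length_mul]
    rw [if_neg (by omega)]
    rfl
  exact DFunLike.congr_fun this x

/-- At `x = ξ_w` one has `A ξ_w = R_w A ξ_∅`, and `R_w` raises the degree by `|w|`, so only the pair
`(n - |w|, |w|)` contributes. It is the grading behind `homComp_mul`. -/
theorem degProj_apply_eq (n : ℕ) (A : LAlg d) (x : Fock d) :
    degProj n (A.1 x) =
      ∑ p ∈ Finset.HasAntidiagonal.antidiagonal n, (homComp p.1 A).1 (degProj p.2 x) := by
  have : degProj n ∘L A.1 =
      ∑ p ∈ Finset.HasAntidiagonal.antidiagonal n, (homComp p.1 A).1 ∘L degProj p.2 := by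
    refine ext_ξ fun w => ?_
    simp only [ContinuousLinearMap.comp_apply, sum_apply, degProj_ξ]
    rw [apply_ξ]
    by_cases h : w.length ≤ n
    · obtain ⟨k, rfl⟩ := Nat.exists_eq_add_of_le' h
      rw [degProj_Rop, ← homComp_apply_one, ← apply_ξ, Finset.sum_eq_single (k, w.length)]
      · simp
      · rintro ⟨i, j⟩ hij hne
        rw [if_neg, map_zero]
        rintro rfl
        rw [Finset.HasAntidiagonal.mem_antidiagonal] at hij
        exact hne (Prod.ext (by simpa using hij) rfl)
      · simp
    · push Not at h
      rw [degProj_Rop_of_lt h, Finset.sum_eq_zero]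
      rintro ⟨i, j⟩ hij
      rw [Finset.HasAntidiagonal.mem_antidiagonal] at hij
      rw [if_neg (by simp at hij; omega), map_zero]
  simpa using DFunLike.congr_fun this x

theorem homComp_mul (n : ℕ) (A B : LAlg d) :
    homComp n (A * B) =
      ∑ p ∈ Finset.HasAntidiagonal.antidiagonal n, homComp p.1 A * homComp p.2 B := by
  refine LAlg_ext ?_
  have h : (∑ p ∈ Finset.HasAntidiagonal.antidiagonal n, homComp p.1 A * homComp p.2 B : LAlg d).1 =
      ∑ p ∈ Finset.HasAntidiagonal.antidiagonal n, (homComp p.1 A).1 * (homComp p.2 B).1 := by simp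
  rw [h, homComp_apply_one, sum_apply]
  change degProj n (A.1 (B.1 (ξ 1))) = _
  rw [degProj_apply_eq]
  refine Finset.sum_congr rfl fun p _ => ?_
  rw [mul_apply_eq_comp, homComp_apply_one]

/-- Only finitely many coefficients enter, each a WOT-continuous functional. It serves to show that
the auxiliary ideal in `homComp_mem` is closed. -/
theorem continuous_homComp (n : ℕ) :
    Continuous fun T : Fock d →WOT[ℂ] Fock d =>
      (ContinuousLinearMapWOT.ofCLM (∑ w ∈ words d n, ⟪ξ w, T (ξ 1)⟫_ℂ • Lop w) :
        Fock d →WOT[ℂ] Fock d) := by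
  have : (fun T : Fock d →WOT[ℂ] Fock d =>
      (ContinuousLinearMapWOT.ofCLM (∑ w ∈ words d n, ⟪ξ w, T (ξ 1)⟫_ℂ • Lop w) :
        Fock d →WOT[ℂ] Fock d)) = fun T : Fock d →WOT[ℂ] Fock d =>
      ∑ w ∈ words d n, ⟪ξ w, T (ξ 1)⟫_ℂ • (ContinuousLinearMapWOT.ofCLM (Lop w) :
        Fock d →WOT[ℂ] Fock d) := by
    funext T
    exact map_sum (ContinuousLinearMapWOT.linearEquiv ℂ).symm _ _
  rw [this]
  refine continuous_finsetSum _ fun w _ => Continuous.fun_smul ?_ continuous_const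
  exact ContinuousLinearMapWOT.continuous_dual_apply (ξ 1) (innerSL ℂ (ξ w))

/-- A homogeneous WOT-closed ideal contains the homogeneous components of its elements. -/
theorem homComp_mem {J : TwoSidedIdeal (LAlg d)} (hJ : IsHomogeneousHopfIdeal J) {A : LAlg d}
    (hA : A ∈ J) (n : ℕ) : homComp n A ∈ J := by
  obtain ⟨G, hG, ⟨-, hGJ⟩, hmin⟩ := hJ.homogeneous
  -- The elements with all components in `J` form an ideal by `homComp_mul`. It is WOT-closed and
  -- contains the homogeneous generators, so minimality of `J` gives `J ≤ I`.
  let I : TwoSidedIdeal (LAlg d) := TwoSidedIdeal.mk' {A | ∀ n, homComp n A ∈ J}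
    (fun n => by rw [map_zero]; exact J.zero_mem)
    (fun hx hy n => by rw [map_add]; exact J.add_mem (hx n) (hy n))
    (fun hx n => by rw [map_neg]; exact J.neg_mem (hx n))
    (fun hy n => by
      rw [homComp_mul]
      exact sum_mem fun p _ => J.mul_mem_left _ _ (hy _))
    (fun hx n => by
      rw [homComp_mul]
      exact sum_mem fun p _ => J.mul_mem_right _ _ (hx _))
  have hI : ∀ A, A ∈ I ↔ ∀ n, homComp n A ∈ J := fun A => TwoSidedIdeal.mem_mk' _ _ _ _ _ _ _
  have hIJ : J ≤ I := by
    refine hmin ⟨?_, fun A hA => ?_⟩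
    · have : (ContinuousLinearMapWOT.toCLM : (Fock d →WOT[ℂ] Fock d) → _) ⁻¹'
          (Subtype.val '' {A : LAlg d | A ∈ I}) =
          (ContinuousLinearMapWOT.toCLM ⁻¹' (LAlg d : Set (Fock d →L[ℂ] Fock d))) ∩
          ⋂ n, (fun T : Fock d →WOT[ℂ] Fock d =>
            (ContinuousLinearMapWOT.ofCLM (∑ w ∈ words d n, ⟪ξ w, T (ξ 1)⟫_ℂ • Lop w) :
              Fock d →WOT[ℂ] Fock d)) ⁻¹' (ContinuousLinearMapWOT.toCLM ⁻¹'
              (Subtype.val '' {A : LAlg d | A ∈ J})) := by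
        ext T
        simp only [Set.mem_preimage, Set.mem_image, Set.mem_ofPred_eq, Set.mem_inter_iff,
          Set.mem_iInter, SetLike.mem_coe]
        constructor
        · rintro ⟨A, hA, hAT⟩
          refine ⟨hAT ▸ A.2, fun n => ⟨homComp n A, (hI A).1 hA n, ?_⟩⟩
          rw [homComp_apply, polyOf_coe, hAT]
          rfl
        · rintro ⟨hT, h⟩
          refine ⟨⟨_, hT⟩, (hI _).2 fun n => ?_, rfl⟩
          obtain ⟨B, hB, hBT⟩ := h n
          convert hB
          refine Subtype.ext ?_
          rw [hBT, homComp_apply, polyOf_coe]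
          rfl
      rw [IsClosedIdeal, IsWOTClosed, this]
      refine isWOTClosed_LAlg.inter (isClosed_iInter fun n => ?_)
      exact IsClosed.preimage (continuous_homComp n) hJ.closed
    · rw [hI]
      intro n
      obtain ⟨m, hm⟩ := hG A hA
      rw [homComp_of_mem hm]
      split_ifs
      exacts [hGJ A hA, J.zero_mem]
  exact (hI A).1 (hIJ hA) n

end

section

variable {d : ℕ}

/-! ### The compression to `N_J` -/

section Compression

variable (J : TwoSidedIdeal (LAlg d))

/-- The orthogonal projection of the Fock space onto `N_J`. -/
abbrev projN : Fock d →L[ℂ] NSpace J := (NSpace J).orthogonalProjectionOnto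

theorem inner_projN_right (y : NSpace J) (x : Fock d) : ⟪y, projN J x⟫_ℂ = ⟪(y : Fock d), x⟫_ℂ := by
  simp

theorem adjoint_projN : ContinuousLinearMap.adjoint (projN J) = (NSpace J).subtypeL :=
  (ContinuousLinearMap.eq_adjoint_iff _ _).2 (fun y x => by
    rw [inner_projN_right]; rfl) |>.symm

theorem inner_compress (T : Fock d →L[ℂ] Fock d) (x y : NSpace J) :
    ⟪y, compress J T x⟫_ℂ = ⟪(y : Fock d), T x⟫_ℂ := by
  simp [compress]

theorem proj_coe (A : LAlg d) : (proj J A).1 = compress J A.1 := rfl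

variable {J}

/-- Since `A L_w ∈ J`, the vector `y` is orthogonal to `A ξ_w` for every word `w`, not only to `A
ξ_∅`. -/
theorem adjoint_eq_zero_of_mem {A : LAlg d} (hA : A ∈ J) {y : Fock d} (hy : y ∈ NSpace J) :
    ContinuousLinearMap.adjoint A.1 y = 0 := by
  refine ext_inner_ξ fun w => ?_
  have e : (A * LHom d w).1 (ξ 1) = A.1 (ξ w) := by
    change A.1 (Lop w (ξ 1)) = _
    simp
  rw [ContinuousLinearMap.adjoint_inner_right, ← e,
    mem_NSpace.1 hy _ (J.mul_mem_right A _ hA), inner_zero_right]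

/-- This is coinvariance: `A*` maps `N_J` into itself, so nothing is lost by projecting before `A`
is applied. -/
theorem compress_projN (A : LAlg d) (x : Fock d) :
    compress J A.1 (projN J x) = projN J (A.1 x) := by
  refine ext_inner_left ℂ fun y => ?_
  rw [inner_compress, inner_projN_right, ← ContinuousLinearMap.adjoint_inner_left,
    ← ContinuousLinearMap.adjoint_inner_left]
  have h := inner_projN_right J ⟨_, adjoint_mem_NSpace J A y.2⟩ x
  rw [← h]
  rfl

variable (J) in
/-- The vacuum vector of `N_J`. -/
def vac : NSpace J := projN J (ξ 1)

theorem proj_vac (A : LAlg d) : (proj J A).1 (vac J) = projN J (A.1 (ξ 1)) :=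
  compress_projN A _

/-- The space `J ξ_∅` is invariant under right shifts, because `R_w A ξ_∅ = A L_w ξ_∅`. -/
theorem adjoint_Rop_mem {y : Fock d} (hy : y ∈ NSpace J) (w : FreeMonoid (Fin d)) :
    ContinuousLinearMap.adjoint (Rop w).toContinuousLinearMap y ∈ NSpace J := by
  rw [mem_NSpace] at hy ⊢
  intro A hA
  rw [ContinuousLinearMap.adjoint_inner_right]
  have h := hy (A * LHom d w) (J.mul_mem_right A _ hA)
  have e : (A * LHom d w).1 (ξ 1) = Rop w (A.1 (ξ 1)) := by
    change A.1 (Lop w (ξ 1)) = _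
    rw [Lop_ξ, mul_one, apply_ξ]
  rw [← h, e]
  rfl

/-- An element of `𝓛_J` is determined by its value at the vacuum: `⟪y, A ξ_w⟫ = ⟪R_w* y, A ξ_∅⟫`,
and `R_w* y` stays in `N_J`. -/
theorem proj_ext {A B : LAlg d} (h : projN J (A.1 (ξ 1)) = projN J (B.1 (ξ 1))) :
    proj J A = proj J B := by
  have key : ∀ (y : NSpace J) (A : LAlg d) (w : FreeMonoid (Fin d)), ⟪(y : Fock d), A.1 (ξ w)⟫_ℂ =
      ⟪(⟨_, adjoint_Rop_mem y.2 w⟩ : NSpace J), projN J (A.1 (ξ 1))⟫_ℂ := by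
    intro y A w
    rw [apply_ξ, inner_projN_right, ContinuousLinearMap.adjoint_inner_left]
    rfl
  have hy : ∀ y : NSpace J, innerSL ℂ (y : Fock d) ∘L A.1 = innerSL ℂ (y : Fock d) ∘L B.1 :=
    fun y => ext_ξ fun w => by
      change ⟪(y : Fock d), A.1 (ξ w)⟫_ℂ = ⟪(y : Fock d), B.1 (ξ w)⟫_ℂ
      rw [key, key, h]
  refine Subtype.ext (ContinuousLinearMap.ext fun x => ext_inner_left ℂ fun y => ?_)
  rw [proj_coe, proj_coe, inner_compress, inner_compress]
  exact DFunLike.congr_fun (hy y) (x : Fock d)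

theorem projN_eq_zero_iff {x : Fock d} :
    projN J x = 0 ↔ ∀ y ∈ NSpace J, ⟪y, x⟫_ℂ = 0 := by
  constructor
  · intro h y hy
    rw [← inner_projN_right J ⟨y, hy⟩, h, inner_zero_right]
  · intro h
    refine ext_inner_left ℂ fun y => ?_
    rw [inner_projN_right, h _ y.2, inner_zero_right]

theorem continuous_proj :
    Continuous[weakStarOn (LAlg d : Set (Fock d →L[ℂ] Fock d)),
      weakStarOn (LJ J : Set (NSpace J →L[ℂ] NSpace J))] (proj J) :=
  continuous_weakStarOn_rng (continuous_comp
    (g := sandwich (NSpace J).subtypeL (projN J)) (continuous_sandwich_map _ _)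
    (continuous_weakStarOn_val _))

theorem proj_surjective (F : LJ J) : ∃ A, proj J A = F := by
  obtain ⟨A, hA⟩ := F.2
  exact ⟨A, Subtype.ext hA⟩

end Compression

/-! ### The comultiplication of `𝓛_J` -/

section Comul

variable {J : TwoSidedIdeal (LAlg d)}

/-- For `B ∈ J` the adjoints of `B ⊗ C` and `C ⊗ B` kill `y ⊗ z`, as `B*` kills `N_J`. By weak*
continuity this extends to the closed span that contains `Δ(A)`. -/
theorem inner_comul_eq_zero (hJ : IsHomogeneousHopfIdeal J) {A : LAlg d} (hA : A ∈ J)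
    {y z : Fock d} (hy : y ∈ NSpace J) (hz : z ∈ NSpace J) (t : TensorSq (Fock d)) :
    ⟪tmul y z, comul d A t⟫_ℂ = 0 := by
  refine eq_zero_of_mem_weakStarSpan (innerFunctional t (tmul y z))
    (continuous_innerFunctional _ _) ?_ (hJ.coideal A hA)
  have h0 : ∀ x : Fock d, tmul 0 x = 0 ∧ tmul x 0 = 0 := fun x => by simp [tmul]
  rintro _ ⟨B, hB, C, rfl | rfl⟩
  · rw [innerFunctional_apply, ← ContinuousLinearMap.adjoint_inner_left, adjoint_opTensor,
      opTensor_tmul, adjoint_eq_zero_of_mem hB hy, (h0 _).1, inner_zero_left]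
  · rw [innerFunctional_apply, ← ContinuousLinearMap.adjoint_inner_left, adjoint_opTensor,
      opTensor_tmul, adjoint_eq_zero_of_mem hB hz, (h0 _).2, inner_zero_left]

theorem adjoint_pairUnitary_apply (x : lp (fun _ : ReducedPair d => Fock d) 2) :
    ContinuousLinearMap.adjoint (pairUnitary d).toContinuousLinearMap (pairUnitary d x) = x := by
  refine ext_inner_left ℂ fun z => ?_
  rw [ContinuousLinearMap.adjoint_inner_right]
  exact (pairUnitary d).inner_map_map _ _

/-- On the copy of the Fock space with index `r`, `Δ(A)` acts as `A`. So testing `⟪y ⊗ z, Δ(A) t⟫ =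
0` at the vacuum `t` of that copy shows that the component of `y ⊗ z` is orthogonal to `A ξ_∅`. -/
theorem adjoint_pairUnitary_mem (hJ : IsHomogeneousHopfIdeal J) {y z : Fock d}
    (hy : y ∈ NSpace J) (hz : z ∈ NSpace J) (r : ReducedPair d) :
    ContinuousLinearMap.adjoint (pairUnitary d).toContinuousLinearMap (tmul y z) r ∈ NSpace J := by
  classical
  rw [mem_NSpace]
  intro A hA
  have h := inner_comul_eq_zero hJ hA hy hz (pairUnitary d (lp.single 2 r (ξ 1)))
  refine (lp.inner_single_left (G := fun _ => Fock d) r (A.1 (ξ 1)) _).symm.trans ?_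
  rw [ContinuousLinearMap.adjoint_inner_right, ← ampliation_single,
    ← inner_conj_symm, ← map_zero (starRingEnd ℂ), ← h]
  congr 2
  change _ = pairUnitary d (ampliation _ A.1 (ContinuousLinearMap.adjoint _ (pairUnitary d _)))
  rw [adjoint_pairUnitary_apply]
  rfl

theorem inner_opTensor_projN (y y' : NSpace J) (t : TensorSq (Fock d)) :
    ⟪tmul y y', opTensor (projN J) (projN J) t⟫_ℂ = ⟪tmul (y : Fock d) (y' : Fock d), t⟫_ℂ := by
  refine (ContinuousLinearMap.adjoint_inner_left (opTensor (projN J) (projN J)) t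
    (tmul y y')).symm.trans ?_
  rw [adjoint_opTensor, opTensor_tmul, adjoint_projN]
  rfl

theorem inner_pairUnitary_ampliation (B : Fock d →L[ℂ] Fock d) (s t : TensorSq (Fock d)) :
    ⟪s, pairUnitary d (ampliation _ B (ContinuousLinearMap.adjoint
        (pairUnitary d).toContinuousLinearMap t))⟫_ℂ =
      ∑' r, ⟪ContinuousLinearMap.adjoint (pairUnitary d).toContinuousLinearMap s r,
        B (ContinuousLinearMap.adjoint (pairUnitary d).toContinuousLinearMap t r)⟫_ℂ := by
  rw [← inner_ampliation, ContinuousLinearMap.adjoint_inner_left]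
  rfl

/-- The components of `y ⊗ y'` lie in `N_J`, so in each copy `A` may be replaced by `π_J(A) P`.
Hence the compression of `Δ(A)` depends only on `π_J(A)`, in a weak* continuous way, and `Δ_J` is
well defined. -/
theorem inner_comul_compress (hJ : IsHomogeneousHopfIdeal J) (A : LAlg d) (x x' y y' : NSpace J) :
    ⟪tmul (y : Fock d) (y' : Fock d), comul d A (tmul (x : Fock d) (x' : Fock d))⟫_ℂ =
      ⟪tmul (y : Fock d) (y' : Fock d), pairUnitary d (ampliation _
        (sandwich (projN J) (NSpace J).subtypeL (proj J A).1) (ContinuousLinearMap.adjoint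
        (pairUnitary d).toContinuousLinearMap (tmul (x : Fock d) (x' : Fock d))))⟫_ℂ := by
  rw [inner_pairUnitary_ampliation]
  refine (inner_pairUnitary_ampliation A.1 _ _).trans (tsum_congr fun r => ?_)
  have hy := adjoint_pairUnitary_mem hJ y.2 y'.2 r
  rw [sandwich_apply, ContinuousLinearMap.comp_apply, ContinuousLinearMap.comp_apply, proj_coe,
    compress_projN]
  exact (inner_projN_right J ⟨_, hy⟩ _).symm

variable (J) in
/-- The comultiplication of `𝓛_J` as the restriction of a linear map on `B(N_J)`. -/
def comulJLin : (NSpace J →L[ℂ] NSpace J) →ₗ[ℂ]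
    (TensorSq (NSpace J) →L[ℂ] TensorSq (NSpace J)) :=
  ampSandwich (ContinuousLinearMap.adjoint (pairUnitary d).toContinuousLinearMap ∘L
        opTensor (NSpace J).subtypeL (NSpace J).subtypeL)
      (opTensor (projN J) (projN J) ∘L (pairUnitary d).toContinuousLinearMap) ∘ₗ
    sandwich (projN J) (NSpace J).subtypeL

variable (J) in
theorem continuous_comulJLin :
    Continuous[weakStar (NSpace J), weakStar (TensorSq (NSpace J))] (comulJLin J) :=
  continuous_comp (g := ampSandwich _ _) (continuous_ampSandwich _ _)
    (continuous_sandwich_map _ _)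

theorem compress_comul (hJ : IsHomogeneousHopfIdeal J) (A : LAlg d) :
    opTensor (projN J) (projN J) ∘L comul d A ∘L
      opTensor (NSpace J).subtypeL (NSpace J).subtypeL = comulJLin J (proj J A).1 := by
  refine ext_inner_tmul fun x x' y y' => ?_
  rw [ContinuousLinearMap.comp_apply, inner_opTensor_projN, ContinuousLinearMap.comp_apply,
    opTensor_tmul]
  refine (inner_comul_compress hJ A x x' y y').trans ?_
  refine Eq.trans ?_ (inner_opTensor_projN y y' (pairUnitary d (ampliation _
    (sandwich (projN J) (NSpace J).subtypeL (proj J A).1) (ContinuousLinearMap.adjoint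
      (pairUnitary d).toContinuousLinearMap
      (opTensor (NSpace J).subtypeL (NSpace J).subtypeL (tmul x x')))))).symm
  rw [opTensor_tmul]
  rfl

theorem comulJ_eq (hJ : IsHomogeneousHopfIdeal J) (F : LJ J) :
    comulJ J F = comulJLin J F.1 := by
  have h : (proj J (Classical.choose F.2)).1 = F.1 := Classical.choose_spec F.2
  rw [comulJ, compress_comul hJ, h]

theorem comulJ_proj (hJ : IsHomogeneousHopfIdeal J) (A : LAlg d) :
    comulJ J (proj J A) = opTensor (projN J) (projN J) ∘L comul d A ∘L
      opTensor (NSpace J).subtypeL (NSpace J).subtypeL := by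
  rw [comulJ_eq hJ, compress_comul hJ]

theorem comulJ_proj_LHom (hJ : IsHomogeneousHopfIdeal J) (w : FreeMonoid (Fin d)) :
    comulJ J (proj J (LHom d w)) = opTensor (proj J (LHom d w)).1 (proj J (LHom d w)).1 := by
  rw [comulJ_proj hJ, comul_LHom, opTensor_comp, opTensor_comp]
  rfl

theorem mem_weakStarSpan_proj (A : LAlg d) :
    (proj J A).1 ∈ weakStarSpan (Set.range fun w => (proj J (LHom d w)).1) := by
  refine map_mem_weakStarSpan (sandwich (NSpace J).subtypeL (projN J))
    (continuous_sandwich_map _ _) ?_ (mem_weakStarSpan_Lop A)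
  rintro _ ⟨w, rfl⟩
  exact subset_weakStarSpan _ ⟨w, rfl⟩

theorem comulJ_mem_normalTensor (hJ : IsHomogeneousHopfIdeal J) (F : LJ J) :
    comulJ J F ∈ normalTensor (LJ J) := by
  obtain ⟨A, rfl⟩ := proj_surjective F
  rw [comulJ_eq hJ]
  refine map_mem_normalTensor (comulJLin J) (continuous_comulJLin J) ?_ ?_
    (mem_weakStarSpan_proj A)
  · rintro _ ⟨w, rfl⟩
    exact (proj J (LHom d w)).2
  · rintro _ ⟨w, rfl⟩
    exact (comulJ_eq hJ (proj J (LHom d w))).symm.trans (comulJ_proj_LHom hJ w)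

end Comul

end

section

variable {d : ℕ} {J : TwoSidedIdeal (LAlg d)}

/-! ### Polynomials in a homogeneous ideal -/

variable (J) in
/-- The ideal `J` as a complex subspace of `𝓛_d`. -/
def idealSubmodule : Submodule ℂ (LAlg d) where
  carrier := {A | A ∈ J}
  add_mem' := J.add_mem
  zero_mem' := J.zero_mem
  smul_mem' c A hA := by
    have h := J.mul_mem_left (c • 1) A hA
    rwa [smul_mul_assoc, one_mul] at h

/-- Evaluation at the vacuum vector. -/
def evalOne (d : ℕ) : LAlg d →ₗ[ℂ] Fock d where
  toFun A := A.1 (ξ 1)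
  map_add' _ _ := rfl
  map_smul' _ _ := rfl

/-- The hypothesis only places `A ξ_∅` in the closure of `J ξ_∅`. The degree `n` part of `J ξ_∅` is
finite-dimensional, hence closed, so the degree `n` part of `A ξ_∅` equals that of some `B ξ_∅` with
`B ∈ J`. -/
theorem homComp_mem_of_projN_eq_zero (hJ : IsHomogeneousHopfIdeal J) {A : LAlg d}
    (hA : projN J (A.1 (ξ 1)) = 0) (n : ℕ) : homComp n A ∈ J := by
  let M : Submodule ℂ (Fock d) := (idealSubmodule J).map (evalOne d ∘ₗ homComp n)
  have hM : M ≤ Submodule.span ℂ (ξ '' (words d n : Set (FreeMonoid (Fin d)))) := by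
    rintro _ ⟨B, -, rfl⟩
    change (homComp n B).1 (ξ 1) ∈ _
    rw [homComp_apply_one, degProj_apply]
    exact Submodule.sum_mem _ fun w hw =>
      Submodule.smul_mem _ _ (Submodule.subset_span ⟨w, hw, rfl⟩)
  have hfin : FiniteDimensional ℂ
      (Submodule.span ℂ (ξ '' (words d n : Set (FreeMonoid (Fin d))))) :=
    FiniteDimensional.span_of_finite ℂ ((words d n).finite_toSet.image _)
  have hMfin : FiniteDimensional ℂ M := Submodule.finiteDimensional_of_le hM
  have hclosed : IsClosed ((M.comap (degProj n : Fock d →L[ℂ] Fock d).toLinearMap :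
      Submodule ℂ (Fock d)) : Set (Fock d)) :=
    M.closed_of_finiteDimensional.preimage (degProj n).continuous
  have hsub : Submodule.span ℂ {x | ∃ A ∈ J, x = A.1 (ξ 1)} ≤
      M.comap (degProj n : Fock d →L[ℂ] Fock d).toLinearMap := by
    refine Submodule.span_le.2 ?_
    rintro _ ⟨B, hB, rfl⟩
    exact ⟨B, hB, homComp_apply_one n B⟩
  have hx : A.1 (ξ 1) ∈ (Submodule.span ℂ {x | ∃ A ∈ J, x = A.1 (ξ 1)}).topologicalClosure := by
    rw [← Submodule.orthogonal_orthogonal_eq_closure]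
    exact fun y hy => projN_eq_zero_iff.1 hA y hy
  obtain ⟨B, hB, hBA⟩ := Submodule.topologicalClosure_minimal _ hsub hclosed hx
  have : homComp n A = homComp n B := LAlg_ext (by
    rw [homComp_apply_one]
    exact hBA.symm)
  rw [this]
  exact homComp_mem hJ hB n

theorem eq_sum_homComp {A : LAlg d} (hA : A ∈ Submodule.span ℂ (Set.range (LHom d))) :
    ∃ N, ∀ M ≥ N, ∑ n ∈ Finset.range M, homComp n A = A := by
  induction hA using Submodule.span_induction with
  | mem A hA =>
    obtain ⟨w, rfl⟩ := hA
    refine ⟨w.length + 1, fun M hM => ?_⟩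
    simp only [homComp_LHom, Finset.sum_ite_eq, Finset.mem_range]
    rw [if_pos (by omega)]
  | zero => exact ⟨0, fun M _ => by simp⟩
  | add A B _ _ hA hB =>
    obtain ⟨N, hN⟩ := hA
    obtain ⟨N', hN'⟩ := hB
    refine ⟨max N N', fun M hM => ?_⟩
    simp only [map_add, Finset.sum_add_distrib]
    rw [hN M (le_of_max_le_left hM), hN' M (le_of_max_le_right hM)]
  | smul c A _ hA =>
    obtain ⟨N, hN⟩ := hA
    refine ⟨N, fun M hM => ?_⟩
    simp only [map_smul, ← Finset.smul_sum]
    rw [hN M hM]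

theorem mem_of_projN_eq_zero (hJ : IsHomogeneousHopfIdeal J) {A : LAlg d}
    (hA : A ∈ Submodule.span ℂ (Set.range (LHom d))) (h : projN J (A.1 (ξ 1)) = 0) : A ∈ J := by
  obtain ⟨N, hN⟩ := eq_sum_homComp hA
  rw [← hN N le_rfl]
  exact sum_mem fun n _ => homComp_mem_of_projN_eq_zero hJ h n

theorem LHom_mem_span (w : FreeMonoid (Fin d)) :
    LHom d w ∈ Submodule.span ℂ (Set.range (LHom d)) := Submodule.subset_span ⟨w, rfl⟩

theorem LHom₀_coe (w : FreeMonoid (Fin d)) :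
    LHom₀ d (w : WithZero (FreeMonoid (Fin d))) = LHom d w := rfl

theorem LHom₀_mem_span (x : WithZero (FreeMonoid (Fin d))) :
    LHom₀ d x ∈ Submodule.span ℂ (Set.range (LHom d)) := by
  obtain rfl | hx := eq_or_ne x 0
  · rw [map_zero]
    exact Submodule.zero_mem _
  · obtain ⟨w, rfl⟩ := WithZero.ne_zero_iff_exists.1 hx
    exact LHom_mem_span w

/-! ### The semigroup of `J` -/

theorem Ls_mk (x : WithZero (FreeMonoid (Fin d))) :
    Ls J (x : (congr J).Quotient) = proj J (LHom₀ d x) := rfl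

theorem Ls_injective (hJ : IsHomogeneousHopfIdeal J) : Function.Injective (Ls J) := by
  intro s t h
  induction s using Con.induction_on with | _ x
  induction t using Con.induction_on with | _ y
  refine (Con.eq _).2 ((congr_iff J x y).2 ?_)
  refine mem_of_projN_eq_zero hJ (Submodule.sub_mem _ (LHom₀_mem_span x) (LHom₀_mem_span y)) ?_
  rw [← proj_vac, map_sub, ← Ls_mk, ← Ls_mk, h, sub_self]
  rfl

theorem Ls_mul (s t : Semi J) : Ls J (s * t) = Ls J s * Ls J t := by
  induction s using Con.induction_on with | _ x
  induction t using Con.induction_on with | _ y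
  rw [← Con.coe_mul, Ls_mk, Ls_mk, Ls_mk, map_mul, map_mul]

theorem Ls_zero : Ls J 0 = 0 := by
  change proj J (LHom₀ d 0) = 0
  rw [map_zero, map_zero]

variable (J) in
/-- The class of a word in the semigroup of `J`. -/
def wordClass (w : FreeMonoid (Fin d)) : Semi J :=
  ((w : WithZero (FreeMonoid (Fin d))) : (congr J).Quotient)

theorem Ls_wordClass (w : FreeMonoid (Fin d)) : Ls J (wordClass J w) = proj J (LHom d w) := rfl

theorem wordClass_mul (u v : FreeMonoid (Fin d)) :
    wordClass J (u * v) = wordClass J u * wordClass J v := rfl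

theorem wordClass_one : wordClass J 1 = 1 := rfl

theorem eq_zero_or_wordClass (s : Semi J) : s = 0 ∨ ∃ w, s = wordClass J w := by
  induction s using Con.induction_on with | _ x
  obtain rfl | hx := eq_or_ne x 0
  · exact Or.inl rfl
  · obtain ⟨w, rfl⟩ := WithZero.ne_zero_iff_exists.1 hx
    exact Or.inr ⟨w, rfl⟩

theorem Semi.zero_mul (s : Semi J) : 0 * s = 0 := by
  induction s using Con.induction_on with | _ x
  change (((0 * x : WithZero (FreeMonoid (Fin d)))) : (congr J).Quotient) = _
  rw [MulZeroClass.zero_mul]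
  rfl

theorem Semi.mul_zero (s : Semi J) : s * 0 = 0 := by
  induction s using Con.induction_on with | _ x
  change (((x * 0 : WithZero (FreeMonoid (Fin d)))) : (congr J).Quotient) = _
  rw [MulZeroClass.mul_zero]
  rfl

theorem wordClass_eq_iff (u v : FreeMonoid (Fin d)) :
    wordClass J u = wordClass J v ↔ LHom d u - LHom d v ∈ J :=
  (Con.eq _).trans (congr_iff J _ _)

theorem wordClass_eq_zero_iff (u : FreeMonoid (Fin d)) : wordClass J u = 0 ↔ LHom d u ∈ J := by
  refine (Con.eq _).trans ((congr_iff J _ _).trans ?_)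
  rw [map_zero, sub_zero, LHom₀_coe]

/-- If the lengths differed, the component of `L_u - L_v` of degree `|u|` would be `L_u`, and
homogeneity would put it in `J`. So a nonzero class is a finite set of words of one length. -/
theorem length_eq_of_wordClass_eq (hJ : IsHomogeneousHopfIdeal J) {u v : FreeMonoid (Fin d)}
    (hu : wordClass J u ≠ 0) (h : wordClass J u = wordClass J v) : u.length = v.length := by
  by_contra hne
  have hmem := homComp_mem hJ ((wordClass_eq_iff u v).1 h) u.length
  rw [map_sub, homComp_LHom, homComp_LHom, if_pos rfl, if_neg (Ne.symm hne), sub_zero] at hmem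
  exact hu ((wordClass_eq_zero_iff u).2 hmem)

/-- A weak* continuous functional on `𝓛_J` that vanishes at all `L_s` is zero. -/
theorem eq_zero_of_Ls {f : LJ J →ₗ[ℂ] ℂ}
    (hf : Continuous[weakStarOn (LJ J : Set (NSpace J →L[ℂ] NSpace J)), inferInstance] f)
    (h : ∀ s, f (Ls J s) = 0) (F : LJ J) : f F = 0 := by
  obtain ⟨A, rfl⟩ := proj_surjective F
  exact eq_zero_of_LHom (f := f ∘ₗ (proj J).toLinearMap)
    (continuous_comp (g := f) hf continuous_proj) (fun w => h (wordClass J w)) A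

theorem comulJ_Ls (hJ : IsHomogeneousHopfIdeal J) (s : Semi J) :
    comulJ J (Ls J s) = opTensor (Ls J s).1 (Ls J s).1 := by
  obtain rfl | ⟨w, rfl⟩ := eq_zero_or_wordClass s
  · rw [comulJ_eq hJ, Ls_zero]
    refine (map_zero (comulJLin J)).trans (ext_inner_tmul fun x x' y y' => ?_)
    rw [opTensor_tmul]
    simp [tmul, UniformSpace.Completion.coe_zero]
  · exact comulJ_proj_LHom hJ w

/-! ### Indicator functions of classes -/

/-- The pointwise product of two vectors of the Fock space. -/
def pmul (y z : Fock d) : Fock d :=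
  ContinuousLinearMap.adjoint (diag d).toContinuousLinearMap (tmul y z)

theorem inner_pmul_left (y z x : Fock d) : ⟪pmul y z, x⟫_ℂ = ⟪tmul y z, diag d x⟫_ℂ :=
  ContinuousLinearMap.adjoint_inner_left _ _ _

theorem inner_ξ_pmul (w : FreeMonoid (Fin d)) (y z : Fock d) :
    ⟪ξ w, pmul y z⟫_ℂ = ⟪ξ w, y⟫_ℂ * ⟪ξ w, z⟫_ℂ := by
  rw [← inner_conj_symm, inner_pmul_left, diag_ξ, inner_tmul_tmul, map_mul, inner_conj_symm,
    inner_conj_symm]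

/-- The pairing of the pointwise product with `A ξ_∅` is that of `y ⊗ z` with `Δ(A)(ξ_∅ ⊗ ξ_∅)`,
which vanishes by the coideal condition. -/
theorem pmul_mem (hJ : IsHomogeneousHopfIdeal J) {y z : Fock d} (hy : y ∈ NSpace J)
    (hz : z ∈ NSpace J) : pmul y z ∈ NSpace J := by
  rw [mem_NSpace]
  intro A hA
  rw [← inner_conj_symm, inner_pmul_left, ← comul_tmul_one, inner_comul_eq_zero hJ hA hy hz,
    map_zero]

theorem degProj_mem (hJ : IsHomogeneousHopfIdeal J) {y : Fock d} (hy : y ∈ NSpace J) (n : ℕ) :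
    degProj n y ∈ NSpace J := by
  rw [mem_NSpace] at hy ⊢
  intro A hA
  rw [← inner_degProj_left, ← homComp_apply_one]
  exact hy _ (homComp_mem hJ hA n)

theorem inner_ξ_eq_zero {w : FreeMonoid (Fin d)} (hw : wordClass J w = 0) {y : Fock d}
    (hy : y ∈ NSpace J) : ⟪ξ w, y⟫_ℂ = 0 := by
  have := mem_NSpace.1 hy _ ((wordClass_eq_zero_iff w).1 hw)
  rwa [LHom_coe, Lop_ξ, mul_one] at this

theorem inner_ξ_congr {u v : FreeMonoid (Fin d)} (h : wordClass J u = wordClass J v) {y : Fock d}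
    (hy : y ∈ NSpace J) : ⟪ξ u, y⟫_ℂ = ⟪ξ v, y⟫_ℂ := by
  have := mem_NSpace.1 hy _ ((wordClass_eq_iff u v).1 h)
  have e : (LHom d u - LHom d v).1 (ξ 1) = ξ u - ξ v := by
    change Lop u (ξ 1) - Lop v (ξ 1) = _
    simp
  rwa [e, inner_sub_left, sub_eq_zero] at this

theorem exists_inner_ξ_ne_zero (hJ : IsHomogeneousHopfIdeal J) {w : FreeMonoid (Fin d)}
    (hw : wordClass J w ≠ 0) : ∃ y ∈ NSpace J, ⟪ξ w, y⟫_ℂ ≠ 0 := by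
  by_contra! h
  refine hw ((wordClass_eq_zero_iff w).2 (mem_of_projN_eq_zero hJ (LHom_mem_span w) ?_))
  refine projN_eq_zero_iff.2 fun y hy => ?_
  rw [LHom_coe, Lop_ξ, mul_one, ← inner_conj_symm, h y hy, map_zero]

theorem exists_inner_ξ_ne (hJ : IsHomogeneousHopfIdeal J) {u v : FreeMonoid (Fin d)}
    (h : wordClass J u ≠ wordClass J v) : ∃ y ∈ NSpace J, ⟪ξ u, y⟫_ℂ ≠ ⟪ξ v, y⟫_ℂ := by
  by_contra! h'
  refine h ((wordClass_eq_iff u v).2 (mem_of_projN_eq_zero hJ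
    (Submodule.sub_mem _ (LHom_mem_span u) (LHom_mem_span v)) ?_))
  have e : (LHom d u - LHom d v).1 (ξ 1) = ξ u - ξ v := by
    change Lop u (ξ 1) - Lop v (ξ 1) = _
    simp
  refine projN_eq_zero_iff.2 fun y hy => ?_
  rw [e, ← inner_conj_symm, inner_sub_left, h' y hy, sub_self, map_zero]

/-- Constants need not lie in `N_J`, so the usual `y(v) - y` is multiplied by some `z ∈ N_J` with
`z(w) ≠ 0`. The product stays in `N_J`, vanishes at `v`, and is normalised at `w`. -/
theorem exists_separating (hJ : IsHomogeneousHopfIdeal J) {w v : FreeMonoid (Fin d)}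
    (hw : wordClass J w ≠ 0) (h : wordClass J v ≠ wordClass J w) :
    ∃ g ∈ NSpace J, ⟪ξ w, g⟫_ℂ = 1 ∧ ⟪ξ v, g⟫_ℂ = 0 := by
  obtain ⟨z, hz, hzw⟩ := exists_inner_ξ_ne_zero hJ hw
  obtain ⟨y, hy, hyvw⟩ := exists_inner_ξ_ne hJ h
  have hne : ⟪ξ w, z⟫_ℂ * (⟪ξ v, y⟫_ℂ - ⟪ξ w, y⟫_ℂ) ≠ 0 := mul_ne_zero hzw (sub_ne_zero.2 hyvw)
  refine ⟨(⟪ξ w, z⟫_ℂ * (⟪ξ v, y⟫_ℂ - ⟪ξ w, y⟫_ℂ))⁻¹ • (⟪ξ v, y⟫_ℂ • z - pmul y z),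
    Submodule.smul_mem _ _ (Submodule.sub_mem _ (Submodule.smul_mem _ _ hz) (pmul_mem hJ hy hz)),
    ?_, ?_⟩
  · rw [inner_smul_right, inner_sub_right, inner_smul_right, inner_ξ_pmul]
    rw [inv_mul_eq_one₀ hne]
    ring
  · rw [inner_smul_right, inner_sub_right, inner_smul_right, inner_ξ_pmul]
    ring

variable (J) in
open Classical in
/-- The indicator function of the class of a word, as a vector of the Fock space. -/
def classInd (w : FreeMonoid (Fin d)) : Fock d :=
  ∑ v ∈ (words d w.length).filter (fun v => wordClass J v = wordClass J w), ξ v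

open Classical in
theorem inner_ξ_classInd (hJ : IsHomogeneousHopfIdeal J) {w : FreeMonoid (Fin d)}
    (hw : wordClass J w ≠ 0) (v : FreeMonoid (Fin d)) :
    ⟪ξ v, classInd J w⟫_ℂ = if wordClass J v = wordClass J w then 1 else 0 := by
  rw [classInd, inner_sum]
  simp only [inner_ξ_ξ, Finset.sum_ite_eq, Finset.mem_filter, mem_words]
  congr 1
  refine propext ⟨fun h => h.2, fun h => ⟨?_, h⟩⟩
  exact (length_eq_of_wordClass_eq hJ hw h.symm).symm

/-- A finite Stone–Weierstrass argument: multiply functions separating `w` from each inequivalent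
word of the same length, then truncate to that length to remove all other words. -/
theorem classInd_mem (hJ : IsHomogeneousHopfIdeal J) {w : FreeMonoid (Fin d)}
    (hw : wordClass J w ≠ 0) : classInd J w ∈ NSpace J := by
  classical
  have key : ∀ s : Finset (FreeMonoid (Fin d)), (∀ v ∈ s, wordClass J v ≠ wordClass J w) →
      ∃ g ∈ NSpace J, ⟪ξ w, g⟫_ℂ = 1 ∧ ∀ v ∈ s, ⟪ξ v, g⟫_ℂ = 0 := by
    intro s
    induction s using Finset.induction_on with
    | empty =>
      intro _
      obtain ⟨z, hz, hzw⟩ := exists_inner_ξ_ne_zero hJ hw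
      refine ⟨(⟪ξ w, z⟫_ℂ)⁻¹ • z, Submodule.smul_mem _ _ hz, ?_, by simp⟩
      rw [inner_smul_right, inv_mul_cancel₀ hzw]
    | insert v s _ ih =>
      intro h
      obtain ⟨g, hg, hgw, hgs⟩ := ih fun u hu => h u (Finset.mem_insert_of_mem hu)
      obtain ⟨f, hf, hfw, hfv⟩ := exists_separating hJ hw (h v (Finset.mem_insert_self _ _))
      refine ⟨pmul f g, pmul_mem hJ hf hg, by rw [inner_ξ_pmul, hgw, hfw, one_mul], ?_⟩
      intro u hu
      rw [inner_ξ_pmul]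
      obtain rfl | hu := Finset.mem_insert.1 hu
      · rw [hfv, zero_mul]
      · rw [hgs u hu, mul_zero]
  obtain ⟨g, hg, hgw, hgs⟩ := key
    ((words d w.length).filter fun v => wordClass J v ≠ wordClass J w) (by simp)
  have : classInd J w = degProj w.length g := by
    refine ext_inner_ξ fun v => ?_
    rw [inner_ξ_classInd hJ hw, inner_ξ_degProj]
    by_cases hv : wordClass J v = wordClass J w
    · rw [if_pos hv, if_pos (length_eq_of_wordClass_eq hJ hw hv.symm).symm, inner_ξ_congr hv hg,
        hgw]
    · rw [if_neg hv]
      split_ifs with hl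
      · rw [hgs v (by simp [hl, hv])]
      · rfl
  rw [this]
  exact degProj_mem hJ hg _

theorem pmul_classInd_self (hJ : IsHomogeneousHopfIdeal J) {w : FreeMonoid (Fin d)}
    (hw : wordClass J w ≠ 0) : pmul (classInd J w) (classInd J w) = classInd J w :=
  ext_inner_ξ fun u => by
    rw [inner_ξ_pmul, inner_ξ_classInd hJ hw]
    split_ifs <;> simp

theorem pmul_classInd_of_ne (hJ : IsHomogeneousHopfIdeal J) {v w : FreeMonoid (Fin d)}
    (hv : wordClass J v ≠ 0) (hw : wordClass J w ≠ 0) (h : wordClass J v ≠ wordClass J w) :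
    pmul (classInd J v) (classInd J w) = 0 :=
  ext_inner_ξ fun u => by
    rw [inner_ξ_pmul, inner_ξ_classInd hJ hv, inner_ξ_classInd hJ hw, inner_zero_right]
    split_ifs with h1 h2 <;> simp
    exact h (h1.symm.trans h2)

/-- A vector of `N_J` is constant on classes, so its pairing with an indicator is its value there
times the positive size of the class. The indicators are therefore total in `N_J`. -/
theorem projN_eq_zero_of_classInd (hJ : IsHomogeneousHopfIdeal J) {x : Fock d}
    (h : ∀ w, wordClass J w ≠ 0 → ⟪classInd J w, x⟫_ℂ = 0) : projN J x = 0 := by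
  classical
  refine Subtype.ext (ext_inner_ξ fun w => ?_)
  rw [Submodule.coe_zero, inner_zero_right]
  by_cases hw : wordClass J w = 0
  · exact inner_ξ_eq_zero hw (projN J x).2
  · have h1 := h w hw
    rw [← inner_projN_right J ⟨_, classInd_mem hJ hw⟩, Submodule.coe_inner] at h1
    simp only [classInd, sum_inner] at h1
    rw [Finset.sum_congr rfl (fun v hv => inner_ξ_congr (J := J) (v := w)
      (Finset.mem_filter.1 hv).2 (projN J x).2), Finset.sum_const, smul_eq_zero] at h1
    refine h1.resolve_left fun h0 => ?_
    rw [Finset.card_eq_zero] at h0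
    exact Finset.notMem_empty w (h0 ▸ Finset.mem_filter.2 ⟨mem_words.2 rfl, rfl⟩)

/-! ### Group-like elements -/

theorem ξ_one_mem (hJ : IsHomogeneousHopfIdeal J) (h : wordClass J 1 ≠ 0) :
    (ξ 1 : Fock d) ∈ NSpace J := by
  classical
  convert classInd_mem hJ h
  refine ext_inner_ξ fun v => ?_
  rw [inner_ξ_classInd hJ h, inner_ξ_ξ]
  congr 1
  refine propext ⟨fun hv => by rw [hv], fun hv => ?_⟩
  have := length_eq_of_wordClass_eq hJ h hv.symm
  exact FreeMonoid.length_eq_zero.1 (by simpa using this.symm)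

/-- The degenerate case in which `J` is all of `𝓛_d`; no nonzero vacuum exists and it must be
treated separately. -/
theorem eq_zero_of_wordClass_one_eq_zero (h : wordClass J 1 = 0) {y : Fock d}
    (hy : y ∈ NSpace J) : y = 0 := by
  refine ext_inner_ξ fun w => ?_
  rw [inner_zero_right]
  refine inner_ξ_eq_zero (J := J) ?_ hy
  rw [← mul_one w, wordClass_mul, h, Semi.mul_zero]

theorem inner_tmul_zero_left {K : Type*} [NormedAddCommGroup K] [InnerProductSpace ℂ K] (x : K)
    (t : TensorSq K) : ⟪tmul 0 x, t⟫_ℂ = 0 := by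
  simp [tmul, UniformSpace.Completion.coe_zero]

theorem inner_comulJ_vac (hJ : IsHomogeneousHopfIdeal J) (A : LAlg d) (y z : NSpace J) :
    ⟪tmul y z, comulJ J (proj J A) (tmul (vac J) (vac J))⟫_ℂ =
      ⟪pmul (y : Fock d) (z : Fock d), A.1 (ξ 1)⟫_ℂ := by
  have hvac : ∀ h : wordClass J 1 ≠ 0, vac J = ⟨ξ 1, ξ_one_mem hJ h⟩ := fun h =>
    Submodule.orthogonalProjectionOnto_mem_subspace_eq_self
      (⟨ξ 1, ξ_one_mem hJ h⟩ : NSpace J)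
  by_cases h : wordClass J 1 = 0
  · have hy : y = 0 := Subtype.ext (eq_zero_of_wordClass_one_eq_zero h y.2)
    rw [inner_pmul_left, hy, Submodule.coe_zero, inner_tmul_zero_left (K := Fock d)]
    exact inner_tmul_zero_left (K := NSpace J) z _
  · rw [comulJ_proj hJ, ContinuousLinearMap.comp_apply, inner_opTensor_projN,
      ContinuousLinearMap.comp_apply, opTensor_tmul, hvac h, inner_pmul_left, ← comul_tmul_one]
    rfl

theorem inner_pmul_of_grouplike (hJ : IsHomogeneousHopfIdeal J) {A : LAlg d}
    (h : comulJ J (proj J A) = opTensor (proj J A).1 (proj J A).1) {y z : Fock d}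
    (hy : y ∈ NSpace J) (hz : z ∈ NSpace J) :
    ⟪pmul y z, A.1 (ξ 1)⟫_ℂ = ⟪y, A.1 (ξ 1)⟫_ℂ * ⟪z, A.1 (ξ 1)⟫_ℂ := by
  rw [← inner_comulJ_vac hJ A ⟨y, hy⟩ ⟨z, hz⟩, h, opTensor_tmul, inner_tmul_tmul, proj_vac,
    inner_projN_right, inner_projN_right]

theorem classInd_congr (hJ : IsHomogeneousHopfIdeal J) {v w : FreeMonoid (Fin d)}
    (hv : wordClass J v ≠ 0) (h : wordClass J v = wordClass J w) : classInd J v = classInd J w :=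
  ext_inner_ξ fun u => by rw [inner_ξ_classInd hJ hv, inner_ξ_classInd hJ (h ▸ hv), h]

open Classical in
theorem inner_classInd_ξ (hJ : IsHomogeneousHopfIdeal J) {w : FreeMonoid (Fin d)}
    (hw : wordClass J w ≠ 0) (v : FreeMonoid (Fin d)) :
    ⟪classInd J w, ξ v⟫_ℂ = if wordClass J v = wordClass J w then 1 else 0 := by
  rw [← inner_conj_symm, inner_ξ_classInd hJ hw]
  split_ifs <;> simp

/-- The group-like elements of `𝓛_J` are the operators `L_s`. -/
theorem exists_eq_Ls_of_grouplike (hJ : IsHomogeneousHopfIdeal J) {F : LJ J}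
    (h : comulJ J F = opTensor F.1 F.1) : ∃ s, F = Ls J s := by
  obtain ⟨A, rfl⟩ := proj_surjective F
  have hmul := fun {y z : Fock d} => inner_pmul_of_grouplike hJ h (y := y) (z := z)
  -- The indicators are orthogonal idempotents and the pairing with `A ξ_∅` is multiplicative on
  -- them. A nonzero value is therefore `1` and forces `0` on every other class.
  by_cases h0 : ∀ w, wordClass J w ≠ 0 → ⟪classInd J w, A.1 (ξ 1)⟫_ℂ = 0
  · refine ⟨0, ?_⟩
    rw [Ls_zero, ← map_zero (proj J)]
    refine proj_ext ((projN_eq_zero_of_classInd hJ h0).trans ?_)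
    exact (map_zero (projN J)).symm
  · push Not at h0
    obtain ⟨w, hw, hne⟩ := h0
    refine ⟨wordClass J w, ?_⟩
    rw [Ls_wordClass]
    refine proj_ext (sub_eq_zero.1 ?_)
    rw [← map_sub, LHom_coe, Lop_ξ, mul_one]
    refine projN_eq_zero_of_classInd hJ fun v hv => ?_
    rw [inner_sub_right, inner_classInd_ξ hJ hv, sub_eq_zero]
    have hmem := classInd_mem hJ hw
    by_cases hvw : wordClass J v = wordClass J w
    · have h1 := hmul hmem hmem
      rw [pmul_classInd_self hJ hw] at h1
      rw [if_pos hvw.symm, classInd_congr hJ hv hvw]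
      exact (mul_eq_left₀ hne).1 h1.symm
    · have h1 := hmul (classInd_mem hJ hv) hmem
      rw [pmul_classInd_of_ne hJ hv hw hvw, inner_zero_left] at h1
      rw [if_neg (Ne.symm hvw)]
      exact (mul_eq_zero.1 h1.symm).resolve_right hne

end

section

/-! ### Elements of the predual -/

section Conjugation

variable {K : Type*} [NormedAddCommGroup K] [InnerProductSpace ℂ K]

theorem predual_ext {A : Subalgebra ℂ (K →L[ℂ] K)} {φ ψ : Predual A}
    (h : ∀ a, φ.1 a = ψ.1 a) : φ = ψ :=
  Subtype.ext (ContinuousLinearMap.ext h)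

section

variable [CompleteSpace K]

theorem continuous_sandwich_val (X Y : K →L[ℂ] K) (s : Set (K →L[ℂ] K)) :
    Continuous[weakStarOn s, weakStar K] fun a : s => Y ∘L a.1 ∘L X :=
  continuous_comp (g := sandwich X Y) (continuous_sandwich_map X Y) (continuous_weakStarOn_val _)

/-- Makes weak* continuous functionals norm continuous, as membership in the predual requires. -/
theorem continuous_norm_weakStar :
    Continuous[inferInstance, weakStar K] (fun T : K →L[ℂ] K => T) := by
  refine continuous_to_weakStar fun x y => ?_
  let f : (K →L[ℂ] K) →ₗ[ℂ] ℂ :=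
    { toFun := fun T => ⟪y, ampliation ℕ T x⟫_ℂ
      map_add' := fun S T => inner_add_right y (ampliation ℕ S x) (ampliation ℕ T x)
      map_smul' := fun c T => inner_smul_right y (ampliation ℕ T x) c }
  refine (LinearMap.mkContinuous f (‖y‖ * ‖x‖) fun T => ?_).continuous
  refine (norm_inner_le_norm (𝕜 := ℂ) y (ampliation ℕ T x)).trans ?_
  have hT : ‖ampliation ℕ T x‖ ≤ ‖T‖ * ‖x‖ :=
    (ContinuousLinearMap.le_opNorm _ _).trans (mul_le_mul_of_nonneg_right
      (LinearMap.mkContinuous_norm_le _ (norm_nonneg _) _) (norm_nonneg _))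
  calc ‖y‖ * ‖ampliation ℕ T x‖ ≤ ‖y‖ * (‖T‖ * ‖x‖) :=
        mul_le_mul_of_nonneg_left hT (norm_nonneg _)
    _ = ‖y‖ * ‖x‖ * ‖T‖ := by ring

variable {A : Subalgebra ℂ (K →L[ℂ] K)}

/-- A weak* continuous linear functional, as an element of the predual. -/
def mkPredual (f : A →ₗ[ℂ] ℂ)
    (hf : Continuous[weakStarOn (A : Set (K →L[ℂ] K)), inferInstance] f) : Predual A :=
  ⟨⟨f, continuous_comp (g := f) hf (continuous_weakStarOn_rng (f := fun a : A => a)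
    (continuous_comp (g := fun T : K →L[ℂ] K => T) continuous_norm_weakStar
      continuous_subtype_val))⟩, hf⟩

@[simp]
theorem mkPredual_apply (f : A →ₗ[ℂ] ℂ)
    (hf : Continuous[weakStarOn (A : Set (K →L[ℂ] K)), inferInstance] f) (a : A) :
    (mkPredual f hf).1 a = f a := rfl

/-- The restriction to `A` of a weak* continuous linear functional on `B(K)`. -/
def resPredual (A : Subalgebra ℂ (K →L[ℂ] K)) (f : (K →L[ℂ] K) →ₗ[ℂ] ℂ)
    (hf : Continuous[weakStar K, inferInstance] f) : Predual A :=
  mkPredual (f ∘ₗ A.val.toLinearMap) (continuous_comp (g := f) hf (continuous_weakStarOn_val _))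

/-- The vector functional `a ↦ ⟪y, a x⟫`. -/
def vecPredual (A : Subalgebra ℂ (K →L[ℂ] K)) (x y : K) : Predual A :=
  resPredual A (innerFunctional x y) (continuous_innerFunctional x y)

@[simp]
theorem vecPredual_apply (x y : K) (a : A) : (vecPredual A x y).1 a = ⟪y, a.1 x⟫_ℂ := rfl

theorem ext_of_predual {a b : A} (h : ∀ φ : Predual A, φ.1 a = φ.1 b) : a = b :=
  Subtype.ext (ContinuousLinearMap.ext fun x => ext_inner_left ℂ fun y => h (vecPredual A x y))

/-- The functional `a ↦ φ(ab)`. -/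
def predualMulRight (φ : Predual A) (b : A) : Predual A :=
  mkPredual (φ.1.toLinearMap ∘ₗ LinearMap.mulRight ℂ b) (continuous_comp (g := φ.1) φ.2
    (continuous_weakStarOn_rng (f := fun a : A => a * b)
      (continuous_sandwich_val b.1 1 _)))

/-- The functional `b ↦ φ(ab)`. -/
def predualMulLeft (φ : Predual A) (a : A) : Predual A :=
  mkPredual (φ.1.toLinearMap ∘ₗ LinearMap.mulLeft ℂ a) (continuous_comp (g := φ.1) φ.2
    (continuous_weakStarOn_rng (f := fun b : A => a * b)
      (continuous_sandwich_val 1 a.1 _)))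

end

/-! ### Automorphisms given by a similarity -/

variable {A : Subalgebra ℂ (K →L[ℂ] K)} {Δ : A → (TensorSq K →L[ℂ] TensorSq K)}
  {V W : K →L[ℂ] K} {α : A →ₗ[ℂ] A}

theorem conj_map_mul (hWV : W ∘L V = 1) (hα : ∀ a, (α a).1 = V ∘L a.1 ∘L W) (a b : A) :
    α (a * b) = α a * α b := by
  refine Subtype.ext ?_
  rw [hα]
  change _ = (α a).1 ∘L (α b).1
  rw [hα, hα]
  ext x
  have : W (V (b.1 (W x))) = b.1 (W x) := DFunLike.congr_fun hWV (b.1 (W x))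
  simp only [ContinuousLinearMap.comp_apply, this]
  rfl

theorem conj_injective (hWV : W ∘L V = 1) (hα : ∀ a, (α a).1 = V ∘L a.1 ∘L W) :
    Function.Injective α := by
  intro a b h
  have key : ∀ a : A, a.1 = W ∘L (α a).1 ∘L V := by
    intro a
    rw [hα]
    ext x
    have h1 : ∀ x, W (V x) = x := DFunLike.congr_fun hWV
    simp only [ContinuousLinearMap.comp_apply, h1]
  exact Subtype.ext (by rw [key a, key b, h])

theorem IsHopfDualAut.grouplike (h : IsHopfDualAut A Δ α) {a : A}
    (ha : Δ a = opTensor a.1 a.1) : Δ (α a) = opTensor (α a).1 (α a).1 := by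
  obtain ⟨Θ, -, h1, h2⟩ := h.map_comul
  obtain ⟨T, hT, hT'⟩ := h2 a
  rw [← hT', h1 a a T (hT.trans ha)]

theorem IsHopfConvolutionAut.eq_zero {θ : Predual A →L[ℂ] Predual A}
    (h : IsHopfConvolutionAut A Δ θ) (hθ : ∀ φ a, (θ φ).1 a = φ.1 (α a))
    {φ : Predual A} (hφ : ∀ a, φ.1 (α a) = 0) : φ = 0 := by
  refine h.bijective.1 (predual_ext fun a => ?_)
  rw [hθ, hφ, map_zero]
  rfl

theorem IsHopfDualAut.eq_zero (h : IsHopfDualAut A Δ α) {φ : Predual A}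
    (hφ : ∀ a, φ.1 (α a) = 0) : φ = 0 := by
  refine predual_ext fun a => ?_
  obtain ⟨b, rfl⟩ := h.bijective.2 a
  exact hφ b

theorem sandwich_mem_normalTensor (hα : ∀ a, (α a).1 = V ∘L a.1 ∘L W)
    {T : TensorSq K →L[ℂ] TensorSq K} (hT : T ∈ normalTensor A) :
    sandwich (opTensor W W) (opTensor V V) T ∈ normalTensor A := by
  unfold normalTensor at hT ⊢
  refine map_mem_weakStarSpan _ (continuous_sandwich_map _ _) ?_ hT
  rintro _ ⟨a, ha, b, hb, rfl⟩
  refine subset_weakStarSpan _ ⟨_, (α ⟨a, ha⟩).2, _, (α ⟨b, hb⟩).2, ?_⟩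
  rw [sandwich_apply, opTensor_comp, opTensor_comp, hα, hα]

variable [CompleteSpace K]

theorem isHopfDualAut_of_conj (hVW : V ∘L W = 1) (hWV : W ∘L V = 1)
    (hα : ∀ a, (α a).1 = V ∘L a.1 ∘L W) (hsurj : Function.Surjective α)
    (hΔ : ∀ a, Δ a ∈ normalTensor A)
    (hΔα : ∀ a, Δ (α a) = opTensor V V ∘L Δ a ∘L opTensor W W) : IsHopfDualAut A Δ α where
  bijective := ⟨conj_injective hWV hα, hsurj⟩
  map_one := Subtype.ext (by
    rw [hα]
    exact hVW)
  map_mul := conj_map_mul hWV hα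
  continuous := by
    refine continuous_weakStarOn_rng ?_
    simp only [hα]
    exact continuous_sandwich_val W V _
  map_comul := by
    refine ⟨(sandwich (opTensor W W) (opTensor V V)).restrict
      fun T hT => sandwich_mem_normalTensor hα hT, ?_, ?_, ?_⟩
    · exact continuous_weakStarOn_rng (continuous_sandwich_val (opTensor W W) (opTensor V V) _)
    · intro a b T hT
      rw [LinearMap.coe_restrict_apply, hT, sandwich_apply, opTensor_comp, opTensor_comp, hα, hα]
    · intro a
      exact ⟨⟨_, hΔ a⟩, rfl, (hΔα a).symm⟩

theorem isHopfConvolutionAut_of_conj (hWV : W ∘L V = 1)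
    (hα : ∀ a, (α a).1 = V ∘L a.1 ∘L W) (hsurj : Function.Surjective α)
    (hΔα : ∀ a, Δ (α a) = opTensor V V ∘L Δ a ∘L opTensor W W)
    {θ : Predual A →L[ℂ] Predual A} (hθ : ∀ φ a, (θ φ).1 a = φ.1 (α a)) :
    IsHopfConvolutionAut A Δ θ where
  bijective := by
    constructor
    · intro φ ψ h
      refine predual_ext fun a => ?_
      obtain ⟨b, rfl⟩ := hsurj a
      rw [← hθ, ← hθ, h]
    · intro ψ
      let e : A ≃ₗ[ℂ] A := LinearEquiv.ofBijective α ⟨conj_injective hWV hα, hsurj⟩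
      -- The inverse is again a similarity, hence weak* continuous, so composing `ψ` with it stays
      -- in the predual.
      have he : ∀ a, (e.symm a).1 = W ∘L a.1 ∘L V := by
        intro a
        obtain ⟨b, rfl⟩ := e.surjective a
        rw [LinearEquiv.symm_apply_apply]
        change b.1 = W ∘L (α b).1 ∘L V
        rw [hα]
        ext x
        have h1 : ∀ x, W (V x) = x := DFunLike.congr_fun hWV
        simp only [ContinuousLinearMap.comp_apply, h1]
      refine ⟨mkPredual (ψ.1.toLinearMap ∘ₗ e.symm.toLinearMap) ?_, predual_ext fun a => ?_⟩
      · refine continuous_comp (g := ψ.1) ψ.2 (continuous_weakStarOn_rng (f := e.symm) ?_)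
        simp only [he]
        exact continuous_sandwich_val V W _
      · rw [hθ, mkPredual_apply]
        exact congrArg ψ.1 (e.symm_apply_apply a)
  map_conv := by
    rintro φ ψ χ ⟨ω, hω, hωφψ, hωχ⟩
    refine ⟨ω ∘ₗ sandwich (opTensor W W) (opTensor V V),
      continuous_comp (g := ω) hω (continuous_sandwich_map _ _), fun a b => ?_, fun a => ?_⟩
    · rw [LinearMap.comp_apply, sandwich_apply, opTensor_comp, opTensor_comp, ← hα, ← hα, hωφψ,
        hθ, hθ]
    · rw [hθ, hωχ, hΔα]
      rfl
  map_comul := by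
    intro φ
    -- This kernel is `(θ ⊗ id)` of `(a, b) ↦ φ(ab)`; applying `θ` in the second variable gives
    -- `φ(α(a) α(b))`.
    refine ⟨fun a b => φ.1 (α a * b), fun b => ?_, fun a => ?_⟩
    · refine ⟨predualMulRight φ b, fun a => rfl, fun a => ?_⟩
      rw [hθ]
      rfl
    · refine ⟨predualMulLeft φ (α a), fun b => rfl, fun b => ?_⟩
      rw [hθ, predualComul, hθ, conj_map_mul hWV hα]
      rfl

/-! ### The adjoint of a Hopf convolution algebra automorphism -/

section Adjoint

variable {θ : Predual A →L[ℂ] Predual A}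

/-- Unwinding the two halves of `θ ⊗ θ` on the kernel `φ(ab)` gives `φ(α(a) α(b))`; compatibility
with the comultiplication says that this is `φ(α(ab))`. -/
theorem IsHopfConvolutionAut.adjoint_mul (h : IsHopfConvolutionAut A Δ θ)
    (hθ : ∀ φ a, (θ φ).1 a = φ.1 (α a)) (a b : A) : α (a * b) = α a * α b := by
  refine ext_of_predual fun φ => ?_
  obtain ⟨w, hw₁, hw₂⟩ := h.map_comul φ
  obtain ⟨f, hf, hf'⟩ := hw₂ a
  obtain ⟨g, hg, hg'⟩ := hw₁ (α b)
  have h1 := hf' b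
  rw [predualComul, hθ, hθ, hf, hg', hθ, hg] at h1
  exact h1

theorem IsHopfConvolutionAut.adjoint_injective (h : IsHopfConvolutionAut A Δ θ)
    (hθ : ∀ φ a, (θ φ).1 a = φ.1 (α a)) : Function.Injective α := by
  refine fun a b hab => ext_of_predual fun φ => ?_
  obtain ⟨ψ, rfl⟩ := h.bijective.2 φ
  rw [hθ, hθ, hab]

/-- Weak* continuity of `Δ` ensures that `χ = φ ⋆ ψ` exists for vector functionals `φ`, `ψ`.
Evaluating `θ(χ) = θ(φ) ⋆ θ(ψ)` at a group-like `a` gives `χ(α(a)) = φ(α(a)) ψ(α(a))`, an identity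
of matrix coefficients. -/
theorem IsHopfConvolutionAut.grouplike (h : IsHopfConvolutionAut A Δ θ)
    (hθ : ∀ φ a, (θ φ).1 a = φ.1 (α a))
    {f : (K →L[ℂ] K) →ₗ[ℂ] (TensorSq K →L[ℂ] TensorSq K)}
    (hf : Continuous[weakStar K, weakStar (TensorSq K)] f) (hΔ : ∀ a, Δ a = f a.1)
    {a : A} (ha : Δ a = opTensor a.1 a.1) : Δ (α a) = opTensor (α a).1 (α a).1 := by
  refine ext_inner_tmul fun x x' y y' => ?_
  have hc : Continuous[weakStar K, inferInstance]
      (innerFunctional (tmul x x') (tmul y y') ∘ₗ f) :=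
    continuous_comp (g := innerFunctional (tmul x x') (tmul y y'))
      (continuous_innerFunctional _ _) hf
  obtain ⟨ω, -, hω, hω'⟩ := h.map_conv (vecPredual _ x y) (vecPredual _ x' y')
    (resPredual _ _ hc) ⟨innerFunctional (tmul x x') (tmul y y'),
      continuous_innerFunctional _ _, fun a b => by
        rw [innerFunctional_apply, opTensor_tmul, inner_tmul_tmul]; rfl,
      fun a => by rw [hΔ]; rfl⟩
  have h1 := hω' a
  rw [ha, hω, hθ, hθ, hθ] at h1
  rw [opTensor_tmul, inner_tmul_tmul, hΔ]
  exact h1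

end Adjoint

end Conjugation

/-! ### From automorphisms to the semigroup -/

variable {d : ℕ} {J : TwoSidedIdeal (LAlg d)}

theorem inner_classInd_Ls (hJ : IsHomogeneousHopfIdeal J) {w : FreeMonoid (Fin d)}
    (hw : wordClass J w ≠ 0) {s : Semi J} (hs : s ≠ wordClass J w) :
    ⟪(⟨classInd J w, classInd_mem hJ hw⟩ : NSpace J), (Ls J s).1 (vac J)⟫_ℂ = 0 := by
  obtain rfl | ⟨v, rfl⟩ := eq_zero_or_wordClass s
  · rw [Ls_zero]
    exact inner_zero_right _
  · rw [Ls_wordClass, proj_vac, inner_projN_right, LHom_coe, Lop_ξ, mul_one,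
      inner_classInd_ξ hJ hw, if_neg hs]

theorem inner_classInd_Ls_self (hJ : IsHomogeneousHopfIdeal J) {w : FreeMonoid (Fin d)}
    (hw : wordClass J w ≠ 0) :
    ⟪(⟨classInd J w, classInd_mem hJ hw⟩ : NSpace J), (Ls J (wordClass J w)).1 (vac J)⟫_ℂ = 1 := by
  rw [Ls_wordClass, proj_vac, inner_projN_right, LHom_coe, Lop_ξ, mul_one,
    inner_classInd_ξ hJ hw, if_pos rfl]

/-- Collects what (i) and (ii) have in common. The last hypothesis follows from injectivity of `θ`
in the first case and from surjectivity of `θs` in the second. -/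
theorem exists_semigroup_aut (hJ : IsHomogeneousHopfIdeal J) {θs : LJ J →ₗ[ℂ] LJ J}
    (hmul : ∀ F G, θs (F * G) = θs F * θs G) (hinj : Function.Injective θs)
    (hgl : ∀ s, comulJ J (θs (Ls J s)) = opTensor (θs (Ls J s)).1 (θs (Ls J s)).1)
    (hcont : ∀ φ : Predual (LJ J), Continuous[weakStarOn (LJ J : Set (NSpace J →L[ℂ] NSpace J)),
      inferInstance] fun F => φ.1 (θs F))
    (hker : ∀ φ : Predual (LJ J), (∀ F, φ.1 (θs F) = 0) → φ = 0) :
    ∃ σ : Semi J ≃* Semi J, σ 1 = 1 ∧ σ 0 = 0 ∧ ∀ s : Semi J, θs (Ls J s) = Ls J (σ s) := by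
  choose σ hσ using fun s => exists_eq_Ls_of_grouplike hJ (hgl s)
  have hσ0 : σ 0 = 0 := Ls_injective hJ (by rw [← hσ, Ls_zero, map_zero])
  have hσmul : ∀ s t, σ (s * t) = σ s * σ t := fun s t => Ls_injective hJ (by
    rw [← hσ, Ls_mul, hmul, hσ, hσ, Ls_mul])
  have hσinj : Function.Injective σ := fun s t h => Ls_injective hJ (hinj (by rw [hσ, hσ, h]))
  have hσsurj : Function.Surjective σ := by
    intro t
    by_contra! hne
    obtain rfl | ⟨w, rfl⟩ := eq_zero_or_wordClass t
    · exact hne 0 hσ0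
    have hw : wordClass J w ≠ 0 := fun h => hne 0 (by rw [hσ0, h])
    -- This functional is `1` at the missed `L_t` and `0` at every other `L_s`, so it would
    -- annihilate the range of `θs`.
    let φ : Predual (LJ J) := vecPredual (LJ J) (vac J) ⟨classInd J w, classInd_mem hJ hw⟩
    have hφ : φ = 0 := by
      refine hker φ fun F => ?_
      refine eq_zero_of_Ls (f := φ.1.toLinearMap ∘ₗ θs) (hcont φ) (fun s => ?_) F
      change φ.1 (θs (Ls J s)) = 0
      rw [hσ]
      exact inner_classInd_Ls hJ hw (hne s)
    have h1 : φ.1 (Ls J (wordClass J w)) = 1 := inner_classInd_Ls_self hJ hw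
    rw [hφ] at h1
    exact zero_ne_one h1
  let e : Semi J ≃* Semi J := MulEquiv.ofBijective (⟨σ, hσmul⟩ : Semi J →ₙ* Semi J) ⟨hσinj, hσsurj⟩
  exact ⟨e, map_one e, hσ0, hσ⟩

variable {θ : Predual (LJ J) →L[ℂ] Predual (LJ J)} {θs : LJ J →ₗ[ℂ] LJ J}

theorem continuous_adjoint_apply (hθ : ∀ (φ : Predual (LJ J)) (F : LJ J), (θ φ).1 F = φ.1 (θs F))
    (φ : Predual (LJ J)) : Continuous[weakStarOn (LJ J : Set (NSpace J →L[ℂ] NSpace J)),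
      inferInstance] fun F => φ.1 (θs F) := by
  simp only [← hθ]
  exact (θ φ).2

theorem exists_semigroup_aut_of_isHopfDualAut (hJ : IsHomogeneousHopfIdeal J)
    (hθ : ∀ (φ : Predual (LJ J)) (F : LJ J), (θ φ).1 F = φ.1 (θs F))
    (h : IsHopfDualAut (LJ J) (comulJ J) θs) :
    ∃ σ : Semi J ≃* Semi J, σ 1 = 1 ∧ σ 0 = 0 ∧ ∀ s : Semi J, θs (Ls J s) = Ls J (σ s) := by
  exact exists_semigroup_aut hJ h.map_mul h.bijective.1
    (fun s => h.grouplike (comulJ_Ls hJ s))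
    (continuous_adjoint_apply hθ) fun φ hφ => h.eq_zero hφ

theorem exists_semigroup_aut_of_isHopfConvolutionAut (hJ : IsHomogeneousHopfIdeal J)
    (hθ : ∀ (φ : Predual (LJ J)) (F : LJ J), (θ φ).1 F = φ.1 (θs F))
    (h : IsHopfConvolutionAut (LJ J) (comulJ J) θ) :
    ∃ σ : Semi J ≃* Semi J, σ 1 = 1 ∧ σ 0 = 0 ∧ ∀ s : Semi J, θs (Ls J s) = Ls J (σ s) := by
  exact exists_semigroup_aut hJ (h.adjoint_mul hθ) (h.adjoint_injective hθ)
    (fun s => h.grouplike hθ (continuous_comulJLin J) (comulJ_eq hJ) (comulJ_Ls hJ s))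
    (continuous_adjoint_apply hθ) fun φ hφ => h.eq_zero hθ hφ

end

section

/-! ### Boundedness of the adjoint and similarities preserving group-likes -/

section General

variable {K : Type*} [NormedAddCommGroup K] [InnerProductSpace ℂ K]

theorem norm_sq_sum_of_pairwise_inner_eq_zero {ι : Type*} (s : Finset ι) (f : ι → K)
    (h : ∀ i ∈ s, ∀ j ∈ s, i ≠ j → ⟪f i, f j⟫_ℂ = 0) :
    ‖∑ i ∈ s, f i‖ ^ 2 = ∑ i ∈ s, ‖f i‖ ^ 2 := by
  classical
  induction s using Finset.induction_on with
  | empty => simp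
  | insert a s ha ih =>
    rw [Finset.sum_insert ha, Finset.sum_insert ha, ← ih fun i hi j hj =>
      h i (Finset.mem_insert_of_mem hi) j (Finset.mem_insert_of_mem hj)]
    have h0 : ⟪f a, ∑ i ∈ s, f i⟫_ℂ = 0 := by
      rw [inner_sum]
      refine Finset.sum_eq_zero fun i hi => ?_
      refine h a (Finset.mem_insert_self a s) i (Finset.mem_insert_of_mem hi) ?_
      rintro rfl
      exact ha hi
    have := norm_add_sq_eq_norm_sq_add_norm_sq_of_inner_eq_zero _ _ h0
    simpa [sq] using this

variable [CompleteSpace K] {A : Subalgebra ℂ (K →L[ℂ] K)} {α : A →ₗ[ℂ] A}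

theorem norm_vecPredual_apply_le (x y : K) (b : A) :
    ‖(vecPredual A x y).1 b‖ ≤ ‖y‖ * ‖x‖ * ‖b.1‖ := by
  rw [vecPredual_apply]
  calc ‖⟪y, b.1 x⟫_ℂ‖ ≤ ‖y‖ * ‖b.1 x‖ := norm_inner_le_norm _ _
    _ ≤ ‖y‖ * (‖b.1‖ * ‖x‖) := mul_le_mul_of_nonneg_left (b.1.le_opNorm x) (norm_nonneg _)
    _ = ‖y‖ * ‖x‖ * ‖b.1‖ := by ring

/-- The norm of the dual of `A`. -/
abbrev dualNormed (A : Subalgebra ℂ (K →L[ℂ] K)) : NormedAddCommGroup (A →L[ℂ] ℂ) :=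
  ContinuousLinearMap.toNormedAddCommGroup

/-- The norm of the predual of `A`. -/
abbrev predualNormed (A : Subalgebra ℂ (K →L[ℂ] K)) : NormedAddCommGroup (Predual A) :=
  letI := dualNormed A
  Submodule.normedAddCommGroup (Predual A)

/-- The dual of `A` is a normed space. -/
abbrev dualNormedSpace (A : Subalgebra ℂ (K →L[ℂ] K)) :
    letI := dualNormed A
    NormedSpace ℂ (A →L[ℂ] ℂ) :=
  ContinuousLinearMap.toNormedSpace

/-- The predual of `A` is a normed space. -/
abbrev predualNormedSpace (A : Subalgebra ℂ (K →L[ℂ] K)) :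
    letI := predualNormed A
    NormedSpace ℂ (Predual A) :=
  letI := dualNormed A
  letI := dualNormedSpace A
  Submodule.normedSpace (Predual A)

theorem exists_bound_predual (θ : Predual A →L[ℂ] Predual A) : ∃ C, 0 ≤ C ∧
    ∀ (φ : Predual A) (B : ℝ), 0 ≤ B → (∀ a, ‖φ.1 a‖ ≤ B * ‖a.1‖) →
      ∀ a, ‖(θ φ).1 a‖ ≤ C * B * ‖a.1‖ := by
  let _ := dualNormed A
  let _ := dualNormedSpace A
  let _ := predualNormed A
  let _ := predualNormedSpace A
  obtain ⟨C, hC, h⟩ := ContinuousLinearMap.bound θ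
  refine ⟨C, hC.le, fun φ B hB hφ a => ?_⟩
  have h1 : ‖φ‖ ≤ B := ContinuousLinearMap.opNorm_le_bound φ.1 hB hφ
  have h2 : ‖(θ φ).1 a‖ ≤ ‖θ φ‖ * ‖a.1‖ := ContinuousLinearMap.le_opNorm (θ φ).1 a
  exact h2.trans (mul_le_mul_of_nonneg_right
    ((h φ).trans (mul_le_mul_of_nonneg_left h1 hC.le)) (norm_nonneg _))

/-- The adjoint of a bounded map of the predual is bounded. -/
theorem exists_norm_adjoint_le {θ : Predual A →L[ℂ] Predual A}
    (hθ : ∀ φ a, (θ φ).1 a = φ.1 (α a)) :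
    ∃ C, 0 ≤ C ∧ ∀ (a : A) (x : K), ‖(α a).1 x‖ ≤ C * ‖a.1‖ * ‖x‖ := by
  obtain ⟨C, hC, hb⟩ := exists_bound_predual θ
  refine ⟨C, hC, fun a x => ?_⟩
  -- Choosing `y = α(a) x` in `⟪y, α(a) x⟫` gives `‖α(a) x‖² ≤ C ‖α(a) x‖ ‖x‖ ‖a‖`, and one factor
  -- cancels.
  have h := hb (vecPredual A x ((α a).1 x)) _ (by positivity)
    (norm_vecPredual_apply_le x ((α a).1 x)) a
  rw [hθ, vecPredual_apply, inner_self_eq_norm_sq_to_K, norm_pow, RCLike.norm_ofReal, abs_norm,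
    sq] at h
  by_cases h0 : ‖(α a).1 x‖ = 0
  · rw [h0]; positivity
  · refine le_of_mul_le_mul_left (h.trans_eq ?_) (lt_of_le_of_ne (norm_nonneg _) (Ne.symm h0))
    ring

/-- A similarity that preserves a weak* total set of group-like elements intertwines the
comultiplication. -/
theorem comul_conj_of_grouplike {Δ : A → (TensorSq K →L[ℂ] TensorSq K)} {V W : K →L[ℂ] K}
    (hα : ∀ a, (α a).1 = V ∘L a.1 ∘L W)
    {f : (K →L[ℂ] K) →ₗ[ℂ] (TensorSq K →L[ℂ] TensorSq K)}
    (hf : Continuous[weakStar K, weakStar (TensorSq K)] f) (hΔ : ∀ a, Δ a = f a.1)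
    {ι : Type*} {g : ι → A} (hg : ∀ φ : Predual A, (∀ i, φ.1 (g i) = 0) → φ = 0)
    (hgl : ∀ i, Δ (g i) = opTensor (g i).1 (g i).1)
    (hgl' : ∀ i, Δ (α (g i)) = opTensor (α (g i)).1 (α (g i)).1) (a : A) :
    Δ (α a) = opTensor V V ∘L Δ a ∘L opTensor W W := by
  refine ContinuousLinearMap.ext fun t => ext_inner_left ℂ fun z => ?_
  have h₁ : Continuous[weakStar K, inferInstance]
      (innerFunctional t z ∘ₗ f ∘ₗ sandwich W V) :=
    continuous_comp (g := innerFunctional t z) (continuous_innerFunctional t z)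
      (continuous_comp (g := f) hf (continuous_sandwich_map W V))
  have h₂ : Continuous[weakStar K, inferInstance]
      (innerFunctional t z ∘ₗ sandwich (opTensor W W) (opTensor V V) ∘ₗ f) :=
    continuous_comp (g := innerFunctional t z) (continuous_innerFunctional t z)
      (continuous_comp (g := sandwich (opTensor W W) (opTensor V V))
        (continuous_sandwich_map _ _) hf)
  let φ : Predual A := resPredual A (innerFunctional t z ∘ₗ f ∘ₗ sandwich W V -
    innerFunctional t z ∘ₗ sandwich (opTensor W W) (opTensor V V) ∘ₗ f) (continuous_fun_sub h₁ h₂)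
  have e : ∀ a : A, φ.1 a =
      ⟪z, Δ (α a) t⟫_ℂ - ⟪z, (opTensor V V ∘L Δ a ∘L opTensor W W) t⟫_ℂ := fun a => by
    rw [hΔ, hΔ, hα]; rfl
  have h : φ = 0 := hg φ fun i => by
    rw [e, hgl, hgl', opTensor_comp, opTensor_comp, hα, sub_self]
  refine sub_eq_zero.1 ?_
  rw [← e, h]
  rfl

end General

variable {d : ℕ}

/-! ### Homogeneous polynomials -/

theorem inner_Lop_Lop {u v : FreeMonoid (Fin d)} (hl : u.length = v.length) (h : u ≠ v)
    (x y : Fock d) : ⟪Lop u x, Lop v y⟫_ℂ = 0 := by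
  have : ContinuousLinearMap.adjoint (Lop u) ∘L Lop v = 0 := by
    refine ext_ξ fun b => ext_inner_ξ fun a => ?_
    rw [ContinuousLinearMap.comp_apply, ContinuousLinearMap.adjoint_inner_right, Lop_ξ, Lop_ξ,
      inner_ξ_ξ, if_neg, zero_apply, inner_zero_right]
    intro hab
    have hab' : FreeMonoid.toList u ++ FreeMonoid.toList a =
        FreeMonoid.toList v ++ FreeMonoid.toList b := by
      simpa using congrArg FreeMonoid.toList hab
    exact h (FreeMonoid.toList.injective (List.append_inj_left hab' hl))
  rw [← ContinuousLinearMap.adjoint_inner_right]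
  change ⟪x, (ContinuousLinearMap.adjoint (Lop u) ∘L Lop v) y⟫_ℂ = 0
  rw [this, zero_apply, inner_zero_right]

theorem norm_Lop_apply (w : FreeMonoid (Fin d)) (x : Fock d) : ‖Lop w x‖ = ‖x‖ :=
  LinearIsometry.norm_map _ x

theorem norm_sq_degProj (n : ℕ) (x : Fock d) :
    ‖degProj n x‖ ^ 2 = ∑ w ∈ words d n, ‖⟪ξ w, x⟫_ℂ‖ ^ 2 := by
  rw [degProj_apply, norm_sq_sum_of_pairwise_inner_eq_zero]
  · simp [norm_smul, norm_ξ]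
  · intro u _ v _ huv
    simp [inner_ξ_ξ, huv]

/-- The `L_w` with `|w| = n` are isometries with pairwise orthogonal ranges, so a homogeneous
polynomial multiplies all norms by the `ℓ²` norm of its coefficients. -/
theorem norm_polyOf_le (n : ℕ) (x : Fock d) : ‖(polyOf n x).1‖ ≤ ‖degProj n x‖ := by
  refine ContinuousLinearMap.opNorm_le_bound _ (norm_nonneg _) fun z => ?_
  have : ‖(polyOf n x).1 z‖ ^ 2 = (‖degProj n x‖ * ‖z‖) ^ 2 := by
    rw [mul_pow, norm_sq_degProj, polyOf_coe, sum_apply, norm_sq_sum_of_pairwise_inner_eq_zero,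
      Finset.sum_mul]
    · simp [norm_smul, norm_Lop_apply, mul_pow]
    · intro u hu v hv huv
      rw [mem_words] at hu hv
      simp [inner_Lop_Lop (hu.trans hv.symm) huv]
  exact (pow_left_inj₀ (norm_nonneg _) (by positivity) two_ne_zero).1 this |>.le

theorem degProj_degProj (m n : ℕ) (x : Fock d) :
    degProj m (degProj n x) = if m = n then degProj n x else 0 := by
  refine ext_inner_ξ fun w => ?_
  rw [inner_ξ_degProj, inner_ξ_degProj]
  by_cases h : m = n
  · subst h
    rw [if_pos rfl, inner_ξ_degProj]
    split_ifs <;> rfl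
  · rw [if_neg h, inner_zero_right]
    split_ifs with h1 h2
    · exact absurd (h1.symm.trans h2) h
    · rfl
    · rfl

theorem inner_degProj_of_ne {m n : ℕ} (h : m ≠ n) (x y : Fock d) :
    ⟪degProj m x, degProj n y⟫_ℂ = 0 := by
  rw [inner_degProj_left, degProj_degProj, if_neg h, inner_zero_right]

theorem sum_norm_sq_degProj_le (M : ℕ) (x : Fock d) :
    ∑ n ∈ Finset.range M, ‖degProj n x‖ ^ 2 ≤ ‖x‖ ^ 2 := by
  set s := ∑ n ∈ Finset.range M, degProj n x with hs
  have h1 : ‖s‖ ^ 2 = ∑ n ∈ Finset.range M, ‖degProj n x‖ ^ 2 :=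
    norm_sq_sum_of_pairwise_inner_eq_zero _ _ fun i _ j _ hij => inner_degProj_of_ne hij x x
  have h2 : ⟪s, x⟫_ℂ = ((‖s‖ ^ 2 : ℝ) : ℂ) := by
    rw [h1, hs, sum_inner, Complex.ofReal_sum]
    refine Finset.sum_congr rfl fun n _ => ?_
    have : ⟪degProj n x, x⟫_ℂ = ⟪degProj n x, degProj n x⟫_ℂ := by
      rw [← inner_degProj_left, degProj_degProj, if_pos rfl]
    rw [this, inner_self_eq_norm_sq_to_K]
    simp
  have h3 : ‖s‖ ^ 2 ≤ ‖s‖ * ‖x‖ := by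
    have := norm_inner_le_norm (𝕜 := ℂ) s x
    rwa [h2, Complex.norm_real, Real.norm_of_nonneg (by positivity)] at this
  rw [← h1]
  nlinarith [norm_nonneg s, norm_nonneg x, sq_nonneg (‖s‖ - ‖x‖)]

variable {J : TwoSidedIdeal (LAlg d)}

theorem coe_projN_degProj (hJ : IsHomogeneousHopfIdeal J) (n : ℕ) (x : Fock d) :
    (projN J (degProj n x) : Fock d) = degProj n (projN J x : Fock d) := by
  have : projN J (degProj n x) = ⟨_, degProj_mem hJ (projN J x).2 n⟩ := by
    refine ext_inner_left ℂ fun y => ?_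
    rw [inner_projN_right, ← inner_degProj_left, Submodule.coe_inner]
    change _ = ⟪(y : Fock d), degProj n (projN J x : Fock d)⟫_ℂ
    rw [← inner_degProj_left]
    have := inner_projN_right J ⟨_, degProj_mem hJ y.2 n⟩ x
    rw [← this]
    rfl
  rw [this]

theorem norm_proj_le (A : LAlg d) : ‖(proj J A).1‖ ≤ ‖A.1‖ := by
  refine ContinuousLinearMap.opNorm_le_bound _ (norm_nonneg _) fun x => ?_
  exact ((NSpace J).norm_orthogonalProjectionOnto_apply_le _).trans (A.1.le_opNorm _)

theorem norm_vac_le : ‖vac J‖ ≤ 1 :=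
  ((NSpace J).norm_orthogonalProjectionOnto_apply_le _).trans (norm_ξ 1).le

/-! ### Automorphisms of the semigroup preserve the degree and have finite order -/

section Semigroup

variable (σ : Semi J ≃* Semi J)

/-- Letters are irreducible. If `σ[i] = [j][w]`, pulling back factors `[i]` into two classes whose
lengths add to one. The factor from `[j]` is not the unit, so `[w]` is. -/
theorem map_letter (hJ : IsHomogeneousHopfIdeal J) (hσ0 : σ 0 = 0) (i : Fin d) :
    σ (wordClass J (FreeMonoid.of i)) = 0 ∨
      ∃ j, σ (wordClass J (FreeMonoid.of i)) = wordClass J (FreeMonoid.of j) := by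
  refine or_iff_not_imp_left.2 fun hne => ?_
  have hs : wordClass J (FreeMonoid.of i) ≠ 0 := fun h => hne (by rw [h, hσ0])
  have hunit : ∀ j : Fin d, wordClass J (FreeMonoid.of j) ≠ 0 →
      wordClass J (FreeMonoid.of j) ≠ 1 := by
    intro j hj h
    have := length_eq_of_wordClass_eq hJ hj (h.trans wordClass_one.symm)
    simp at this
  obtain h | ⟨w, hw⟩ := eq_zero_or_wordClass (σ (wordClass J (FreeMonoid.of i)))
  · exact absurd h hne
  cases w using FreeMonoid.casesOn with
  | one =>
    rw [wordClass_one] at hw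
    exact absurd (σ.injective (hw.trans (map_one σ).symm)) (hunit i hs)
  | of_mul j w =>
    refine ⟨j, ?_⟩
    have hj : wordClass J (FreeMonoid.of j) ≠ 0 := fun h => hne (by
      rw [hw, wordClass_mul, h, Semi.zero_mul])
    have hfac : wordClass J (FreeMonoid.of i) =
        σ.symm (wordClass J (FreeMonoid.of j)) * σ.symm (wordClass J w) := by
      rw [← map_mul, ← wordClass_mul, ← hw, MulEquiv.symm_apply_apply]
    have back : ∀ {s : Semi J}, σ.symm s = 1 → s = 1 := fun {s} h => by
      rw [← σ.apply_symm_apply s, h, map_one]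
    obtain h | ⟨u, hu⟩ := eq_zero_or_wordClass (σ.symm (wordClass J (FreeMonoid.of j)))
    · exact absurd (by rw [hfac, h, Semi.zero_mul]) hs
    obtain h | ⟨v, hv⟩ := eq_zero_or_wordClass (σ.symm (wordClass J w))
    · exact absurd (by rw [hfac, h, Semi.mul_zero]) hs
    rw [hu, hv, ← wordClass_mul] at hfac
    have hlen := length_eq_of_wordClass_eq hJ hs hfac
    rw [FreeMonoid.length_of, FreeMonoid.length_mul] at hlen
    obtain h0 | h0 : u.length = 0 ∨ v.length = 0 := by omega
    · rw [FreeMonoid.length_eq_zero] at h0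
      subst h0
      exact absurd (back hu) (hunit j hj)
    · rw [FreeMonoid.length_eq_zero] at h0
      subst h0
      rw [hw, wordClass_mul, back hv, mul_one]

theorem map_wordClass (hJ : IsHomogeneousHopfIdeal J) (hσ0 : σ 0 = 0) (w : FreeMonoid (Fin d)) :
    σ (wordClass J w) = 0 ∨ ∃ v, v.length = w.length ∧ σ (wordClass J w) = wordClass J v := by
  induction w using FreeMonoid.recOn with
  | one => exact Or.inr ⟨1, rfl, map_one σ⟩
  | of_mul i w ih =>
    rw [wordClass_mul, map_mul]
    obtain h | ⟨j, hj⟩ := map_letter σ hJ hσ0 i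
    · exact Or.inl (by rw [h, Semi.zero_mul])
    obtain h | ⟨v, hv, hv'⟩ := ih
    · exact Or.inl (by rw [h, Semi.mul_zero])
    · exact Or.inr ⟨FreeMonoid.of j * v, by simp [hv], by rw [hj, hv', wordClass_mul]⟩

/-- On the finite set of letter classes and `0`, `σ` is a permutation, and a power that fixes the
letters fixes all words. The form `m + 1` lets the `m`-th power serve as inverse. -/
theorem exists_iterate_eq (hJ : IsHomogeneousHopfIdeal J) (hσ0 : σ 0 = 0) :
    ∃ m, ∀ s, σ^[m + 1] s = s := by
  let X : Set (Semi J) := insert 0 (Set.range fun i : Fin d => wordClass J (FreeMonoid.of i))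
  have hX : Finite X := ((Set.finite_range _).insert 0).to_subtype
  have hmaps : Set.MapsTo σ X X := by
    rintro _ (rfl | ⟨i, rfl⟩)
    · exact Or.inl hσ0
    · obtain h | ⟨j, hj⟩ := map_letter σ hJ hσ0 i
      · exact Or.inl h
      · exact Or.inr ⟨j, hj.symm⟩
  let g : Equiv.Perm X := Equiv.ofBijective (hmaps.restrict σ X X)
    (Finite.injective_iff_bijective.1 fun a b h =>
      Subtype.ext (σ.injective (congrArg Subtype.val h)))
  have hg : ∀ (k : ℕ) (x : X), ((g ^ k) x : Semi J) = σ^[k] x := by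
    intro k
    induction k with
    | zero => intro x; rfl
    | succ k ih =>
      intro x
      rw [pow_succ, Function.iterate_succ_apply]
      exact ih (g x)
  obtain ⟨m, hm⟩ := Nat.exists_eq_succ_of_ne_zero (orderOf_pos g).ne'
  have hmX : ∀ x ∈ X, σ^[m + 1] x = x := by
    intro x hx
    have := hg (m + 1) ⟨x, hx⟩
    rw [← Nat.succ_eq_add_one, ← hm, pow_orderOf_eq_one] at this
    rw [← Nat.succ_eq_add_one, ← hm]
    exact this.symm
  refine ⟨m, fun s => ?_⟩
  obtain rfl | ⟨w, rfl⟩ := eq_zero_or_wordClass s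
  · exact hmX 0 (Or.inl rfl)
  induction w using FreeMonoid.recOn with
  | one => exact iterate_map_one σ _
  | of_mul i w ih =>
    rw [wordClass_mul, iterate_map_mul, ih, hmX _ (Or.inr ⟨i, rfl⟩)]

end Semigroup

end

section

variable {d : ℕ}

/-! ### The similarity induced by a semigroup automorphism -/

/-- Bounded maps on the homogeneous components with pairwise orthogonal ranges have a common
extension to the Fock space. -/
theorem exists_extension {E : Type*} [NormedAddCommGroup E] [InnerProductSpace ℂ E]
    [CompleteSpace E] (h : ℕ → Fock d →ₗ[ℂ] E) {C : ℝ} (hC : 0 ≤ C)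
    (hb : ∀ n x, ‖h n x‖ ≤ C * ‖degProj n x‖)
    (ho : ∀ m n x, m ≠ n → ⟪h m x, h n x⟫_ℂ = 0) :
    ∃ V : Fock d →L[ℂ] E, ∀ w, V (ξ w) = h w.length (ξ w) := by
  classical
  have h0 : ∀ n w, n ≠ w.length → h n (ξ w) = 0 := by
    intro n w hn
    have := hb n (ξ w)
    rw [degProj_ξ, if_neg hn.symm, norm_zero, mul_zero] at this
    exact norm_le_zero_iff.1 this
  let e : (FreeMonoid (Fin d) →₀ ℂ) →ₗ[ℂ] Fock d := Finsupp.linearCombination ℂ ξ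
  let f : (FreeMonoid (Fin d) →₀ ℂ) →ₗ[ℂ] E :=
    Finsupp.linearCombination ℂ fun w => h w.length (ξ w)
  have hdense : DenseRange e := by
    have : (LinearMap.range e).topologicalClosure = ⊤ := by
      rw [Finsupp.range_linearCombination]
      exact topologicalClosure_span_ξ
    exact Submodule.dense_iff_topologicalClosure_eq_top.2 this
  have hf : ∀ c, ∃ M, f c = ∑ n ∈ Finset.range M, h n (e c) := by
    intro c
    refine ⟨c.support.sup FreeMonoid.length + 1, ?_⟩
    simp only [f, e, Finsupp.linearCombination_apply, Finsupp.sum, map_sum, map_smul]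
    rw [Finset.sum_comm]
    refine Finset.sum_congr rfl fun w hw => ?_
    rw [← Finset.smul_sum, Finset.sum_eq_single w.length (fun n _ hn => h0 n w hn)]
    intro hn
    exact absurd (Finset.mem_range.2 (Nat.lt_succ_of_le (Finset.le_sup hw))) hn
  -- Pythagoras in `E` across the degrees, the bound within each degree, and Bessel's inequality in
  -- the Fock space.
  have hnorm : ∀ c, ‖f c‖ ≤ C * ‖e c‖ := by
    intro c
    obtain ⟨M, hM⟩ := hf c
    refine (pow_le_pow_iff_left₀ (norm_nonneg _) (by positivity) two_ne_zero).1 ?_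
    rw [hM, norm_sq_sum_of_pairwise_inner_eq_zero _ _ fun i _ j _ hij => ho i j _ hij, mul_pow]
    calc ∑ n ∈ Finset.range M, ‖h n (e c)‖ ^ 2
        ≤ ∑ n ∈ Finset.range M, C ^ 2 * ‖degProj n (e c)‖ ^ 2 :=
          Finset.sum_le_sum fun n _ => by
            rw [← mul_pow]
            exact pow_le_pow_left₀ (norm_nonneg _) (hb n _) 2
      _ ≤ C ^ 2 * ‖e c‖ ^ 2 := by
          rw [← Finset.mul_sum]
          exact mul_le_mul_of_nonneg_left (sum_norm_sq_degProj_le M _) (by positivity)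
  refine ⟨f.extendOfNorm e, fun w => ?_⟩
  have := LinearMap.extendOfNorm_eq hdense ⟨C, hnorm⟩ (Finsupp.single w 1)
  simpa [e, f] using this

/-- A map with a predual that permutes a weak* total set with finite order is surjective. -/
theorem adjoint_surjective {K : Type*} [NormedAddCommGroup K] [InnerProductSpace ℂ K]
    [CompleteSpace K] {A : Subalgebra ℂ (K →L[ℂ] K)} {α : A →ₗ[ℂ] A}
    {θ : Predual A →L[ℂ] Predual A} (hθ : ∀ φ a, (θ φ).1 a = φ.1 (α a))
    {ι : Type*} {g : ι → A} (hg : ∀ φ : Predual A, (∀ i, φ.1 (g i) = 0) → φ = 0)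
    {σ : ι → ι} (hσ : ∀ i, α (g i) = g (σ i)) {m : ℕ} (hm : ∀ i, σ^[m + 1] i = i) :
    Function.Surjective α := by
  have hs : ∀ k i, α^[k] (g i) = g (σ^[k] i) := by
    intro k
    induction k with
    | zero => intro s; rfl
    | succ k ih =>
      intro s
      rw [Function.iterate_succ_apply, Function.iterate_succ_apply, hσ, ih]
  have hadj : ∀ (k : ℕ) (φ : Predual A) (a : A), (θ^[k] φ).1 a = φ.1 (α^[k] a) := by
    intro k
    induction k with
    | zero => intro φ a; rfl
    | succ k ih =>
      intro φ a
      rw [Function.iterate_succ_apply, ih, hθ, ← Function.iterate_succ_apply' α]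
  -- The power of `α` is the adjoint of the same power of `θ`, hence weak* continuous, so it is the
  -- identity once it fixes the total set.
  have hid : ∀ a, α^[m + 1] a = a := by
    intro a
    refine ext_of_predual fun φ => sub_eq_zero.1 ?_
    rw [← hadj]
    let ψ : Predual A := mkPredual ((θ^[m + 1] φ).1.toLinearMap - φ.1.toLinearMap)
      (continuous_fun_sub (θ^[m + 1] φ).2 φ.2)
    have hψ : ψ = 0 := hg ψ fun i => by
      change (θ^[m + 1] φ).1 (g i) - φ.1 (g i) = 0
      rw [hadj, hs, hm, sub_self]
    change ψ.1 a = 0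
    rw [hψ]
    rfl
  intro a
  exact ⟨α^[m] a, by rw [← Function.iterate_succ_apply' α, hid]⟩

variable {J : TwoSidedIdeal (LAlg d)} {θ : Predual (LJ J) →L[ℂ] Predual (LJ J)}
  {θs : LJ J →ₗ[ℂ] LJ J} {σ : Semi J ≃* Semi J}

/-- Evaluation of an element of `𝓛_J` at the vacuum vector. -/
def evalVac (J : TwoSidedIdeal (LAlg d)) : LJ J →ₗ[ℂ] NSpace J where
  toFun F := F.1 (vac J)
  map_add' _ _ := rfl
  map_smul' _ _ := rfl

theorem evalVac_apply (F : LJ J) : evalVac J F = F.1 (vac J) := rfl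

theorem degProj_evalVac_Ls (hJ : IsHomogeneousHopfIdeal J) (hσ0 : σ 0 = 0)
    (w : FreeMonoid (Fin d)) :
    degProj w.length (evalVac J (Ls J (σ (wordClass J w))) : Fock d) =
      evalVac J (Ls J (σ (wordClass J w))) := by
  obtain h | ⟨v, hv, h⟩ := map_wordClass σ hJ hσ0 w
  · rw [h, Ls_zero, map_zero, Submodule.coe_zero, map_zero]
  · rw [h, evalVac_apply, Ls_wordClass, proj_vac, LHom_coe, Lop_ξ, mul_one,
      ← coe_projN_degProj hJ, degProj_ξ, if_pos hv]

/-- The action of `θs` on the homogeneous component of degree `n`, at the vacuum vector. -/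
def degMap (θs : LJ J →ₗ[ℂ] LJ J) (n : ℕ) : Fock d →ₗ[ℂ] NSpace J :=
  evalVac J ∘ₗ θs ∘ₗ (proj J).toLinearMap ∘ₗ polyOf n

theorem degMap_apply (n : ℕ) (x : Fock d) :
    degMap θs n x = evalVac J (θs (proj J (polyOf n x))) := rfl

theorem degProj_degMap (hJ : IsHomogeneousHopfIdeal J) (hσ0 : σ 0 = 0)
    (hσ : ∀ s, θs (Ls J s) = Ls J (σ s)) (n : ℕ) (x : Fock d) :
    degProj n (degMap θs n x : Fock d) = degMap θs n x := by
  rw [degMap_apply, polyOf_apply]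
  simp only [map_sum, map_smul, Submodule.coe_sum, Submodule.coe_smul]
  refine Finset.sum_congr rfl fun w hw => ?_
  rw [mem_words] at hw
  subst hw
  rw [← Ls_wordClass, hσ, degProj_evalVac_Ls hJ hσ0]

theorem degMap_ξ (hσ : ∀ s, θs (Ls J s) = Ls J (σ s)) (w : FreeMonoid (Fin d)) :
    degMap θs w.length (ξ w) = evalVac J (Ls J (σ (wordClass J w))) := by
  rw [degMap_apply, polyOf_ξ, if_pos rfl, ← Ls_wordClass, hσ]

/-- In degree `n` the map sends a coefficient vector to `θs` of its polynomial, evaluated at the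
vacuum, so it inherits the bound of `θs`. The ranges are orthogonal because `σ` preserves degrees.
-/
theorem exists_intertwiner (hJ : IsHomogeneousHopfIdeal J) (hσ0 : σ 0 = 0)
    (hθ : ∀ (φ : Predual (LJ J)) (F : LJ J), (θ φ).1 F = φ.1 (θs F))
    (hσ : ∀ s, θs (Ls J s) = Ls J (σ s)) :
    ∃ V : Fock d →L[ℂ] NSpace J, ∀ w, V (ξ w) = evalVac J (Ls J (σ (wordClass J w))) := by
  obtain ⟨C, hC, hb⟩ := exists_norm_adjoint_le hθ
  have hex : ∃ V : Fock d →L[ℂ] NSpace J, ∀ w, V (ξ w) = degMap θs w.length (ξ w) := by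
    refine exists_extension (degMap θs) hC (fun n x => ?_) fun m n x hmn => ?_
    · refine (hb _ _).trans ?_
      calc C * ‖(proj J (polyOf n x)).1‖ * ‖vac J‖ ≤ C * ‖degProj n x‖ * 1 := by
            refine mul_le_mul (mul_le_mul_of_nonneg_left ?_ hC) norm_vac_le (norm_nonneg _)
              (by positivity)
            exact (norm_proj_le _).trans (norm_polyOf_le n x)
        _ = C * ‖degProj n x‖ := mul_one _
    · rw [Submodule.coe_inner, ← degProj_degMap hJ hσ0 hσ m, ← degProj_degMap hJ hσ0 hσ n]
      exact inner_degProj_of_ne hmn _ _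
  obtain ⟨V, hV⟩ := hex
  exact ⟨V, fun w => (hV w).trans (degMap_ξ hσ w)⟩

/-- Both sides are weak* continuous in `A`. For `A = L_w` and `x = ξ_u` the identity is `σ([w][u]) =
σ[w] σ[u]`. -/
theorem intertwiner_apply (hθ : ∀ (φ : Predual (LJ J)) (F : LJ J), (θ φ).1 F = φ.1 (θs F))
    (hσ : ∀ s, θs (Ls J s) = Ls J (σ s)) {V : Fock d →L[ℂ] NSpace J}
    (hV : ∀ w, V (ξ w) = evalVac J (Ls J (σ (wordClass J w)))) (A : LAlg d) (x : Fock d) :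
    V (A.1 x) = (θs (proj J A)).1 (V x) := by
  refine ext_inner_left ℂ fun y => ?_
  let f : LAlg d →ₗ[ℂ] ℂ :=
    innerFunctional x (ContinuousLinearMap.adjoint V y) ∘ₗ (LAlg d).val.toLinearMap -
      (θ (vecPredual (LJ J) (V x) y)).1.toLinearMap ∘ₗ (proj J).toLinearMap
  have hf : ∀ B, f B = ⟪y, V (B.1 x)⟫_ℂ - ⟪y, (θs (proj J B)).1 (V x)⟫_ℂ := by
    intro B
    change ⟪ContinuousLinearMap.adjoint V y, B.1 x⟫_ℂ -
      (θ (vecPredual (LJ J) (V x) y)).1 (proj J B) = _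
    exact congrArg₂ (· - ·) (ContinuousLinearMap.adjoint_inner_left V _ _) (hθ _ _)
  refine sub_eq_zero.1 ?_
  rw [← hf]
  refine eq_zero_of_LHom (continuous_fun_sub ?_ ?_) (fun w => ?_) A
  · exact continuous_comp (g := innerFunctional x (ContinuousLinearMap.adjoint V y))
      (continuous_innerFunctional _ _) (continuous_weakStarOn_val _)
  · exact continuous_comp (g := (θ (vecPredual (LJ J) (V x) y)).1)
      (θ (vecPredual (LJ J) (V x) y)).2 continuous_proj
  · rw [hf, sub_eq_zero]
    have : V ∘L Lop w = (Ls J (σ (wordClass J w))).1 ∘L V := by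
      refine ext_ξ fun u => ?_
      rw [ContinuousLinearMap.comp_apply, ContinuousLinearMap.comp_apply, Lop_ξ, hV, hV,
        wordClass_mul, map_mul, Ls_mul]
      rfl
    rw [← Ls_wordClass, hσ]
    exact congrArg (inner ℂ y) (DFunLike.congr_fun this x)

/-- The intertwining relation makes `V` vanish on `J ξ_∅`, so the range of `V*` lies in `N_J` and
`V` factors through the projection. -/
theorem intertwiner_projN {V : Fock d →L[ℂ] NSpace J}
    (hV : ∀ (A : LAlg d) (x : Fock d), V (A.1 x) = (θs (proj J A)).1 (V x)) (x : Fock d) :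
    V (projN J x) = V x := by
  refine ext_inner_left ℂ fun y => ?_
  have hmem : ContinuousLinearMap.adjoint V y ∈ NSpace J := by
    refine mem_NSpace.2 fun A hA => ?_
    rw [ContinuousLinearMap.adjoint_inner_right, hV]
    have h0 : proj J A = 0 := Subtype.ext (compress_eq_zero J hA)
    rw [h0, map_zero]
    exact inner_zero_left _
  rw [← ContinuousLinearMap.adjoint_inner_left, ← ContinuousLinearMap.adjoint_inner_left]
  exact inner_projN_right J ⟨_, hmem⟩ x

/-- A semigroup automorphism is implemented by a similarity of finite order. -/
theorem exists_similarity (hJ : IsHomogeneousHopfIdeal J) (hσ0 : σ 0 = 0)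
    (hθ : ∀ (φ : Predual (LJ J)) (F : LJ J), (θ φ).1 F = φ.1 (θs F))
    (hσ : ∀ s, θs (Ls J s) = Ls J (σ s)) :
    ∃ V W : NSpace J →L[ℂ] NSpace J, V ∘L W = 1 ∧ W ∘L V = 1 ∧
      ∀ F : LJ J, (θs F).1 = V ∘L F.1 ∘L W := by
  obtain ⟨V', hV'⟩ := exists_intertwiner hJ hσ0 hθ hσ
  have hcomm := intertwiner_apply hθ hσ hV'
  have hN := intertwiner_projN hcomm
  let V : NSpace J →L[ℂ] NSpace J := V' ∘L (NSpace J).subtypeL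
  have hVN : ∀ x, V (projN J x) = V' x := hN
  have hVs : ∀ s, V (evalVac J (Ls J s)) = evalVac J (Ls J (σ s)) := by
    intro s
    obtain rfl | ⟨w, rfl⟩ := eq_zero_or_wordClass s
    · rw [hσ0, Ls_zero, map_zero, map_zero]
    · rw [evalVac_apply, Ls_wordClass, proj_vac, LHom_coe, Lop_ξ, mul_one, hVN, hV']
  have hVF : ∀ (F : LJ J) (x : NSpace J), V (F.1 x) = (θs F).1 (V x) := by
    intro F x
    obtain ⟨A, rfl⟩ := proj_surjective F
    exact (hN _).trans (hcomm A x)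
  obtain ⟨m, hm⟩ := exists_iterate_eq σ hJ hσ0
  have hpow : ∀ k s, (V ^ k) (evalVac J (Ls J s)) = evalVac J (Ls J (σ^[k] s)) := by
    intro k
    induction k with
    | zero => intro s; rfl
    | succ k ih =>
      intro s
      rw [pow_succ, Function.iterate_succ_apply, ← ih, ← hVs]
      rfl
  -- `V` permutes the vectors `P ξ_w`, which are total in `N_J`, as `σ` permutes classes. It need
  -- not be unitary, since `σ` need not preserve the sizes of classes.
  have hone : V ^ (m + 1) = 1 := by
    have h1 : (V ^ (m + 1)) ∘L projN J = projN J := by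
      refine ext_ξ fun w => ?_
      have := hpow (m + 1) (wordClass J w)
      rw [hm, evalVac_apply, Ls_wordClass, proj_vac, LHom_coe, Lop_ξ, mul_one] at this
      exact this
    refine ContinuousLinearMap.ext fun x => ?_
    have h2 := DFunLike.congr_fun h1 (x : Fock d)
    have h3 : projN J (x : Fock d) = x := by
      refine ext_inner_left ℂ fun y => ?_
      rw [inner_projN_right]
      rfl
    rw [ContinuousLinearMap.comp_apply, h3] at h2
    exact h2
  have hVW : V ∘L (V ^ m) = 1 := (pow_succ' V m).symm.trans hone
  have hWV : (V ^ m) ∘L V = 1 := (pow_succ V m).symm.trans hone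
  refine ⟨V, V ^ m, hVW, hWV, fun F => ContinuousLinearMap.ext fun x => ?_⟩
  have h1 : V ((V ^ m) x) = x := DFunLike.congr_fun hVW x
  change _ = V (F.1 ((V ^ m) x))
  rw [hVF, h1]

theorem isHopfAut_of_semigroup_aut (hJ : IsHomogeneousHopfIdeal J) (hσ0 : σ 0 = 0)
    (hθ : ∀ (φ : Predual (LJ J)) (F : LJ J), (θ φ).1 F = φ.1 (θs F))
    (hσ : ∀ s, θs (Ls J s) = Ls J (σ s)) :
    IsHopfConvolutionAut (LJ J) (comulJ J) θ ∧ IsHopfDualAut (LJ J) (comulJ J) θs := by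
  obtain ⟨V, W, hVW, hWV, hα⟩ := exists_similarity hJ hσ0 hθ hσ
  obtain ⟨m, hm⟩ := exists_iterate_eq σ hJ hσ0
  have hg : ∀ φ : Predual (LJ J), (∀ s, φ.1 (Ls J s) = 0) → φ = 0 := fun φ hφ =>
    predual_ext fun F => eq_zero_of_Ls (f := φ.1.toLinearMap) φ.2 hφ F
  have hsurj := adjoint_surjective hθ hg hσ hm
  have hΔα := comul_conj_of_grouplike hα (continuous_comulJLin J) (comulJ_eq hJ) (g := Ls J) hg
    (comulJ_Ls hJ) fun s => by
      rw [hσ]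
      exact comulJ_Ls hJ _
  exact ⟨isHopfConvolutionAut_of_conj hWV hα hsurj hΔα hθ,
    isHopfDualAut_of_conj hVW hWV hα hsurj (comulJ_mem_normalTensor hJ) hΔα⟩

end

section

variable {d : ℕ}

/-! ### Permutations of the generators -/

theorem permUnitary_ξ (τ : Equiv.Perm (Fin d)) (w : FreeMonoid (Fin d)) :
    permUnitary τ (ξ w) = ξ (FreeMonoid.map τ w) := by
  simp [permUnitary]

theorem permUnitary_one : permUnitary (1 : Equiv.Perm (Fin d)) = 1 := by
  refine ext_ξ fun w => ?_
  rw [permUnitary_ξ, Equiv.Perm.coe_one, FreeMonoid.map_id]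
  rfl

theorem permUnitary_comp (σ τ : Equiv.Perm (Fin d)) :
    permUnitary σ ∘L permUnitary τ = permUnitary (σ * τ) := by
  refine ext_ξ fun w => ?_
  rw [ContinuousLinearMap.comp_apply, permUnitary_ξ, permUnitary_ξ, permUnitary_ξ,
    Equiv.Perm.coe_mul, FreeMonoid.map_comp]
  rfl

theorem map_inv_map (τ : Equiv.Perm (Fin d)) (w : FreeMonoid (Fin d)) :
    FreeMonoid.map (τ⁻¹ : Equiv.Perm (Fin d)) (FreeMonoid.map τ w) = w := by
  change (FreeMonoid.map _).comp (FreeMonoid.map _) w = w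
  rw [← FreeMonoid.map_comp, ← Equiv.Perm.coe_mul, inv_mul_cancel, Equiv.Perm.coe_one,
    FreeMonoid.map_id]
  rfl

theorem adjoint_permUnitary (τ : Equiv.Perm (Fin d)) :
    ContinuousLinearMap.adjoint (permUnitary τ) = permUnitary τ⁻¹ := by
  refine ext_ξ fun w => ext_inner_ξ fun u => ?_
  rw [ContinuousLinearMap.adjoint_inner_right, permUnitary_ξ, permUnitary_ξ, inner_ξ_ξ, inner_ξ_ξ]
  refine if_congr ⟨?_, ?_⟩ rfl rfl
  · rintro rfl
    exact (map_inv_map τ u).symm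
  · rintro rfl
    simp

theorem conj_Lop (τ : Equiv.Perm (Fin d)) (w : FreeMonoid (Fin d)) :
    permUnitary τ ∘L Lop w ∘L permUnitary τ⁻¹ = Lop (FreeMonoid.map τ w) := by
  refine ext_ξ fun u => ?_
  have := map_inv_map τ⁻¹ u
  rw [inv_inv] at this
  simp only [ContinuousLinearMap.comp_apply, permUnitary_ξ, Lop_ξ, map_mul, this]

variable {α : LAlg d →ₗ[ℂ] LAlg d}

/-- Iterating `α` up to the order of `τ` gives the identity; this produces preimages inside `𝓛_d`
without a separate check that conjugation by `τ⁻¹` preserves it. -/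
theorem surjective_of_perm {τ : Equiv.Perm (Fin d)}
    (hα : ∀ A, (α A).1 = permUnitary τ ∘L A.1 ∘L permUnitary τ⁻¹) : Function.Surjective α := by
  have key : ∀ (k : ℕ) A, (α^[k] A).1 = permUnitary (τ ^ k) ∘L A.1 ∘L permUnitary (τ ^ k)⁻¹ := by
    intro k
    induction k with
    | zero =>
      intro A
      rw [pow_zero, inv_one, permUnitary_one]
      rfl
    | succ k ih =>
      intro A
      rw [Function.iterate_succ_apply, ih, hα, pow_succ, mul_inv_rev, ← permUnitary_comp,
        ← permUnitary_comp]
      rfl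
  intro A
  obtain ⟨m, hm⟩ := Nat.exists_eq_succ_of_ne_zero (orderOf_pos τ).ne'
  refine ⟨α^[m] A, ?_⟩
  rw [← Function.iterate_succ_apply' α]
  refine Subtype.ext ?_
  rw [key, ← hm, pow_orderOf_eq_one, inv_one, permUnitary_one]
  rfl

theorem eq_zero_of_predual_LHom (φ : Predual (LAlg d)) (h : ∀ w, φ.1 (LHom d w) = 0) : φ = 0 :=
  predual_ext fun A => eq_zero_of_LHom (f := φ.1.toLinearMap) φ.2 h A

theorem isHopfDualAut_of_perm {τ : Equiv.Perm (Fin d)}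
    (hα : ∀ A, (α A).1 = permUnitary τ ∘L A.1 ∘L permUnitary τ⁻¹) :
    IsHopfDualAut (LAlg d) (comul d) α := by
  have hL : ∀ w, α (LHom d w) = LHom d (FreeMonoid.map τ w) := fun w =>
    Subtype.ext ((hα _).trans (conj_Lop τ w))
  have hΔα := comul_conj_of_grouplike hα (continuous_ampSandwich _ _) comul_eq
    eq_zero_of_predual_LHom (comul_LHom (d := d)) fun w => by
      rw [hL]
      exact comul_LHom _
  refine isHopfDualAut_of_conj ?_ ?_ hα (surjective_of_perm hα) comul_mem_normalTensor hΔα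
  · rw [permUnitary_comp, mul_inv_cancel, permUnitary_one]
  · rw [permUnitary_comp, inv_mul_cancel, permUnitary_one]

/-! ### Hopf dual algebra automorphisms of `𝓛_d` -/

theorem LHom_injective : Function.Injective (LHom d) := by
  intro u v h
  have h1 : ξ u = ξ v := by
    have := congrArg (fun A : LAlg d => A.1 (ξ 1)) h
    simpa [LHom_coe] using this
  by_contra hne
  have h2 := inner_ξ_ξ u v
  rw [if_neg hne, h1, inner_ξ_ξ, if_pos rfl] at h2
  exact one_ne_zero h2

/-- The coefficients `x_u` of `A ξ_∅` satisfy `x_u x_v = 0` for `u ≠ v` and `x_u² = x_u`, so exactly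
one of them is `1`. -/
theorem exists_eq_LHom_of_grouplike {A : LAlg d} (h0 : A ≠ 0)
    (h : comul d A = opTensor A.1 A.1) : ∃ w, A = LHom d w := by
  set x := A.1 (ξ 1) with hx
  have hd : diag d x = tmul x x := by
    rw [hx, ← comul_tmul_one, h, opTensor_tmul]
  have hc : ∀ u v, ⟪ξ u, x⟫_ℂ * ⟪ξ v, x⟫_ℂ = if u = v then ⟪ξ u, x⟫_ℂ else 0 := by
    intro u v
    rw [← inner_tmul_tmul, ← hd]
    have : innerSL ℂ (tmul (ξ u) (ξ v)) ∘L (diag d).toContinuousLinearMap =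
        if u = v then innerSL ℂ (ξ u) else 0 := by
      refine ext_ξ fun w => ?_
      have h1 : ⟪tmul (ξ u) (ξ v), diag d (ξ w)⟫_ℂ =
          (if u = v then innerSL ℂ (ξ u) else 0) (ξ w) := by
        rw [diag_ξ, inner_tmul_ξ]
        by_cases huv : u = v
        · subst huv
          simp [inner_ξ_ξ]
        · rw [if_neg huv, if_neg]
          · rfl
          · rintro ⟨rfl, rfl⟩
            exact huv rfl
      exact h1
    have h2 := DFunLike.congr_fun this x
    refine Eq.trans h2 ?_
    split_ifs <;> rfl
  have hx0 : ∃ u, ⟪ξ u, x⟫_ℂ ≠ 0 := by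
    by_contra! hne
    refine h0 (LAlg_ext ?_)
    refine ext_inner_ξ fun w => ?_
    rw [← hx, hne w]
    exact (inner_zero_right _).symm
  obtain ⟨u, hu⟩ := hx0
  have hu1 : ⟪ξ u, x⟫_ℂ = 1 := by
    have := hc u u
    rw [if_pos rfl] at this
    exact mul_left_cancel₀ hu (this.trans (mul_one _).symm)
  refine ⟨u, LAlg_ext (ext_inner_ξ fun v => ?_)⟩
  rw [← hx, LHom_coe, Lop_ξ, mul_one, inner_ξ_ξ]
  have := hc v u
  rw [hu1, mul_one] at this
  rw [this]
  split_ifs with hv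
  · rw [hv, hu1]
  · rfl

/-- An automorphism of a free monoid permutes the generators. -/
theorem exists_perm_of_bijective {ι : Type*} [Finite ι] (f : FreeMonoid ι →* FreeMonoid ι)
    (hf : Function.Bijective f) : ∃ τ : Equiv.Perm ι, f = FreeMonoid.map τ := by
  have hletter : ∀ i, ∃ j, f (FreeMonoid.of i) = FreeMonoid.of j := by
    intro i
    have hne : f (FreeMonoid.of i) ≠ 1 := fun h =>
      FreeMonoid.of_ne_one i (hf.1 (h.trans (map_one f).symm))
    obtain ⟨w, hw⟩ : ∃ w, f (FreeMonoid.of i) = w := ⟨_, rfl⟩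
    cases w using FreeMonoid.casesOn with
    | one => exact absurd hw hne
    | of_mul j w =>
      -- Pulling the factorisation `j · w` back by surjectivity writes the letter `i` as `u v`, and
      -- lengths force one factor to be empty.
      obtain ⟨u, hu⟩ := hf.2 (FreeMonoid.of j)
      obtain ⟨v, rfl⟩ := hf.2 w
      rw [← hu, ← map_mul] at hw
      have hlen := congrArg FreeMonoid.length (hf.1 hw)
      rw [FreeMonoid.length_of, FreeMonoid.length_mul] at hlen
      obtain h0 | h0 : u.length = 0 ∨ v.length = 0 := by omega
      · rw [FreeMonoid.length_eq_zero] at h0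
        rw [h0, map_one] at hu
        exact absurd hu.symm (FreeMonoid.of_ne_one j)
      · rw [FreeMonoid.length_eq_zero] at h0
        exact ⟨j, by rw [hw, h0, mul_one, hu]⟩
  choose t ht using hletter
  have hinj : Function.Injective t := fun i j h =>
    FreeMonoid.of_injective (hf.1 (by rw [ht, ht, h]))
  refine ⟨Equiv.ofBijective t (Finite.injective_iff_bijective.1 hinj), ?_⟩
  refine FreeMonoid.hom_eq fun i => ?_
  rw [ht, FreeMonoid.map_of]
  rfl

theorem exists_perm_of_isHopfDualAut (h : IsHopfDualAut (LAlg d) (comul d) α) :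
    ∃ τ : Equiv.Perm (Fin d), ∀ A : LAlg d,
      (α A).1 = permUnitary τ ∘L A.1 ∘L permUnitary τ⁻¹ := by
  have hne : ∀ w, α (LHom d w) ≠ 0 := by
    intro w hw
    have h1 : LHom d w = 0 := h.bijective.1 (by rw [hw, map_zero])
    have h2 : (ξ w : Fock d) = 0 := by
      have := congrArg (fun A : LAlg d => A.1 (ξ 1)) h1
      simpa [LHom_coe] using this
    have h3 := norm_ξ w
    rw [h2, norm_zero] at h3
    exact zero_ne_one h3
  choose f hf using fun w => exists_eq_LHom_of_grouplike (hne w) (h.grouplike (comul_LHom w))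
  let F : FreeMonoid (Fin d) →* FreeMonoid (Fin d) :=
    { toFun := f
      map_one' := LHom_injective (by rw [← hf, map_one, h.map_one])
      map_mul' := fun u v => LHom_injective (by rw [← hf, map_mul, h.map_mul, hf, hf, map_mul]) }
  have hbij : Function.Bijective F := by
    constructor
    · intro u v huv
      refine LHom_injective (h.bijective.1 ?_)
      rw [hf, hf]
      exact congrArg (LHom d) huv
    · intro v
      by_contra! hv
      -- The coefficient functional at a missed word `v` would vanish on the range of `α`, which is
      -- everything, although it is `1` at `L_v`.
      let φ : Predual (LAlg d) := vecPredual (LAlg d) (ξ 1) (ξ v)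
      have hφL : ∀ w, φ.1 (LHom d w) = if v = w then 1 else 0 := by
        intro w
        change ⟪ξ v, (LHom d w).1 (ξ 1)⟫_ℂ = _
        rw [LHom_coe, Lop_ξ, mul_one, inner_ξ_ξ]
      have hφ : φ = 0 := by
        refine h.eq_zero fun A => ?_
        refine eq_zero_of_LHom (f := φ.1.toLinearMap ∘ₗ α)
          (continuous_comp (g := φ.1) φ.2 h.continuous) (fun w => ?_) A
        change φ.1 (α (LHom d w)) = 0
        rw [hf, hφL, if_neg fun h => hv w h.symm]
      have h1 := hφL v
      rw [if_pos rfl, hφ] at h1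
      exact zero_ne_one h1
  obtain ⟨τ, hτ⟩ := exists_perm_of_bijective F hbij
  refine ⟨τ, fun A => ContinuousLinearMap.ext fun x => ext_inner_left ℂ fun y => ?_⟩
  refine sub_eq_zero.1 ?_
  let φ := vecPredual (LAlg d) x y
  refine eq_zero_of_LHom (f := φ.1.toLinearMap ∘ₗ α - innerFunctional x y ∘ₗ
    sandwich (permUnitary τ⁻¹) (permUnitary τ) ∘ₗ (LAlg d).val.toLinearMap)
    (continuous_fun_sub (continuous_comp (g := φ.1) φ.2 h.continuous)
      (continuous_comp (g := innerFunctional x y) (continuous_innerFunctional x y)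
        (continuous_sandwich_val _ _ _))) (fun w => ?_) A
  change ⟪y, (α (LHom d w)).1 x⟫_ℂ - ⟪y, (permUnitary τ ∘L Lop w ∘L permUnitary τ⁻¹) x⟫_ℂ = 0
  have hw : f w = FreeMonoid.map τ w := DFunLike.congr_fun hτ w
  rw [hf, hw, conj_Lop, LHom_coe, sub_self]

end

end NCToeplitz

end

theorem theorem6p3 (d : ℕ) :
    (∀ (J : TwoSidedIdeal (LAlg d)), IsHomogeneousHopfIdeal J →
      ∀ (θ : Predual (LJ J) →L[ℂ] Predual (LJ J)) (θs : LJ J →ₗ[ℂ] LJ J),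
        (∀ (φ : Predual (LJ J)) (A : LJ J), (θ φ).1 A = φ.1 (θs A)) →
        List.TFAE [
          IsHopfConvolutionAut (LJ J) (comulJ J) θ,
          IsHopfDualAut (LJ J) (comulJ J) θs,
          ∃ σ : Semi J ≃* Semi J, σ 1 = 1 ∧ σ 0 = 0 ∧ ∀ s : Semi J, θs (Ls J s) = Ls J (σ s)]) ∧
    (∀ α : LAlg d →ₗ[ℂ] LAlg d,
      IsHopfDualAut (LAlg d) (comul d) α ↔
        ∃ τ : Equiv.Perm (Fin d), ∀ A : LAlg d,
          (α A : Fock d →L[ℂ] Fock d) =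
            permUnitary τ ∘L (A : Fock d →L[ℂ] Fock d) ∘L
              ContinuousLinearMap.adjoint (permUnitary τ)) := by
  refine ⟨fun J hJ θ θs hθ => ?_, fun α => ?_⟩
  · tfae_have 1 → 3 := exists_semigroup_aut_of_isHopfConvolutionAut hJ hθ
    tfae_have 2 → 3 := exists_semigroup_aut_of_isHopfDualAut hJ hθ
    tfae_have 3 → 1 := fun ⟨_, _, hσ0, hσ⟩ => (isHopfAut_of_semigroup_aut hJ hσ0 hθ hσ).1
    tfae_have 3 → 2 := fun ⟨_, _, hσ0, hσ⟩ => (isHopfAut_of_semigroup_aut hJ hσ0 hθ hσ).2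
    tfae_finish
  · simp only [adjoint_permUnitary]
    exact ⟨exists_perm_of_isHopfDualAut, fun ⟨_, hτ⟩ => isHopfDualAut_of_perm hτ⟩
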